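/- **Theorem.** Let $N\ge 1$ be an integer and $-1<\gamma<1$. Put $\sigma(z)=-\frac{1-\gamma}{2}$ for $z>0$ and $\sigma(z)=-\frac{1+\gamma}{2}$ for $z\le 0$. For every $\alpha>0$ the singular Cauchy problem $$f''+\frac{N-1}{\eta}f'=\sigma(\alpha f+\eta f')\,(\alpha f+\eta f')\quad(\eta>0),\qquad f(0)=1,\quad f'(0)=0,$$ has exactly one solution $f(\cdot;\alpha)\in C^1([0,\infty))\cap C^2((0,\infty))$. (These are the normalized profiles of the radial self-similar solutions $u(x,t)=t^{-\alpha/2}f(\|x\|/\sqrt t;\alpha)$ of the Barenblatt equation $u_t+\gamma|u_t|=\Delta u$ in $\mathbb R^N\times(0,\infty)$.) There is an increasing, unbounded sequence of exponents $0<\alpha_0<\alpha_1<\alpha_2<\cdots$ such that: 1. for every $k\ge 0$ there is a constant $D\ne 0$ with $$f(\eta;\alpha_k)\sim D\,\eta^{\alpha_k-N}\exp\Bigl(-\tfrac{1+(-1)^k\gamma}{4}\,\eta^2\Bigr)\qquad(\eta\to\infty);$$ 2. for every $\alpha>0$ with $\alpha\notin\{\alpha_0,\alpha_1,\dots\}$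 there is a constant $C\neq 0$ with $f(\eta;\alpha)\sim C\,\eta^{-\alpha}$ as $\eta\to\infty$; 3. for every $m\ge 0$ and every $\alpha>0$, one has $\alpha=\alpha_m$ if and only if the equation $\eta f'(\eta;\alpha)+\alpha f(\eta;\alpha)=0$ has exactly $m+1$ positive roots $\eta_1<\dots<\eta_{m+1}$ and these satisfy $$M\Bigl(\tfrac{N-\alpha}{2}-1,\tfrac N2;\tfrac{1-\gamma}{4}\eta_1^2\Bigr)=0,\qquad U\Bigl(\tfrac{N-\alpha}{2}-1,\tfrac N2;\tfrac{1+(-1)^m\gamma}{4}\eta_{m+1}^2\Bigr)=0,$$ and, if $\frac{N-\alpha}{2}\notin\{0,-1,-2,\dots\}$, $$M\Bigl(\tfrac{N-\alpha}{2}-1,\tfrac N2;\tfrac{1+(-1)^m\gamma}{4}\eta_{m+1}^2\Bigr)\cdot\Gamma\Bigl(\tfrac{N-\alpha}{2}\Bigr)>0.$$ Here $M(a,b;z)=\sum_{k\ge0}\frac{(a)_k}{(b)_k}\frac{z^k}{k!}$ is Kummer's function, and $U(a,b;\cdot)$ is Tricomi's function, i.e. the unique solution on $(0,\infty)$ of $zw''+(b-z)w'-aw=0$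 with $w(z)\sim z^{-a}$ as $z\to\infty$. The symbol $g\sim h$ means $g(\eta)/h(\eta)\to1$. -/

import Mathlib

open Filter Topology Asymptotics

noncomputable section

/-- The two-valued coefficient of the profile equation. -/
def sigmaCoeff (γ z : ℝ) : ℝ :=
  if 0 < z then -(1 - γ) / 2 else -(1 + γ) / 2

/-- `f` solves the singular Cauchy problem
`f'' + ((N - 1) / η) f' = σ(α f + η f') (α f + η f')` for `η > 0`, `f(0) = 1`, `f'(0) = 0`,
in the class of functions that are `C¹` on `[0, ∞)` and `C²` on `(0, ∞)`
(continuity of the second derivative is a consequence of the equation).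
Only the values of `f` on `[0, ∞)` matter. -/
structure IsProfile (N : ℕ) (γ α : ℝ) (f : ℝ → ℝ) : Prop where
  initial_value : f 0 = 1
  initial_slope : HasDerivWithinAt f 0 (Set.Ici 0) 0
  slope_tendsto : Tendsto (deriv f) (𝓝[>] 0) (𝓝 0)
  differentiable : ∀ η : ℝ, 0 < η → DifferentiableAt ℝ f η
  differentiable_deriv : ∀ η : ℝ, 0 < η → DifferentiableAt ℝ (deriv f) η
  equation : ∀ η : ℝ, 0 < η →
    deriv (deriv f) η + ((N : ℝ) - 1) / η * deriv f η
      = sigmaCoeff γ (α * f η + η * deriv f η) * (α * f η + η * deriv f η)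

/-- The set of positive roots of `η f'(η) + α f(η) = 0`. -/
def criticalRoots (α : ℝ) (f : ℝ → ℝ) : Set ℝ :=
  {η : ℝ | 0 < η ∧ η * deriv f η + α * f η = 0}

/-- Kummer's function `M(a, b; z) = ∑ (a)_k z^k / ((b)_k k!)`, for `b` not in `{0, -1, -2, …}`. -/
def kummerM (a b z : ℝ) : ℝ :=
  ∑' k : ℕ, (ascPochhammer ℝ k).eval a / (ascPochhammer ℝ k).eval b
    * z ^ k / (k.factorial : ℝ)

/-- `U` is, on `(0, ∞)`, Tricomi's function `U(a, b; ·)`: the solution of Kummer's equation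
`z w'' + (b - z) w' - a w = 0` on `(0, ∞)` with `w(z) ~ z^(-a)` as `z → ∞`. Such a solution exists
and is unique for all real `a`, `b`, because every solution that is not a multiple of it grows
like `z^(a - b) e^z`. -/
structure IsTricomi (a b : ℝ) (U : ℝ → ℝ) : Prop where
  differentiable : ∀ z : ℝ, 0 < z → DifferentiableAt ℝ U z
  differentiable_deriv : ∀ z : ℝ, 0 < z → DifferentiableAt ℝ (deriv U) z
  equation : ∀ z : ℝ, 0 < z → z * deriv (deriv U) z + (b - z) * deriv U z - a * U z = 0
  normalization : Tendsto (fun z : ℝ => z ^ a * U z) atTop (𝓝 1)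

/-- The conditions, for a profile `f` with parameter `α`, by which the `m`-th exponent is
determined: `η f' + α f = 0` has exactly `m + 1` positive roots `η₁ < ⋯ < η_{m+1}`, and with
`a = (N - α) / 2 - 1`, `b = N / 2`, `κ = (1 + (-1)^m γ) / 4`,
`M(a, b; (1 - γ) η₁² / 4) = 0`, `U(a, b; κ η_{m+1}²) = 0` and, unless `(N - α) / 2` is a pole of
the Gamma function, `M(a, b; κ η_{m+1}²) Γ((N - α) / 2) > 0`. -/
def ExponentSystem (N : ℕ) (γ α : ℝ) (m : ℕ) (f : ℝ → ℝ) : Prop :=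
  ∃ r : Fin (m + 1) → ℝ, StrictMono r ∧ Set.range r = criticalRoots α f ∧
    kummerM (((N : ℝ) - α) / 2 - 1) ((N : ℝ) / 2) ((1 - γ) / 4 * r 0 ^ 2) = 0 ∧
    (∃ U : ℝ → ℝ, IsTricomi (((N : ℝ) - α) / 2 - 1) ((N : ℝ) / 2) U ∧
      U ((1 + (-1) ^ m * γ) / 4 * r (Fin.last m) ^ 2) = 0) ∧
    ((∀ l : ℕ, ((N : ℝ) - α) / 2 ≠ -(l : ℝ)) →
      0 < kummerM (((N : ℝ) - α) / 2 - 1) ((N : ℝ) / 2)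
            ((1 + (-1) ^ m * γ) / 4 * r (Fin.last m) ^ 2)
          * Real.Gamma (((N : ℝ) - α) / 2))

end

/-!
The object to study is `W = (α f + η f') / α`, whose zeros are the positive roots of
`η f' + α f = 0`. With `h = f' / α` the Cauchy problem becomes `W = 1 + α ∫ h + η h`,
`(η^(N-1) h)' = η^(N-1) σ(W) W`, a fixed point equation that makes sense for every real `α`. Since
`x ↦ σ(x) x` is Lipschitz, it is solved by contraction in a norm with weight `exp (-K η²)`
(`exists_profileOp_eq`), uniquely (`IsProfile.eqOn`) and continuously in `α`
(`continuous_profileW`).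

Where `W` has the sign `s = ±1`, the equation is linear: with `c = (1 - s γ) / 2`, the function `W`
solves `y'' + ((N - 1) / η + c η) y' + c β y = 0` for `β = α + 2`, and beyond the last zero `f` solves
it for `β = α`. The substitution `y = exp (-z) w(z)`, `z = c η² / 2`, turns it into Kummer's equation
with `a = (N - β) / 2`, `b = N / 2`. Hence `W` is given by `M` up to its first zero, and at infinity
there is a dichotomy (`ZoneSol.exists_tendsto`): either `η^β y` has a nonzero limit, or `y` is a
multiple of `exp (-z) U(z)`. The sign of `M` at the last zero of `U` follows from the Wronskian of `M`
and `U` and from the growth of `Γ(a) M` at infinity (`kummerM_mul_gamma_pos`).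

The exponents are found by counting zeros of `W`, which are simple and finite in number.
* By Sturm comparison the zeros move to the left as `α` grows (`IsNode.exists_le_of_lt`). If `W` has
  Gaussian decay at `α`, then every larger exponent has at least one more zero
  (`IsNode.exists_succ_of_decay`).
* Under a small change of `α` the zeros in a bounded interval persist and do not split. Powers
  `η^(-A)` with `A > α + 2` are supersolutions far out, and `W` cannot change sign any more once it
  lies above one of them (`pos_of_trapped`). So at most one new zero comes from infinity
  (`eventually_not_exists_node`), and none if `η^(α+2) W` does not tend to zero
  (`eventually_not_exists_succ_node`).
* For large `α` there are arbitrarily many zeros (`exists_node_of_large`).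

Therefore the infimum `criticalExponent N γ m` of the exponents with at least `m + 2` zeros is the only
exponent for which `W` has exactly `m + 1` zeros and decays like a Gaussian (`eq_criticalExponent_iff`).
This gives monotonicity and unboundedness. Positivity is clear for `N ≥ 2`, since there are no zeros
for `α ≤ N - 2`; for `N = 1` it holds because `W` has at most one zero and no fast decay at `α = 0`.
Finally the decay of `f` and of `W` are equivalent (`profile_decay_iff`), and the decay of `W` is
equivalent to the vanishing of `U` at the last zero.
-/

open Filter Topology Asymptotics

noncomputable section

/-! ### The integral equation -/

/-- The right-hand side `σ(x) x` of the profile equation. -/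
def flux (γ x : ℝ) : ℝ := sigmaCoeff γ x * x

lemma flux_sub_le {γ : ℝ} (hγ : -1 < γ) (hγ' : γ < 1) (x y : ℝ) :
    |flux γ x - flux γ y| ≤ |x - y| := by
  have key : ∀ x y : ℝ, y ≤ x → |flux γ x - flux γ y| ≤ x - y := by
    intro x y h
    unfold flux sigmaCoeff
    rw [abs_le]
    split_ifs <;> constructor <;> nlinarith
  rcases le_total y x with h | h
  · exact (key x y h).trans (le_abs_self _)
  · rw [abs_sub_comm, abs_sub_comm x y]
    exact (key y x h).trans (le_abs_self _)

lemma flux_zero (γ : ℝ) : flux γ 0 = 0 := by simp [flux]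

lemma abs_flux_le {γ : ℝ} (hγ : -1 < γ) (hγ' : γ < 1) (x : ℝ) : |flux γ x| ≤ |x| := by
  simpa [flux_zero] using flux_sub_le hγ hγ' x 0

lemma continuous_flux {γ : ℝ} (hγ : -1 < γ) (hγ' : γ < 1) : Continuous (flux γ) := by
  have : LipschitzWith 1 (flux γ) := by
    refine LipschitzWith.of_dist_le_mul fun x y => ?_
    simpa [Real.dist_eq] using flux_sub_le hγ hγ' x y
  exact this.continuous

lemma flux_mul {γ a : ℝ} (ha : 0 < a) (x : ℝ) : flux γ (a * x) = a * flux γ x := by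
  have : 0 < a * x ↔ 0 < x := by simp [ha]
  simp only [flux, sigmaCoeff, this]
  ring

/-- The weighted mean `∫₀¹ τ^k u(τη) dτ` of `u` over the segment from `0` to `η`. For `η ≠ 0` it
is `η^(-k-1) ∫₀^η s^k u(s) ds`, but this form has no singularity at `η = 0`. -/
def radialMean (k : ℕ) (u : ℝ → ℝ) (η : ℝ) : ℝ :=
  ∫ τ in (0 : ℝ)..1, τ ^ k * u (τ * η)

lemma continuous_radialMean {X : Type*} [TopologicalSpace X] (k : ℕ) {u : X → ℝ → ℝ}
    (hu : Continuous fun p : X × ℝ => u p.1 p.2) :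
    Continuous fun p : X × ℝ => radialMean k (u p.1) p.2 := by
  unfold radialMean
  apply intervalIntegral.continuous_parametric_intervalIntegral_of_continuous'
  have h1 : Continuous fun q : (X × ℝ) × ℝ => u q.1.1 (q.2 * q.1.2) :=
    hu.comp (by fun_prop : Continuous fun q : (X × ℝ) × ℝ => (q.1.1, q.2 * q.1.2))
  exact (by fun_prop : Continuous fun q : (X × ℝ) × ℝ => q.2 ^ k).mul h1

lemma Continuous.radialMean (k : ℕ) {u : ℝ → ℝ} (hu : Continuous u) :
    Continuous (radialMean k u) := by
  have := continuous_radialMean (X := Unit) k (u := fun _ => u) (hu.comp continuous_snd)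
  exact this.comp (by fun_prop : Continuous fun η : ℝ => ((), η))

lemma radialMean_sub (k : ℕ) {u v : ℝ → ℝ} (hu : Continuous u) (hv : Continuous v) (η : ℝ) :
    radialMean k u η - radialMean k v η = radialMean k (fun s => u s - v s) η := by
  unfold radialMean
  rw [← intervalIntegral.integral_sub]
  · simp only [mul_sub]
  · exact (by fun_prop : Continuous fun τ : ℝ => τ ^ k * u (τ * η)).intervalIntegrable _ _
  · exact (by fun_prop : Continuous fun τ : ℝ => τ ^ k * v (τ * η)).intervalIntegrable _ _

lemma pow_mul_radialMean (k : ℕ) (u : ℝ → ℝ) (η : ℝ) :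
    η ^ (k + 1) * radialMean k u η = ∫ s in (0 : ℝ)..η, s ^ k * u s := by
  have h := intervalIntegral.mul_integral_comp_mul_right (a := 0) (b := 1)
    (f := fun s : ℝ => s ^ k * u s) η
  rw [zero_mul, one_mul] at h
  rw [← h, radialMean, pow_succ, mul_comm (η ^ k), mul_assoc,
    ← intervalIntegral.integral_const_mul]
  congr 1
  apply intervalIntegral.integral_congr
  intro τ _
  simp only [mul_pow]
  ring

lemma hasDerivAt_pow_mul_radialMean (k : ℕ) {u : ℝ → ℝ} (hu : Continuous u) (η : ℝ) :
    HasDerivAt (fun x => x ^ (k + 1) * radialMean k u x) (η ^ k * u η) η := by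
  have h : (fun x => x ^ (k + 1) * radialMean k u x) = fun x => ∫ s in (0 : ℝ)..x, s ^ k * u s :=
    funext fun x => pow_mul_radialMean k u x
  rw [h]
  have hc : Continuous fun s : ℝ => s ^ k * u s := by fun_prop
  exact intervalIntegral.integral_hasDerivAt_right (hc.intervalIntegrable _ _)
    (hc.stronglyMeasurableAtFilter _ _) hc.continuousAt

lemma integral_exp_mul_le_exp {x : ℝ} (hx : 0 ≤ x) :
    ∫ τ in (0 : ℝ)..1, Real.exp (τ * x) ≤ Real.exp x := by
  have : ∫ τ in (0 : ℝ)..1, Real.exp (τ * x) ≤ ∫ τ in (0 : ℝ)..1, Real.exp x := by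
    apply intervalIntegral.integral_mono_on zero_le_one
    · exact (by fun_prop : Continuous fun τ : ℝ => Real.exp (τ * x)).intervalIntegrable _ _
    · simp
    · intro τ hτ
      exact Real.exp_le_exp.2 (by nlinarith [hτ.1, hτ.2])
  simpa using this

lemma abs_radialMean_le (k : ℕ) {u : ℝ → ℝ} {K m η : ℝ} (hK : 0 < K)
    (h : ∀ τ ∈ Set.Icc (0 : ℝ) 1, |u (τ * η)| ≤ m * Real.exp (K * (τ * η) ^ 2)) :
    |radialMean k u η| ≤ m * ∫ τ in (0 : ℝ)..1, Real.exp (τ * (K * η ^ 2)) := by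
  have hm : 0 ≤ m := by
    have := h 0 (by simp)
    simp at this
    exact (abs_nonneg _).trans this
  unfold radialMean
  rw [← intervalIntegral.integral_const_mul, ← Real.norm_eq_abs]
  apply intervalIntegral.norm_integral_le_of_norm_le zero_le_one
  · refine Filter.Eventually.of_forall fun τ hτ => ?_
    have hτ' : τ ∈ Set.Icc (0 : ℝ) 1 := ⟨hτ.1.le, hτ.2⟩
    rw [Real.norm_eq_abs, abs_mul, abs_of_nonneg (pow_nonneg hτ'.1 _)]
    have h1 : τ ^ k ≤ 1 := pow_le_one₀ hτ'.1 hτ'.2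
    have h2 := h τ hτ'
    have h3 : Real.exp (K * (τ * η) ^ 2) ≤ Real.exp (τ * (K * η ^ 2)) := by
      apply Real.exp_le_exp.2
      have : 0 ≤ K * η ^ 2 * (τ * (1 - τ)) :=
        mul_nonneg (by positivity) (mul_nonneg hτ'.1 (by linarith [hτ'.2]))
      nlinarith
    calc τ ^ k * |u (τ * η)| ≤ 1 * |u (τ * η)| := by gcongr
      _ ≤ m * Real.exp (K * (τ * η) ^ 2) := by rw [one_mul]; exact h2
      _ ≤ _ := by gcongr
  · exact (by fun_prop : Continuous fun τ : ℝ => m * Real.exp (τ * (K * η ^ 2))).intervalIntegrable _ _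

lemma abs_radialMean_le_exp (k : ℕ) {u : ℝ → ℝ} {K m η : ℝ} (hK : 0 < K)
    (h : ∀ τ ∈ Set.Icc (0 : ℝ) 1, |u (τ * η)| ≤ m * Real.exp (K * (τ * η) ^ 2)) :
    |radialMean k u η| ≤ m * Real.exp (K * η ^ 2) := by
  have hm : 0 ≤ m := by
    have := h 0 (by simp)
    simp at this
    exact (abs_nonneg _).trans this
  refine (abs_radialMean_le k hK h).trans ?_
  gcongr
  exact integral_exp_mul_le_exp (by positivity)

/-- The factor `1 / K` gained here is what makes the integral operator a contraction for the
norm with weight `exp (-K η²)`. -/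
lemma abs_sq_mul_radialMean_le (k : ℕ) {u : ℝ → ℝ} {K m η : ℝ} (hK : 0 < K)
    (h : ∀ τ ∈ Set.Icc (0 : ℝ) 1, |u (τ * η)| ≤ m * Real.exp (K * (τ * η) ^ 2)) :
    |η ^ 2 * radialMean k u η| ≤ m / K * Real.exp (K * η ^ 2) := by
  have hm : 0 ≤ m := by
    have := h 0 (by simp)
    simp at this
    exact (abs_nonneg _).trans this
  have h1 := abs_radialMean_le k hK h
  have h2 := intervalIntegral.mul_integral_comp_mul_right (a := 0) (b := 1)
    (f := Real.exp) (K * η ^ 2)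
  rw [integral_exp] at h2
  simp only [zero_mul, one_mul, Real.exp_zero] at h2
  rw [abs_mul, abs_of_nonneg (sq_nonneg η)]
  calc η ^ 2 * |radialMean k u η|
      ≤ η ^ 2 * (m * ∫ τ in (0 : ℝ)..1, Real.exp (τ * (K * η ^ 2))) := by gcongr
    _ = m / K * (K * η ^ 2 * ∫ τ in (0 : ℝ)..1, Real.exp (τ * (K * η ^ 2))) := by
        generalize (∫ τ in (0 : ℝ)..1, Real.exp (τ * (K * η ^ 2))) = I
        field_simp
    _ = m / K * (Real.exp (K * η ^ 2) - 1) := by rw [h2]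
    _ ≤ _ := by gcongr; linarith

/-- The integral operator whose fixed point is `W = (α f + η f') / α`: with
`h(η) = η^(1-N) ∫₀^η s^(N-1) σ(W) W ds` and `g = ∫₀^η h`, it sends `W` to `1 + α g + η h`. -/
def profileOp (N : ℕ) (γ α : ℝ) (u : ℝ → ℝ) (η : ℝ) : ℝ :=
  1 + (α * (η ^ 2 * radialMean 1 (radialMean (N - 1) fun s => flux γ (u s)) η)
    + η ^ 2 * radialMean (N - 1) (fun s => flux γ (u s)) η)

lemma continuous_profileOp (N : ℕ) {γ : ℝ} (hγ : -1 < γ) (hγ' : γ < 1) (α : ℝ) {u : ℝ → ℝ}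
    (hu : Continuous u) : Continuous (profileOp N γ α u) := by
  have h0 : Continuous fun s => flux γ (u s) := (continuous_flux hγ hγ').comp hu
  have h1 := h0.radialMean (N - 1)
  have h2 := h1.radialMean 1
  unfold profileOp
  fun_prop

lemma abs_profileOp_sub_le (N : ℕ) {γ : ℝ} (hγ : -1 < γ) (hγ' : γ < 1) (α : ℝ) {u v : ℝ → ℝ}
    (hu : Continuous u) (hv : Continuous v) {K m η : ℝ} (hK : 0 < K)
    (h : ∀ τ ∈ Set.Icc (0 : ℝ) 1,
      |u (τ * η) - v (τ * η)| ≤ m * Real.exp (K * (τ * η) ^ 2)) :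
    |profileOp N γ α u η - profileOp N γ α v η| ≤ (|α| + 1) / K * (m * Real.exp (K * η ^ 2)) := by
  have hu0 : Continuous fun s => flux γ (u s) := (continuous_flux hγ hγ').comp hu
  have hv0 : Continuous fun s => flux γ (v s) := (continuous_flux hγ hγ').comp hv
  have hu1 := hu0.radialMean (N - 1)
  have hv1 := hv0.radialMean (N - 1)
  have e1 := radialMean_sub (N - 1) hu0 hv0
  have e2 := radialMean_sub 1 hu1 hv1 η
  have b0 : ∀ τ ∈ Set.Icc (0 : ℝ) 1, |flux γ (u (τ * η)) - flux γ (v (τ * η))|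
      ≤ m * Real.exp (K * (τ * η) ^ 2) := fun τ hτ => (flux_sub_le hγ hγ' _ _).trans (h τ hτ)
  have b1 := abs_sq_mul_radialMean_le (N - 1)
    (u := fun s => flux γ (u s) - flux γ (v s)) hK b0
  have b2 : ∀ τ ∈ Set.Icc (0 : ℝ) 1,
      |radialMean (N - 1) (fun s => flux γ (u s)) (τ * η)
        - radialMean (N - 1) (fun s => flux γ (v s)) (τ * η)|
      ≤ m * Real.exp (K * (τ * η) ^ 2) := by
    intro τ hτ
    rw [e1]
    apply abs_radialMean_le_exp (N - 1) hK
    intro t ht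
    have := b0 (t * τ) ⟨mul_nonneg ht.1 hτ.1, mul_le_one₀ ht.2 hτ.1 hτ.2⟩
    simpa only [mul_assoc] using this
  have b3 := abs_sq_mul_radialMean_le 1
    (u := fun s => radialMean (N - 1) (fun s => flux γ (u s)) s
        - radialMean (N - 1) (fun s => flux γ (v s)) s) hK b2
  have e : profileOp N γ α u η - profileOp N γ α v η
      = α * (η ^ 2 * radialMean 1 (fun s => radialMean (N - 1) (fun s => flux γ (u s)) s
        - radialMean (N - 1) (fun s => flux γ (v s)) s) η)
        + η ^ 2 * radialMean (N - 1) (fun s => flux γ (u s) - flux γ (v s)) η := by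
    rw [← e1, ← e2]
    unfold profileOp
    ring
  rw [e]
  refine (abs_add_le _ _).trans ?_
  rw [abs_mul]
  have := mul_le_mul_of_nonneg_left b3 (abs_nonneg α)
  calc _ ≤ |α| * (m / K * Real.exp (K * η ^ 2)) + m / K * Real.exp (K * η ^ 2) := add_le_add this b1
    _ = _ := by ring

/-- Two fixed points for different parameters stay close, with a constant that depends on the
first only. For equal parameters this is uniqueness. -/
lemma abs_sub_le_of_profileOp_eq (N : ℕ) {γ : ℝ} (hγ : -1 < γ) (hγ' : γ < 1) {α α' : ℝ}
    {u v : ℝ → ℝ} (hu : Continuous u) (hv : Continuous v) {S : Set ℝ} (hS : IsCompact S)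
    (hstar : ∀ η ∈ S, ∀ τ ∈ Set.Icc (0 : ℝ) 1, τ * η ∈ S)
    (hu' : ∀ η ∈ S, u η = profileOp N γ α u η) (hv' : ∀ η ∈ S, v η = profileOp N γ α' v η)
    {K B : ℝ} (hK : 2 * (|α'| + 1) ≤ K)
    (hB : ∀ η ∈ S,
      |η ^ 2 * radialMean 1 (radialMean (N - 1) fun s => flux γ (u s)) η| ≤ B) :
    ∀ η ∈ S, |u η - v η| ≤ 2 * (|α - α'| * B) * Real.exp (K * η ^ 2) := by
  intro η₀ hη₀
  have hK0 : 0 < K := by have := abs_nonneg α'; linarith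
  have hcont : Continuous fun η => |u η - v η| * Real.exp (-(K * η ^ 2)) := by fun_prop
  obtain ⟨x, hx, hmax⟩ := hS.exists_isMaxOn ⟨η₀, hη₀⟩ hcont.continuousOn
  -- `m` is the weighted distance of `u` and `v` on `S`, attained at `x`
  set m := |u x - v x| * Real.exp (-(K * x ^ 2)) with hm
  have hb : ∀ η ∈ S, |u η - v η| ≤ m * Real.exp (K * η ^ 2) := by
    intro η hη
    have h1 : |u η - v η| * Real.exp (-(K * η ^ 2)) ≤ m := hmax hη
    rw [Real.exp_neg] at h1
    have := Real.exp_pos (K * η ^ 2)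
    rwa [← div_eq_mul_inv, div_le_iff₀ this] at h1
  have hBn : 0 ≤ B := (abs_nonneg _).trans (hB x hx)
  have hmx : |u x - v x| = m * Real.exp (K * x ^ 2) := by
    rw [hm, mul_assoc, ← Real.exp_add]; simp
  have hm0 : 0 ≤ m := by positivity
  have hd := abs_profileOp_sub_le N hγ hγ' α' hu hv (η := x) (m := m) hK0
    fun τ hτ => hb _ (hstar x hx τ hτ)
  have e : u x - v x = (α - α') * (x ^ 2 * radialMean 1 (radialMean (N - 1)
      fun s => flux γ (u s)) x) + (profileOp N γ α' u x - profileOp N γ α' v x) := by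
    rw [← hv' x hx]
    nth_rw 1 [hu' x hx]
    unfold profileOp
    ring
  have h1 : |u x - v x| ≤ |α - α'| * B + 1 / 2 * (m * Real.exp (K * x ^ 2)) := by
    rw [e]
    refine (abs_add_le _ _).trans (add_le_add ?_ (hd.trans ?_))
    · rw [abs_mul]
      exact mul_le_mul_of_nonneg_left (hB x hx) (abs_nonneg _)
    · have : (|α'| + 1) / K ≤ 1 / 2 := by rw [div_le_iff₀ hK0]; linarith
      exact mul_le_mul_of_nonneg_right this (by positivity)
  rw [hmx] at h1
  have h2 : 1 ≤ Real.exp (K * x ^ 2) := Real.one_le_exp (by positivity)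
  have h3 : m ≤ 2 * (|α - α'| * B) := by nlinarith
  exact (hb η₀ hη₀).trans (by gcongr)

open BoundedContinuousFunction in
/-- Banach's fixed point theorem in the space of functions `exp (K η²) φ` with `φ` bounded. -/
lemma exists_profileOp_eq (N : ℕ) {γ : ℝ} (hγ : -1 < γ) (hγ' : γ < 1) (α : ℝ) :
    ∃ u : ℝ → ℝ, Continuous u ∧ ∀ η, u η = profileOp N γ α u η := by
  set K : ℝ := 2 * (|α| + 1) with hKd
  have hK : 0 < K := by positivity
  have hq : (|α| + 1) / K = 1 / 2 := by rw [hKd]; field_simp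
  let lift : (ℝ →ᵇ ℝ) → ℝ → ℝ := fun φ η => Real.exp (K * η ^ 2) * φ η
  have hlift : ∀ φ, Continuous (lift φ) := fun φ => by
    have := φ.continuous
    fun_prop
  have hdiff : ∀ φ ψ : ℝ →ᵇ ℝ, ∀ s, |lift φ s - lift ψ s| ≤ dist φ ψ * Real.exp (K * s ^ 2) := by
    intro φ ψ s
    have h1 := BoundedContinuousFunction.dist_coe_le_dist (f := φ) (g := ψ) s
    rw [Real.dist_eq] at h1
    simp only [lift, ← mul_sub, abs_mul, Real.abs_exp]
    rw [mul_comm]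
    gcongr
  have hone : ∀ η, profileOp N γ α (fun _ => 0) η = 1 := by
    intro η
    simp [profileOp, radialMean, flux_zero]
  have hbd : ∀ φ : ℝ →ᵇ ℝ, ∀ η,
      ‖Real.exp (-(K * η ^ 2)) * profileOp N γ α (lift φ) η‖ ≤ 1 + 1 / 2 * ‖φ‖ := by
    intro φ η
    have h1 := abs_profileOp_sub_le N hγ hγ' α (hlift φ) (hlift 0) (η := η)
      (m := ‖φ‖) hK (fun τ _ => by simpa using hdiff φ 0 (τ * η))
    have h0 : lift 0 = fun _ => 0 := by funext s; simp [lift]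
    rw [h0, hone, hq] at h1
    rw [norm_mul, Real.norm_eq_abs, Real.norm_eq_abs, Real.abs_exp]
    have h2 : |profileOp N γ α (lift φ) η| ≤ 1 + 1 / 2 * (‖φ‖ * Real.exp (K * η ^ 2)) := by
      have := abs_le.1 h1
      have h3 : 0 ≤ 1 / 2 * (‖φ‖ * Real.exp (K * η ^ 2)) := by positivity
      rw [abs_le]; constructor <;> linarith
    have h4 : 1 ≤ Real.exp (K * η ^ 2) := Real.one_le_exp (by positivity)
    rw [Real.exp_neg, inv_mul_le_iff₀ (Real.exp_pos _)]
    nlinarith [norm_nonneg φ]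
  let Φ : (ℝ →ᵇ ℝ) → (ℝ →ᵇ ℝ) := fun φ =>
    BoundedContinuousFunction.ofNormedAddCommGroup
      (fun η => Real.exp (-(K * η ^ 2)) * profileOp N γ α (lift φ) η)
      (by
        have := continuous_profileOp N hγ hγ' α (hlift φ)
        fun_prop) (1 + 1 / 2 * ‖φ‖) (hbd φ)
  have hΦ : ContractingWith (1 / 2) Φ := by
    refine ⟨by rw [← NNReal.coe_lt_coe]; norm_num, LipschitzWith.of_dist_le_mul fun φ ψ => ?_⟩
    rw [BoundedContinuousFunction.dist_le (by positivity)]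
    intro η
    have h1 := abs_profileOp_sub_le N hγ hγ' α (hlift φ) (hlift ψ) (η := η)
      (m := dist φ ψ) hK (fun τ _ => hdiff φ ψ (τ * η))
    rw [hq] at h1
    simp only [Φ, BoundedContinuousFunction.coe_ofNormedAddCommGroup, Real.dist_eq, ← mul_sub,
      abs_mul, Real.abs_exp]
    rw [Real.exp_neg, inv_mul_le_iff₀ (Real.exp_pos _)]
    push_cast
    linarith
  let φ := hΦ.fixedPoint
  have hfix : Φ φ = φ := hΦ.fixedPoint_isFixedPt
  refine ⟨lift φ, hlift φ, fun η => ?_⟩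
  have h1 : Real.exp (-(K * η ^ 2)) * profileOp N γ α (lift φ) η = φ η :=
    congrArg (fun ψ : ℝ →ᵇ ℝ => ψ η) hfix
  simp only [lift] at h1 ⊢
  nth_rw 1 [← h1]
  rw [← mul_assoc, ← Real.exp_add]
  simp

/-! ### The normalized profile and its derivatives -/

/-- `W = (α f + η f') / α` for the profile `f` with parameter `α`. The normalization `W(0) = 1`
makes sense for every real `α`, in particular for `α = 0`. -/
def profileW (N : ℕ) (γ α : ℝ) : ℝ → ℝ :=
  Classical.epsilon fun u : ℝ → ℝ => Continuous u ∧ ∀ η, u η = profileOp N γ α u η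

/-- `h = f' / α` for the profile `f` with parameter `α`. -/
def profileH (N : ℕ) (γ α η : ℝ) : ℝ :=
  η * radialMean (N - 1) (fun s => flux γ (profileW N γ α s)) η

/-- `g = (f - 1) / α` for the profile `f` with parameter `α`. -/
def profileG (N : ℕ) (γ α η : ℝ) : ℝ :=
  η ^ 2 * radialMean 1 (radialMean (N - 1) fun s => flux γ (profileW N γ α s)) η

/-- The derivative of `profileW` on `(0, ∞)`. -/
def profileDW (N : ℕ) (γ α η : ℝ) : ℝ :=
  (α + 2 - N) * profileH N γ α η + η * flux γ (profileW N γ α η)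

section profile

variable {N : ℕ} {γ : ℝ} (hγ : -1 < γ) (hγ' : γ < 1)
include hγ hγ'

lemma profileW_spec (α : ℝ) : Continuous (profileW N γ α) ∧
    ∀ η, profileW N γ α η = profileOp N γ α (profileW N γ α) η :=
  Classical.epsilon_spec (exists_profileOp_eq N hγ hγ' α)

lemma profileW_eq (α η : ℝ) :
    profileW N γ α η = 1 + (α * profileG N γ α η + η * profileH N γ α η) := by
  rw [(profileW_spec hγ hγ' α).2 η]
  unfold profileOp profileG profileH
  ring

lemma profileW_zero (α : ℝ) : profileW N γ α 0 = 1 := by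
  rw [profileW_eq hγ hγ']
  simp [profileG]

/-- Joint continuity in the parameter and the variable. -/
lemma continuous_profileW : Continuous fun p : ℝ × ℝ => profileW N γ p.1 p.2 := by
  rw [continuous_iff_continuousAt]
  rintro ⟨α, η₀⟩
  -- compare the fixed points for `α` and for nearby `α'` on `[-T, T]`; the bound only involves `α`
  set T := |η₀| + 1
  have hG : Continuous (profileG N γ α) := by
    have h0 : Continuous fun s => flux γ (profileW N γ α s) :=
      (continuous_flux hγ hγ').comp (profileW_spec hγ hγ' α).1
    have h2 := (h0.radialMean (N - 1)).radialMean 1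
    unfold profileG
    fun_prop
  obtain ⟨B, hB⟩ := (isCompact_Icc (a := -T) (b := T)).exists_bound_of_continuousOn hG.continuousOn
  set K := 2 * (|α| + 1 + 1)
  have hclose : ∀ α', |α' - α| ≤ 1 → ∀ η ∈ Set.Icc (-T) T,
      |profileW N γ α η - profileW N γ α' η| ≤ 2 * (|α - α'| * B) * Real.exp (K * η ^ 2) := by
    intro α' hα'
    refine abs_sub_le_of_profileOp_eq N hγ hγ' (profileW_spec hγ hγ' α).1
      (profileW_spec hγ hγ' α').1 isCompact_Icc ?_ (fun η _ => (profileW_spec hγ hγ' α).2 η)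
      (fun η _ => (profileW_spec hγ hγ' α').2 η) ?_ hB
    · intro η hη τ hτ
      have h1 : |η| ≤ T := abs_le.2 hη
      have h2 : |τ * η| ≤ T := by
        rw [abs_mul, abs_of_nonneg hτ.1]
        exact (mul_le_of_le_one_left (abs_nonneg _) hτ.2).trans h1
      exact abs_le.1 h2
    · have : |α'| ≤ |α' - α| + |α| := by simpa using abs_add_le (α' - α) α
      simp only [K]
      linarith
  have hlim : Tendsto (fun p : ℝ × ℝ => profileW N γ α p.2
      - (profileW N γ α p.2 - profileW N γ p.1 p.2)) (𝓝 (α, η₀)) (𝓝 (profileW N γ α η₀ - 0)) := by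
    refine Tendsto.sub ?_ ?_
    · exact ((profileW_spec hγ hγ' α).1.comp continuous_snd).tendsto (α, η₀)
    · have hb : Tendsto (fun p : ℝ × ℝ => 2 * (|α - p.1| * B) * Real.exp (K * p.2 ^ 2))
          (𝓝 (α, η₀)) (𝓝 0) := by
        have : Continuous fun p : ℝ × ℝ => 2 * (|α - p.1| * B) * Real.exp (K * p.2 ^ 2) := by
          fun_prop
        simpa using this.tendsto (α, η₀)
      refine squeeze_zero_norm' ?_ hb
      have h1 : ∀ᶠ p : ℝ × ℝ in 𝓝 (α, η₀), |p.1 - α| < 1 :=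
        (by fun_prop : Continuous fun p : ℝ × ℝ => |p.1 - α|).tendsto (α, η₀)
          |>.eventually (gt_mem_nhds (by simp))
      have h2 : ∀ᶠ p : ℝ × ℝ in 𝓝 (α, η₀), |p.2| < T :=
        (by fun_prop : Continuous fun p : ℝ × ℝ => |p.2|).tendsto (α, η₀)
          |>.eventually (gt_mem_nhds (by simp [T]))
      filter_upwards [h1, h2] with p hp1 hp2
      exact hclose p.1 hp1.le p.2 (abs_le.1 hp2.le)
  simpa [ContinuousAt] using hlim

lemma continuous_flux_profileW :
    Continuous fun p : ℝ × ℝ => flux γ (profileW N γ p.1 p.2) :=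
  (continuous_flux hγ hγ').comp (continuous_profileW hγ hγ')

lemma continuous_profileH : Continuous fun p : ℝ × ℝ => profileH N γ p.1 p.2 := by
  unfold profileH
  exact continuous_snd.mul (continuous_radialMean (N - 1)
    (u := fun α s => flux γ (profileW N γ α s)) (continuous_flux_profileW hγ hγ'))

lemma continuous_profileDW : Continuous fun p : ℝ × ℝ => profileDW N γ p.1 p.2 := by
  have h1 := continuous_profileH (N := N) hγ hγ'
  have h2 := continuous_flux_profileW (N := N) hγ hγ'
  unfold profileDW
  fun_prop

lemma continuous_profileW_right (α : ℝ) : Continuous (profileW N γ α) :=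
  (profileW_spec hγ hγ' α).1

lemma continuous_profileW_left (η : ℝ) : Continuous fun α => profileW N γ α η :=
  (continuous_profileW hγ hγ').comp (by fun_prop : Continuous fun α : ℝ => (α, η))

lemma continuous_profileDW_left (η : ℝ) : Continuous fun α => profileDW N γ α η :=
  (continuous_profileDW hγ hγ').comp (by fun_prop : Continuous fun α : ℝ => (α, η))

lemma continuous_profileH_right (α : ℝ) : Continuous (profileH N γ α) :=
  (continuous_profileH hγ hγ').comp (by fun_prop : Continuous fun η : ℝ => (α, η))

lemma continuous_profileDW_right (α : ℝ) : Continuous (profileDW N γ α) :=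
  (continuous_profileDW hγ hγ').comp (by fun_prop : Continuous fun η : ℝ => (α, η))

lemma hasDerivAt_profileG (α η : ℝ) : HasDerivAt (profileG N γ α) (profileH N γ α η) η := by
  have h0 : Continuous fun s => flux γ (profileW N γ α s) :=
    (continuous_flux hγ hγ').comp (continuous_profileW_right hγ hγ' α)
  have := hasDerivAt_pow_mul_radialMean 1 (h0.radialMean (N - 1)) η
  rw [pow_one] at this
  exact this

lemma hasDerivAt_profileH (hN : 1 ≤ N) (α : ℝ) {η : ℝ} (hη : 0 < η) :
    HasDerivAt (profileH N γ α)
      (flux γ (profileW N γ α η) - ((N : ℝ) - 1) / η * profileH N γ α η) η := by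
  have h0 : Continuous fun s => flux γ (profileW N γ α s) :=
    (continuous_flux hγ hγ').comp (continuous_profileW_right hγ hγ' α)
  have h1 := hasDerivAt_pow_mul_radialMean (N - 1) h0 η
  have h2 := h1.mul ((hasDerivAt_zpow (-((N - 1 : ℕ) : ℤ)) η (Or.inl hη.ne')))
  have hc : ((N - 1 : ℕ) : ℝ) = (N : ℝ) - 1 := by push_cast [hN]; ring
  have heq : (fun x => x ^ (N - 1 + 1) * radialMean (N - 1) (fun s => flux γ (profileW N γ α s)) x)
      * (fun x => x ^ (-((N - 1 : ℕ) : ℤ))) =ᶠ[𝓝 η] profileH N γ α := by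
    filter_upwards [lt_mem_nhds hη] with x hx
    simp only [Pi.mul_apply, profileH, zpow_neg, zpow_natCast, pow_succ]
    field_simp
  refine (h2.congr_of_eventuallyEq heq.symm).congr_deriv ?_
  simp only [profileH]
  rw [zpow_sub₀ hη.ne', zpow_neg, zpow_natCast, zpow_one]
  push_cast
  rw [hc]
  field_simp
  ring

lemma hasDerivAt_profileW (hN : 1 ≤ N) (α : ℝ) {η : ℝ} (hη : 0 < η) :
    HasDerivAt (profileW N γ α) (profileDW N γ α η) η := by
  have h1 := hasDerivAt_profileG (N := N) hγ hγ' α η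
  have h2 := hasDerivAt_profileH (N := N) hγ hγ' hN α hη
  have h3 := ((h1.const_mul α).add ((hasDerivAt_id η).mul h2)).const_add 1
  have heq : profileW N γ α = fun η => 1 + ((fun η => α * profileG N γ α η) +
      (id * profileH N γ α : ℝ → ℝ) : ℝ → ℝ) η := by
    funext x
    simpa using profileW_eq hγ hγ' α x
  rw [heq]
  refine h3.congr_deriv ?_
  simp only [profileDW, id]
  field_simp
  ring

end profile

/-! ### The linear equation on an interval without zeros -/

/-- The first point at which a function that starts positive fails to be positive. -/
lemma exists_first_zero {y : ℝ → ℝ} {R t : ℝ} (hRt : R ≤ t) (hy : ContinuousOn y (Set.Icc R t))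
    (hR : 0 < y R) (ht : y t ≤ 0) :
    ∃ x, R < x ∧ x ≤ t ∧ y x = 0 ∧ ∀ η ∈ Set.Ico R x, 0 < y η := by
  have hcl : IsCompact {η ∈ Set.Icc R t | y η ≤ 0} := by
    have : {η ∈ Set.Icc R t | y η ≤ 0} = Set.Icc R t ∩ y ⁻¹' Set.Iic 0 := rfl
    rw [this]
    exact isCompact_Icc.of_isClosed_subset (hy.preimage_isClosed_of_isClosed isClosed_Icc isClosed_Iic)
      Set.inter_subset_left
  obtain ⟨x, hx, hmin⟩ := hcl.exists_isLeast ⟨t, ⟨hRt, le_rfl⟩, ht⟩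
  have hpos : ∀ η ∈ Set.Ico R x, 0 < y η := by
    intro η hη
    by_contra hcon
    have := hmin ⟨⟨hη.1, hη.2.le.trans hx.1.2⟩, not_lt.1 hcon⟩
    linarith [hη.2]
  have hxR : R < x := by
    rcases hx.1.1.eq_or_lt with h | h
    · rw [← h] at hx; exact absurd hx.2 (not_le.2 hR)
    · exact h
  refine ⟨x, hxR, hx.1.2, le_antisymm hx.2 ?_, hpos⟩
  have hcw : ContinuousWithinAt y (Set.Ico R x) x :=
    (hy x hx.1).mono (Set.Ico_subset_Icc_self.trans (Set.Icc_subset_Icc le_rfl hx.1.2))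
  have : (𝓝[Set.Ico R x] x).NeBot := by
    rw [← mem_closure_iff_nhdsWithin_neBot, closure_Ico hxR.ne]
    exact ⟨hxR.le, le_rfl⟩
  exact ge_of_tendsto hcw (eventually_nhdsWithin_of_forall fun η hη => (hpos η hη).le)

/-- The coefficient `-σ(W)` on a zone where `W` has the sign `s = ±1`. -/
def zoneCoeff (γ s : ℝ) : ℝ := (1 - s * γ) / 2

lemma zoneCoeff_pos {γ s : ℝ} (hγ : -1 < γ) (hγ' : γ < 1) (hs : s = 1 ∨ s = -1) :
    0 < zoneCoeff γ s := by
  unfold zoneCoeff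
  rcases hs with rfl | rfl <;> linarith

lemma flux_eq {γ s x : ℝ} (hs : s = 1 ∨ s = -1) (hx : 0 ≤ s * x) :
    flux γ x = -zoneCoeff γ s * x := by
  unfold flux sigmaCoeff zoneCoeff
  rcases hs with rfl | rfl
  · rcases (by linarith : 0 ≤ x).eq_or_lt with rfl | h
    · simp
    · rw [if_pos h]; ring
  · rw [if_neg (by linarith)]; ring

/-- `y`, with derivative `dy`, solves `y'' + ((N - 1) / η + c η) y' + c β y = 0` on `S`. Profiles
solve it with `β = α`, and `W` with `β = α + 2`, wherever `W` keeps its sign. -/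
structure ZoneSol (N : ℕ) (c β : ℝ) (S : Set ℝ) (y dy : ℝ → ℝ) : Prop where
  fst : ∀ η ∈ S, HasDerivAt y (dy η) η
  snd : ∀ η ∈ S, HasDerivAt dy (-(((N : ℝ) - 1) / η + c * η) * dy η - c * β * y η) η

lemma ZoneSol.mono {N : ℕ} {c β : ℝ} {S T : Set ℝ} {y dy : ℝ → ℝ} (h : ZoneSol N c β S y dy)
    (hT : T ⊆ S) : ZoneSol N c β T y dy :=
  ⟨fun η hη => h.fst η (hT hη), fun η hη => h.snd η (hT hη)⟩

lemma ZoneSol.const_mul {N : ℕ} {c β : ℝ} {S : Set ℝ} {y dy : ℝ → ℝ} (h : ZoneSol N c β S y dy)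
    (k : ℝ) : ZoneSol N c β S (fun η => k * y η) (fun η => k * dy η) :=
  ⟨fun η hη => (h.fst η hη).const_mul k,
    fun η hη => ((h.snd η hη).const_mul k).congr_deriv (by ring)⟩

/-- The weight that puts the linear equation into the form `(p y')' + c β p y = 0`. -/
def zoneWeight (N : ℕ) (c η : ℝ) : ℝ := η ^ (N - 1) * Real.exp (c * η ^ 2 / 2)

lemma zoneWeight_pos (N : ℕ) (c : ℝ) {η : ℝ} (hη : 0 < η) : 0 < zoneWeight N c η := by
  unfold zoneWeight; positivity

lemma continuous_zoneWeight (N : ℕ) (c : ℝ) : Continuous (zoneWeight N c) := by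
  unfold zoneWeight; fun_prop

lemma hasDerivAt_zoneWeight {N : ℕ} (hN : 1 ≤ N) (c : ℝ) {η : ℝ} (hη : 0 < η) :
    HasDerivAt (zoneWeight N c) (zoneWeight N c η * (((N : ℝ) - 1) / η + c * η)) η := by
  have h1 := hasDerivAt_pow (N - 1) η
  have h2 : HasDerivAt (fun η : ℝ => Real.exp (c * η ^ 2 / 2))
      (Real.exp (c * η ^ 2 / 2) * (c * η)) η := by
    apply HasDerivAt.exp
    refine (((hasDerivAt_pow 2 η).const_mul c).div_const 2).congr_deriv ?_
    simp only [Nat.cast_ofNat, Nat.add_one_sub_one, pow_one]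
    ring
  refine (h1.mul h2).congr_deriv ?_
  have hc : ((N - 1 : ℕ) : ℝ) = (N : ℝ) - 1 := by push_cast [hN]; ring
  have hp : ((N : ℝ) - 1) * η ^ (N - 1 - 1) = ((N : ℝ) - 1) / η * η ^ (N - 1) := by
    obtain ⟨n, rfl⟩ : ∃ n, N = n + 1 := ⟨N - 1, by omega⟩
    rcases n with _ | n
    · simp
    · simp only [Nat.add_sub_cancel, pow_succ]
      field_simp
  unfold zoneWeight
  rw [hc, hp]
  ring

/-- Abel's identity for two solutions with possibly different `β`. -/
lemma hasDerivAt_wronskian {N : ℕ} (hN : 1 ≤ N) {c β₁ β₂ : ℝ} {S : Set ℝ} {y₁ dy₁ y₂ dy₂ : ℝ → ℝ}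
    (h₁ : ZoneSol N c β₁ S y₁ dy₁) (h₂ : ZoneSol N c β₂ S y₂ dy₂) {η : ℝ} (hη : 0 < η)
    (hS : η ∈ S) :
    HasDerivAt (fun x => zoneWeight N c x * (y₁ x * dy₂ x - dy₁ x * y₂ x))
      (c * (β₁ - β₂) * (zoneWeight N c η * (y₁ η * y₂ η))) η := by
  have hp := hasDerivAt_zoneWeight hN c hη
  refine (hp.mul (((h₁.fst η hS).mul (h₂.snd η hS)).sub
    ((h₁.snd η hS).mul (h₂.fst η hS)))).congr_deriv ?_
  simp only [Pi.mul_apply, Pi.sub_apply]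
  ring

/-- A solution lying above a multiple of the supersolution `η^(-A)` stays positive: as long as
`y > 0`, the quantity `p η^(-A-1) (η y' + A y)` increases, so that `η^A y` increases too. -/
lemma pos_of_trapped {N : ℕ} (hN : 1 ≤ N) {c β R A : ℝ} (hR : 0 < R)
    (hAR : ∀ η, R ≤ η → A * (A + 2 - N) ≤ c * (A - β) * η ^ 2) {y dy : ℝ → ℝ}
    (hy : Continuous y) (hdy : Continuous dy)
    (hsol : ∀ x, R < x → (∀ η ∈ Set.Ioo R x, 0 < y η) → ZoneSol N c β (Set.Ioo R x) y dy)
    (h0 : 0 < y R) (h1 : 0 < R * dy R + A * y R) : ∀ η, R ≤ η → 0 < y η := by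
  intro t ht
  by_contra hcon
  obtain ⟨x, hRx, -, hx0, hpos⟩ := exists_first_zero ht hy.continuousOn h0 (not_lt.1 hcon)
  have hz := hsol x hRx fun η hη => hpos η ⟨hη.1.le, hη.2⟩
  have hrc : ∀ q : ℝ, ContinuousOn (fun η : ℝ => η ^ q) (Set.Icc R x) := fun q η hη =>
    (Real.continuousAt_rpow_const η q (Or.inl (hR.trans_le hη.1).ne')).continuousWithinAt
  have hrd : ∀ q : ℝ, ∀ η ∈ Set.Ioo R x, HasDerivAt (fun η : ℝ => η ^ q) (q * η ^ q / η) η := by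
    intro q η hη
    have hη0 := hR.trans hη.1
    have := Real.hasDerivAt_rpow_const (x := η) (p := q) (Or.inl hη0.ne')
    rwa [Real.rpow_sub_one hη0.ne', ← mul_div_assoc] at this
  -- `Q' = p η^(-A) y (c (A - β) - A (A + 2 - N) / η²) ≥ 0` by the assumption on `R`
  let Q : ℝ → ℝ := fun η => zoneWeight N c η * (η ^ (-A - 1) * (η * dy η + A * y η))
  have hQ : MonotoneOn Q (Set.Icc R x) := by
    apply monotoneOn_of_hasDerivWithinAt_nonneg (convex_Icc R x)
      (f' := fun η => zoneWeight N c η * (η ^ (-A - 1) * η * y η)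
        * (c * (A - β) - A * (A + 2 - N) / η ^ 2))
    · exact (continuous_zoneWeight N c).continuousOn.mul ((hrc _).mul (by fun_prop))
    · intro η hη
      rw [interior_Icc] at hη
      have hη0 := hR.trans hη.1
      have := ((hasDerivAt_zoneWeight hN c hη0).mul ((hrd (-A - 1) η hη).mul
        (((hasDerivAt_id η).mul (hz.snd η hη)).add ((hz.fst η hη).const_mul A))))
      refine (this.congr_deriv ?_).hasDerivWithinAt
      simp only [Pi.mul_apply, Pi.add_apply, id]
      field_simp
      ring
    · intro η hη
      rw [interior_Icc] at hη
      have hη0 := hR.trans hη.1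
      have hp := zoneWeight_pos N c hη0
      have hyη := hpos η ⟨hη.1.le, hη.2⟩
      refine mul_nonneg (by positivity) ?_
      rw [sub_nonneg, div_le_iff₀ (by positivity)]
      exact hAR η hη.1.le
  have hQR : 0 < Q R := by
    have := zoneWeight_pos N c hR
    simp only [Q]
    positivity
  have hmono : MonotoneOn (fun η => η ^ A * y η) (Set.Icc R x) := by
    apply monotoneOn_of_hasDerivWithinAt_nonneg (convex_Icc R x)
      (f' := fun η => η ^ A / η * (η * dy η + A * y η))
    · exact (hrc _).mul hy.continuousOn
    · intro η hη
      rw [interior_Icc] at hη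
      have hη0 := hR.trans hη.1
      refine (((hrd A η hη).mul (hz.fst η hη)).congr_deriv ?_).hasDerivWithinAt
      field_simp
      ring
    · intro η hη
      rw [interior_Icc] at hη
      have hη0 := hR.trans hη.1
      have h2 : Q R ≤ Q η := hQ ⟨le_rfl, hRx.le⟩ ⟨hη.1.le, hη.2.le⟩ hη.1.le
      have hp := zoneWeight_pos N c hη0
      have h3 : 0 < zoneWeight N c η * η ^ (-A - 1) := by positivity
      have h4 : 0 < zoneWeight N c η * η ^ (-A - 1) * (η * dy η + A * y η) := by
        simp only [Q] at h2 hQR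
        rw [mul_assoc]
        linarith
      have h5 := (mul_pos_iff_of_pos_left h3).1 h4
      positivity
  have h6 := hmono ⟨le_rfl, hRx.le⟩ ⟨hRx.le, le_rfl⟩ hRx.le
  simp only [hx0, mul_zero] at h6
  have : 0 < R ^ A * y R := by positivity
  linarith

section profile

variable {N : ℕ} {γ : ℝ} (hγ : -1 < γ) (hγ' : γ < 1)
include hγ hγ'

lemma profileW_zoneSol (hN : 1 ≤ N) (α : ℝ) {s : ℝ} (hs : s = 1 ∨ s = -1) {S : Set ℝ}
    (hSo : IsOpen S) (hS : ∀ η ∈ S, 0 < η) (hpos : ∀ η ∈ S, 0 < s * profileW N γ α η) :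
    ZoneSol N (zoneCoeff γ s) (α + 2) S (profileW N γ α) (profileDW N γ α) := by
  refine ⟨fun η hη => hasDerivAt_profileW hγ hγ' hN α (hS η hη), fun η hη => ?_⟩
  have h0 := hS η hη
  have heq : (fun x => (α + 2 - N) * profileH N γ α x
      + -zoneCoeff γ s * (x * profileW N γ α x)) =ᶠ[𝓝 η] profileDW N γ α := by
    filter_upwards [hSo.mem_nhds hη] with x hx
    rw [profileDW, flux_eq hs (hpos x hx).le]
    ring
  have h1 := (hasDerivAt_profileH hγ hγ' hN α h0).const_mul (α + 2 - (N : ℝ))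
  have h2 := ((hasDerivAt_id η).mul (hasDerivAt_profileW hγ hγ' hN α h0)).const_mul
    (-zoneCoeff γ s)
  refine ((h1.add h2).congr_of_eventuallyEq heq.symm).congr_deriv ?_
  have e := heq.self_of_nhds
  simp only at e
  rw [← e, flux_eq hs (hpos η hη).le]
  simp only [id]
  field_simp
  ring

end profile

/-! ### Zeros of the normalized profile -/

/-- `IsNode N γ α k x` says that `x` is the `k`-th positive zero of `W`; the node of index `0` is
the origin. Between the nodes of index `k` and `k + 1` the sign of `W` is `(-1)^k`. -/
def IsNode (N : ℕ) (γ α : ℝ) : ℕ → ℝ → Prop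
  | 0, x => x = 0
  | k + 1, x => ∃ y, IsNode N γ α k y ∧ y < x ∧ profileW N γ α x = 0 ∧
      ∀ t ∈ Set.Ioo y x, 0 < (-1) ^ k * profileW N γ α t

/-- The positive zeros of `W`. -/
def profileZeros (N : ℕ) (γ α : ℝ) : Set ℝ := {x | 0 < x ∧ profileW N γ α x = 0}

lemma neg_one_pow_eq (k : ℕ) : (-1 : ℝ) ^ k = 1 ∨ (-1 : ℝ) ^ k = -1 := neg_one_pow_eq_or ℝ k

lemma neg_one_pow_mul_self (k : ℕ) : (-1 : ℝ) ^ k * (-1) ^ k = 1 := by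
  rcases neg_one_pow_eq k with h | h <;> simp [h]

lemma eventually_pos_of_hasDerivAt {f : ℝ → ℝ} {f' x : ℝ} (hf : HasDerivAt f f' x) (hx : f x = 0)
    (hf' : 0 < f') : (∀ᶠ t in 𝓝[>] x, 0 < f t) ∧ ∀ᶠ t in 𝓝[<] x, f t < 0 := by
  have h := (hasDerivAt_iff_tendsto_slope.1 hf).eventually (lt_mem_nhds hf')
  constructor
  · filter_upwards [h.filter_mono (nhdsWithin_mono x fun t ht => ne_of_gt ht),
      self_mem_nhdsWithin] with t ht htx
    rw [slope_def_field, hx, sub_zero] at ht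
    have : (0 : ℝ) < t - x := sub_pos.2 htx
    exact (div_pos_iff_of_pos_right this).1 ht
  · filter_upwards [h.filter_mono (nhdsWithin_mono x fun t ht => ne_of_lt ht),
      self_mem_nhdsWithin] with t ht htx
    rw [slope_def_field, hx, sub_zero] at ht
    have h1 : t - x < 0 := sub_neg.2 htx
    by_contra hcon
    exact absurd ht (not_lt.2 (div_nonpos_of_nonneg_of_nonpos (not_lt.1 hcon) h1.le))

lemma deriv_nonneg_of_pos_right {f : ℝ → ℝ} {f' x b : ℝ} (hf : HasDerivAt f f' x) (hx : f x = 0)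
    (hb : x < b) (hpos : ∀ t ∈ Set.Ioo x b, 0 < f t) : 0 ≤ f' := by
  by_contra hcon
  have h := (eventually_pos_of_hasDerivAt hf.neg (by simp [hx]) (by linarith)).1
  obtain ⟨t, ht1, ht2⟩ := (h.and (Ioo_mem_nhdsGT hb)).exists
  have := hpos t ht2
  simp only [Pi.neg_apply] at ht1
  linarith

lemma deriv_nonpos_of_pos_left {f : ℝ → ℝ} {f' x a : ℝ} (hf : HasDerivAt f f' x) (hx : f x = 0)
    (ha : a < x) (hpos : ∀ t ∈ Set.Ioo a x, 0 < f t) : f' ≤ 0 := by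
  by_contra hcon
  have h := (eventually_pos_of_hasDerivAt hf hx (by linarith)).2
  obtain ⟨t, ht1, ht2⟩ := (h.and (Ioo_mem_nhdsLT ha)).exists
  linarith [hpos t ht2]

lemma IsNode.nonneg {N : ℕ} {γ α : ℝ} {k : ℕ} {x : ℝ} (h : IsNode N γ α k x) : 0 ≤ x := by
  induction k generalizing x with
  | zero => exact le_of_eq h.symm
  | succ k ih =>
    obtain ⟨y, hy, hyx, -⟩ := h
    exact (ih hy).trans hyx.le

lemma IsNode.mem_zeros {N : ℕ} {γ α : ℝ} {k : ℕ} {x : ℝ} (h : IsNode N γ α (k + 1) x) :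
    x ∈ profileZeros N γ α := by
  obtain ⟨y, hy, hyx, h0, -⟩ := h
  exact ⟨hy.nonneg.trans_lt hyx, h0⟩

lemma IsNode.unique {N : ℕ} {γ α : ℝ} {k : ℕ} {x x' : ℝ} (h : IsNode N γ α k x)
    (h' : IsNode N γ α k x') : x = x' := by
  induction k generalizing x x' with
  | zero => exact Eq.trans h (Eq.symm h')
  | succ k ih =>
    obtain ⟨y, hy, hyx, h0, hp⟩ := h
    obtain ⟨y', hy', hyx', h0', hp'⟩ := h'
    obtain rfl := ih hy hy'
    rcases lt_trichotomy x x' with hlt | heq | hlt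
    · have := hp' x ⟨hyx, hlt⟩
      simp [h0] at this
    · exact heq
    · have := hp x' ⟨hyx', hlt⟩
      simp [h0'] at this

/-- The zeros up to a node are counted by its index. -/
lemma IsNode.ncard {N : ℕ} {γ α : ℝ} {k : ℕ} {x : ℝ} (h : IsNode N γ α k x) :
    (profileZeros N γ α ∩ Set.Iic x).Finite ∧ (profileZeros N γ α ∩ Set.Iic x).ncard = k := by
  induction k generalizing x with
  | zero =>
    have : profileZeros N γ α ∩ Set.Iic x = ∅ := by
      ext t
      simp only [profileZeros, Set.mem_inter_iff, Set.mem_ofPred_eq, Set.mem_Iic,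
        Set.mem_empty_iff_false, iff_false]
      rintro ⟨⟨h1, -⟩, h2⟩
      have : x = 0 := h
      linarith
    simp [this]
  | succ k ih =>
    have hmem := h.mem_zeros
    obtain ⟨y, hy, hyx, h0, hp⟩ := h
    obtain ⟨hf, hc⟩ := ih hy
    have : profileZeros N γ α ∩ Set.Iic x = insert x (profileZeros N γ α ∩ Set.Iic y) := by
      ext t
      simp only [Set.mem_inter_iff, Set.mem_Iic, Set.mem_insert_iff]
      constructor
      · rintro ⟨h1, h2⟩
        rcases h2.eq_or_lt with h3 | h3
        · exact Or.inl h3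
        · refine Or.inr ⟨h1, ?_⟩
          by_contra hcon
          have := hp t ⟨not_le.1 hcon, h3⟩
          simp [h1.2] at this
      · rintro (rfl | ⟨h1, h2⟩)
        · exact ⟨hmem, le_rfl⟩
        · exact ⟨h1, h2.trans hyx.le⟩
    have hnot : x ∉ profileZeros N γ α ∩ Set.Iic y := fun hx => not_lt.2 hx.2 hyx
    rw [this]
    exact ⟨hf.insert x, by rw [Set.ncard_insert_of_notMem hnot hf, hc]⟩

section profile

variable {N : ℕ} {γ : ℝ} (hγ : -1 < γ) (hγ' : γ < 1)
include hγ hγ'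

omit hγ hγ' in
lemma profileDW_zero (α : ℝ) : profileDW N γ α 0 = 0 := by
  simp [profileDW, profileH]

omit hγ hγ' in
lemma profileDW_of_zero {α x : ℝ} (hx : profileW N γ α x = 0) :
    profileDW N γ α x = (α + 2 - N) * profileH N γ α x := by
  simp [profileDW, hx, flux_zero]

/-- For `α ≤ N - 2` there are no zeros: as long as `W > 0` one has `h ≤ 0`, so that
`W exp (c η² / 2)` increases. -/
lemma profileW_pos_of_le (hN : 1 ≤ N) {α : ℝ} (hα : α + 2 ≤ N) {η : ℝ} (hη : 0 ≤ η) :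
    0 < profileW N γ α η := by
  by_contra hcon
  obtain ⟨x, hx, -, hx0, hpos⟩ := exists_first_zero hη
    (continuous_profileW_right hγ hγ' α).continuousOn (by rw [profileW_zero hγ hγ']; norm_num)
    (not_lt.1 hcon)
  set c := zoneCoeff γ 1
  have hc : 0 < c := zoneCoeff_pos hγ hγ' (Or.inl rfl)
  have hmono : MonotoneOn (fun η => profileW N γ α η * Real.exp (c * η ^ 2 / 2)) (Set.Icc 0 x) := by
    have hcont := continuous_profileW_right (N := N) hγ hγ' α
    apply monotoneOn_of_hasDerivWithinAt_nonneg (convex_Icc 0 x)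
      (f' := fun η => (α + 2 - N) * profileH N γ α η * Real.exp (c * η ^ 2 / 2))
    · fun_prop
    · intro η hη
      rw [interior_Icc] at hη
      have h2 : HasDerivAt (fun η : ℝ => Real.exp (c * η ^ 2 / 2))
          (Real.exp (c * η ^ 2 / 2) * (c * η)) η := by
        apply HasDerivAt.exp
        refine (((hasDerivAt_pow 2 η).const_mul c).div_const 2).congr_deriv ?_
        simp only [Nat.cast_ofNat, Nat.add_one_sub_one, pow_one]
        ring
      refine (((hasDerivAt_profileW hγ hγ' hN α hη.1).mul h2).congr_deriv ?_).hasDerivWithinAt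
      rw [profileDW, flux_eq (Or.inl rfl) (by rw [one_mul]; exact (hpos η ⟨hη.1.le, hη.2⟩).le)]
      ring
    · intro η hη
      rw [interior_Icc] at hη
      have hH : profileH N γ α η ≤ 0 := by
        unfold profileH radialMean
        refine mul_nonpos_of_nonneg_of_nonpos hη.1.le ?_
        have : 0 ≤ ∫ τ in (0 : ℝ)..1, -(τ ^ (N - 1) * flux γ (profileW N γ α (τ * η))) := by
          apply intervalIntegral.integral_nonneg zero_le_one
          intro τ hτ
          have h1 := hpos (τ * η) ⟨mul_nonneg hτ.1 hη.1.le,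
            (mul_le_of_le_one_left hη.1.le hτ.2).trans_lt hη.2⟩
          rw [flux_eq (Or.inl rfl) (by rw [one_mul]; exact h1.le)]
          have : 0 ≤ τ ^ (N - 1) := pow_nonneg hτ.1 _
          have := mul_nonneg this (mul_pos hc h1).le
          linarith
        rw [intervalIntegral.integral_neg] at this
        linarith
      have : 0 ≤ (α + 2 - N) * profileH N γ α η :=
        mul_nonneg_of_nonpos_of_nonpos (by linarith) hH
      positivity
  have h := hmono ⟨le_rfl, hx.le⟩ ⟨hx.le, le_rfl⟩ hx.le
  simp [hx0, profileW_zero hγ hγ'] at h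
  linarith

lemma lt_of_mem_zeros (hN : 1 ≤ N) {α x : ℝ} (hx : x ∈ profileZeros N γ α) : (N : ℝ) < α + 2 := by
  by_contra hcon
  have := profileW_pos_of_le hγ hγ' hN (not_lt.1 hcon) hx.1.le
  linarith [hx.2]

/-- Uniqueness of the zero solution, by an energy estimate backwards from `x`. -/
lemma profileH_ne_zero (hN : 1 ≤ N) {α x : ℝ} (hx : x ∈ profileZeros N γ α) :
    profileH N γ α x ≠ 0 := by
  intro hh
  obtain ⟨hx0, hW⟩ := hx
  -- `(W² + h²) exp (C η)` increases on `[ε, x]` and vanishes at `x`; the singular coefficient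
  -- `(N - 1) / η` is bounded there by its value at `ε`
  have hzero : ∀ ε ∈ Set.Ioc 0 x, profileW N γ α ε = 0 := by
    intro ε hε
    set μ := α + 2 - (N : ℝ)
    set C : ℝ := |μ| + 2 * x + 2 + 2 * (((N : ℝ) - 1) / ε)
    let E : ℝ → ℝ := fun η => profileW N γ α η ^ 2 + profileH N γ α η ^ 2
    have hcW := continuous_profileW_right (N := N) hγ hγ' α
    have hcH := continuous_profileH_right (N := N) hγ hγ' α
    have hN' : (0 : ℝ) ≤ (N : ℝ) - 1 := by
      have : (1 : ℝ) ≤ N := by exact_mod_cast hN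
      linarith
    have hmono : MonotoneOn (fun η => E η * Real.exp (C * η)) (Set.Icc ε x) := by
      apply monotoneOn_of_hasDerivWithinAt_nonneg (convex_Icc ε x)
        (f' := fun η => (2 * profileW N γ α η * profileDW N γ α η
          + 2 * profileH N γ α η * (flux γ (profileW N γ α η)
            - ((N : ℝ) - 1) / η * profileH N γ α η) + C * E η) * Real.exp (C * η))
      · simp only [E]
        fun_prop
      · intro η hη
        rw [interior_Icc] at hη
        have h0 := hε.1.trans hη.1
        have h1 := (hasDerivAt_profileW (N := N) hγ hγ' hN α h0).pow 2
        have h2 := (hasDerivAt_profileH (N := N) hγ hγ' hN α h0).pow 2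
        have h3 : HasDerivAt (fun η : ℝ => Real.exp (C * η)) (Real.exp (C * η) * C) η := by
          apply HasDerivAt.exp
          simpa using (hasDerivAt_id η).const_mul C
        refine (((h1.add h2).mul h3).congr_deriv ?_).hasDerivWithinAt
        simp only [Pi.add_apply, Pi.pow_apply, E]
        push_cast
        ring
      · intro η hη
        rw [interior_Icc] at hη
        have h0 := hε.1.trans hη.1
        refine mul_nonneg ?_ (Real.exp_pos _).le
        simp only [profileDW, E]
        set w := profileW N γ α η
        set h := profileH N γ α η
        have hG : |flux γ w| ≤ |w| := abs_flux_le hγ hγ' w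
        have e1 : |w * h| ≤ (w ^ 2 + h ^ 2) / 2 := by
          rw [abs_le]; constructor <;> nlinarith [sq_nonneg (w + h), sq_nonneg (w - h)]
        have e2 : |w * flux γ w| ≤ w ^ 2 := by
          rw [abs_mul, ← sq_abs w, sq]
          gcongr
        have e3 : |h * flux γ w| ≤ (w ^ 2 + h ^ 2) / 2 := by
          refine le_trans ?_ e1
          rw [abs_mul, abs_mul, mul_comm]
          gcongr
        have e4 : |μ * (w * h)| ≤ |μ| * ((w ^ 2 + h ^ 2) / 2) := by
          rw [abs_mul]; gcongr
        have e5 : ((N : ℝ) - 1) / η ≤ ((N : ℝ) - 1) / ε :=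
          div_le_div_of_nonneg_left hN' hε.1 hη.1.le
        have e6 : ((N : ℝ) - 1) / η * h ^ 2 ≤ ((N : ℝ) - 1) / ε * (w ^ 2 + h ^ 2) := by
          have : 0 ≤ ((N : ℝ) - 1) / ε := div_nonneg hN' hε.1.le
          calc _ ≤ ((N : ℝ) - 1) / ε * h ^ 2 := by gcongr
            _ ≤ _ := by gcongr; nlinarith [sq_nonneg w]
        have e7 : η * |w * flux γ w| ≤ x * (w ^ 2 + h ^ 2) := by
          have : w ^ 2 ≤ w ^ 2 + h ^ 2 := by nlinarith [sq_nonneg h]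
          have hη2 := hη.2.le
          calc η * |w * flux γ w| ≤ x * w ^ 2 := by gcongr
            _ ≤ _ := by gcongr
        have a1 := neg_abs_le (μ * (w * h))
        have a2 := neg_abs_le (w * flux γ w)
        have a3 := neg_abs_le (h * flux γ w)
        have a4 : -(η * |w * flux γ w|) ≤ η * (w * flux γ w) := by nlinarith
        simp only [C]
        have : 0 ≤ 2 * (|μ| * ((w ^ 2 + h ^ 2) / 2)) - 2 * |μ * (w * h)| := by linarith
        nlinarith [sq_nonneg w, sq_nonneg h]
    have h1 := hmono ⟨le_rfl, hε.2⟩ ⟨hε.2, le_rfl⟩ hε.2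
    simp only [E, hW, hh] at h1
    have h2 : profileW N γ α ε ^ 2 + profileH N γ α ε ^ 2 ≤ 0 := by
      by_contra hcon
      have := mul_pos (not_le.1 hcon) (Real.exp_pos (C * ε))
      norm_num at h1
      linarith
    nlinarith [sq_nonneg (profileW N γ α ε), sq_nonneg (profileH N γ α ε)]
  -- letting `ε → 0` contradicts `W(0) = 1`
  have hlim : Tendsto (profileW N γ α) (𝓝[>] 0) (𝓝 (profileW N γ α 0)) :=
    ((continuous_profileW_right hγ hγ' α).tendsto 0).mono_left nhdsWithin_le_nhds
  rw [profileW_zero hγ hγ'] at hlim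
  have hev : ∀ᶠ ε in 𝓝[>] (0 : ℝ), profileW N γ α ε = 0 := by
    filter_upwards [Ioo_mem_nhdsGT hx0] with ε hε using hzero ε ⟨hε.1, hε.2.le⟩
  have := tendsto_nhds_unique (hlim.congr' hev) tendsto_const_nhds
  norm_num at this

lemma profileDW_ne_zero (hN : 1 ≤ N) {α x : ℝ} (hx : x ∈ profileZeros N γ α) :
    profileDW N γ α x ≠ 0 := by
  rw [profileDW_of_zero hx.2]
  have := lt_of_mem_zeros hγ hγ' hN hx
  exact mul_ne_zero (by linarith) (profileH_ne_zero hγ hγ' hN hx)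

lemma IsNode.eventually_pos (hN : 1 ≤ N) {α : ℝ} {k : ℕ} {x : ℝ} (h : IsNode N γ α k x) :
    ∀ᶠ t in 𝓝[>] x, 0 < (-1) ^ k * profileW N γ α t := by
  rcases k with _ | k
  · have hx : x = 0 := h
    have := ((continuous_profileW_right (N := N) hγ hγ' α).tendsto x).eventually
      (lt_mem_nhds (a := 0) (by rw [hx, profileW_zero hγ hγ']; norm_num))
    simpa using this.filter_mono nhdsWithin_le_nhds
  · have hz := h.mem_zeros
    obtain ⟨y, hy, hyx, h0, hp⟩ := h
    have hd := (hasDerivAt_profileW (N := N) hγ hγ' hN α hz.1).const_mul ((-1 : ℝ) ^ k)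
    have h1 := deriv_nonpos_of_pos_left hd (by simp [h0]) hyx hp
    have h2 : (-1 : ℝ) ^ k * profileDW N γ α x ≠ 0 :=
      mul_ne_zero (pow_ne_zero _ (by norm_num)) (profileDW_ne_zero hγ hγ' hN hz)
    have h3 := (eventually_pos_of_hasDerivAt hd.neg (by simp [h0])
      (neg_pos.2 (lt_of_le_of_ne h1 h2))).1
    filter_upwards [h3] with t ht
    rw [pow_succ]
    simp only [Pi.neg_apply] at ht
    linarith

lemma IsNode.exists_succ (hN : 1 ≤ N) {α : ℝ} {k : ℕ} {y t : ℝ} (h : IsNode N γ α k y)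
    (hyt : y < t) (ht : (-1) ^ k * profileW N γ α t ≤ 0) :
    ∃ x, y < x ∧ x ≤ t ∧ IsNode N γ α (k + 1) x := by
  obtain ⟨b, hb, hpos⟩ := (mem_nhdsGT_iff_exists_Ioo_subset).1
    ((h.eventually_pos hγ hγ' hN).and (Ioo_mem_nhdsGT hyt))
  have hb' : y < b := hb
  have hR := hpos (⟨by linarith, by linarith⟩ : (y + b) / 2 ∈ Set.Ioo y b)
  obtain ⟨x, hRx, hxt, hx0, hxp⟩ := exists_first_zero (y := fun t => (-1) ^ k * profileW N γ α t)
    hR.2.2.le (continuous_const.mul (continuous_profileW_right hγ hγ' α)).continuousOn hR.1 ht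
  have hyx : y < x := by linarith
  refine ⟨x, hyx, hxt, y, h, hyx, ?_, fun τ hτ => ?_⟩
  · simpa using hx0
  · rcases lt_or_ge τ ((y + b) / 2) with h1 | h1
    · exact (hpos (⟨hτ.1, by linarith⟩ : τ ∈ Set.Ioo y b)).1
    · exact hxp τ ⟨h1, hτ.2⟩

/-- `W` cannot change sign again once it lies above a multiple of `η^(-A)`. -/
lemma profileW_trapped (hN : 1 ≤ N) {α s R A : ℝ} (hs : s = 1 ∨ s = -1) (hR : 0 < R)
    (hAR : ∀ η, R ≤ η → A * (A + 2 - N) ≤ zoneCoeff γ s * (A - (α + 2)) * η ^ 2)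
    (h0 : 0 < s * profileW N γ α R)
    (h1 : 0 < s * (R * profileDW N γ α R + A * profileW N γ α R)) :
    ∀ η, R ≤ η → 0 < s * profileW N γ α η := by
  have hcW := continuous_profileW_right (N := N) hγ hγ' α
  have hcD := continuous_profileDW_right (N := N) hγ hγ' α
  refine pos_of_trapped (y := fun η => s * profileW N γ α η)
    (dy := fun η => s * profileDW N γ α η) hN hR hAR (by fun_prop) (by fun_prop) ?_ h0 ?_
  · intro x _ hpos
    exact (profileW_zoneSol hγ hγ' hN α hs isOpen_Ioo (fun η hη => hR.trans hη.1) hpos).const_mul s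
  · linarith

/-- No zero follows a zero that lies far enough out. -/
lemma profileW_ne_zero_of_gt (hN : 1 ≤ N) {α x : ℝ} (hx : x ∈ profileZeros N γ α)
    (hfar : ∀ s : ℝ, s = 1 ∨ s = -1 → ∀ η, x ≤ η →
      (α + 3) * (α + 5 - N) ≤ zoneCoeff γ s * η ^ 2) :
    ∀ t, x < t → profileW N γ α t ≠ 0 := by
  intro t hxt
  obtain ⟨s, hs, hsd⟩ : ∃ s : ℝ, (s = 1 ∨ s = -1) ∧ 0 < s * profileDW N γ α x := by
    rcases lt_or_gt_of_ne (profileDW_ne_zero hγ hγ' hN hx) with h | h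
    · exact ⟨-1, Or.inr rfl, by linarith⟩
    · exact ⟨1, Or.inl rfl, by linarith⟩
  have hd := (hasDerivAt_profileW (N := N) hγ hγ' hN α hx.1).const_mul s
  have e1 := (eventually_pos_of_hasDerivAt hd (by simp [hx.2]) hsd).1
  have e2 : ∀ᶠ τ in 𝓝[>] x, 0 < s * (τ * profileDW N γ α τ + (α + 3) * profileW N γ α τ) := by
    have hcW := continuous_profileW_right (N := N) hγ hγ' α
    have hcD := continuous_profileDW_right (N := N) hγ hγ' α
    have hc : Continuous fun τ => s * (τ * profileDW N γ α τ + (α + 3) * profileW N γ α τ) := by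
      fun_prop
    refine ((hc.tendsto x).eventually (lt_mem_nhds ?_)).filter_mono nhdsWithin_le_nhds
    have := mul_pos hx.1 hsd
    rw [hx.2]
    linarith
  -- just beyond a simple zero, `s W` and `s (η W' + A W)` are positive for `A = α + 3`
  obtain ⟨R, ⟨hR1, hR2⟩, hR3⟩ := ((e1.and e2).and (Ioo_mem_nhdsGT hxt)).exists
  have := profileW_trapped hγ hγ' hN (A := α + 3) hs (hx.1.trans hR3.1) (fun η hη => by
    have := hfar s hs η (hR3.1.le.trans hη)
    have e : α + 3 - (α + 2) = (1 : ℝ) := by ring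
    rw [e]
    linarith) hR1 hR2 t hR3.2.le
  intro h0
  simp [h0] at this

omit hγ hγ' in
/-- Far enough out, uniformly for parameters in a bounded set. -/
lemma exists_far (hγ : -1 < γ) (hγ' : γ < 1) (N : ℕ) (B : ℝ) :
    ∃ R, 0 < R ∧ ∀ α, |α| ≤ B → ∀ s : ℝ, s = 1 ∨ s = -1 → ∀ η, R ≤ η →
      2 * ((α + 3) * (α + 5 - N)) ≤ zoneCoeff γ s * η ^ 2 := by
  have hc1 := zoneCoeff_pos hγ hγ' (Or.inl rfl)
  have hc2 := zoneCoeff_pos hγ hγ' (Or.inr rfl)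
  set c := min (zoneCoeff γ 1) (zoneCoeff γ (-1))
  have hc : 0 < c := lt_min hc1 hc2
  set M := 2 * ((|B| + 3) * (|B| + 5 + N)) with hM
  have hM0 : 0 < M := by positivity
  refine ⟨M / c + 1, by positivity, fun α hα s hs η hη => ?_⟩
  have hcs : c ≤ zoneCoeff γ s := by
    rcases hs with rfl | rfl
    · exact min_le_left _ _
    · exact min_le_right _ _
  have hη1 : 1 ≤ η := by have : 0 < M / c := by positivity
                         linarith
  have h1 : M ≤ c * η := by
    have : M / c ≤ η := by linarith
    rwa [div_le_iff₀ hc, mul_comm] at this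
  have h2 : c * η ≤ zoneCoeff γ s * η ^ 2 := by
    have : c * η ≤ c * η ^ 2 := by nlinarith
    have : c * η ^ 2 ≤ zoneCoeff γ s * η ^ 2 := by gcongr
    linarith
  have h3 : 2 * ((α + 3) * (α + 5 - N)) ≤ M := by
    have hB : |α| ≤ |B| := hα.trans (le_abs_self B)
    have hn : (0 : ℝ) ≤ N := Nat.cast_nonneg N
    have : |(α + 3) * (α + 5 - N)| ≤ (|B| + 3) * (|B| + 5 + N) := by
      rw [abs_mul]
      have a1 : |α + 3| ≤ |B| + 3 := (abs_add_le _ _).trans (by norm_num; exact hB)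
      have a2 : |α + 5 - N| ≤ |B| + 5 + N := by
        have := abs_le.1 hB
        rw [abs_le]; constructor <;> linarith
      gcongr
    have := le_abs_self ((α + 3) * (α + 5 - (N : ℝ)))
    rw [hM]; linarith
  linarith

omit hγ hγ' in
lemma far_of_two_mul {c η a : ℝ} (hc : 0 < c) (h : 2 * a ≤ c * η ^ 2) : a ≤ c * η ^ 2 := by
  have : 0 ≤ c * η ^ 2 := by positivity
  linarith

lemma finite_profileZeros_inter (hN : 1 ≤ N) (α R : ℝ) :
    (profileZeros N γ α ∩ Set.Iic R).Finite := by
  by_contra hinf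
  have hsub : profileZeros N γ α ∩ Set.Iic R ⊆ Set.Icc 0 R := fun x hx => ⟨hx.1.1.le, hx.2⟩
  obtain ⟨x, hx, hacc⟩ := Set.Infinite.exists_accPt_of_subset_isCompact hinf isCompact_Icc hsub
  have hfreq := accPt_iff_frequently_nhdsNE.1 hacc
  have hW : profileW N γ α x = 0 := by
    have hcl : IsClosed {x | profileW N γ α x = 0} :=
      isClosed_eq (continuous_profileW_right hγ hγ' α) continuous_const
    refine hcl.closure_subset ?_
    rw [mem_closure_iff_frequently]
    exact (hfreq.filter_mono nhdsWithin_le_nhds).mono fun y hy => hy.1.2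
  have hx0 : 0 < x := by
    rcases hx.1.eq_or_lt with h | h
    · rw [← h, profileW_zero hγ hγ'] at hW; norm_num at hW
    · exact h
  have hne := (hasDerivAt_profileW (N := N) hγ hγ' hN α hx0).eventually_ne
    (c := 0) (profileDW_ne_zero hγ hγ' hN ⟨hx0, hW⟩)
  obtain ⟨y, hy1, hy2⟩ := (hfreq.and_eventually hne).exists
  exact hy2 hy1.1.2

lemma finite_profileZeros (hN : 1 ≤ N) (α : ℝ) : (profileZeros N γ α).Finite := by
  obtain ⟨R, hR, hfar⟩ := exists_far hγ hγ' N |α|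
  have hsub : (profileZeros N γ α ∩ Set.Ioi R).Subsingleton := by
    have key : ∀ x ∈ profileZeros N γ α ∩ Set.Ioi R, ∀ y ∈ profileZeros N γ α ∩ Set.Ioi R,
        ¬x < y := by
      intro x hx y hy hxy
      refine profileW_ne_zero_of_gt hγ hγ' hN hx.1 (fun s hs η hη => ?_) y hxy hy.1.2
      have hxR : R < x := hx.2
      exact far_of_two_mul (zoneCoeff_pos hγ hγ' hs) (hfar α le_rfl s hs η (hxR.le.trans hη))
    intro x hx y hy
    exact le_antisymm (not_lt.1 (key y hy x hx)) (not_lt.1 (key x hx y hy))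
  refine ((finite_profileZeros_inter hγ hγ' hN α R).union hsub.finite).subset fun x hx => ?_
  rcases le_or_gt x R with h | h
  · exact Or.inl ⟨hx, h⟩
  · exact Or.inr ⟨hx, h⟩

lemma IsNode.le_ncard (hN : 1 ≤ N) {α : ℝ} {k : ℕ} {x : ℝ} (h : IsNode N γ α k x) :
    k ≤ (profileZeros N γ α).ncard := by
  rw [← h.ncard.2]
  exact Set.ncard_le_ncard Set.inter_subset_left (finite_profileZeros hγ hγ' hN α)

/-- There is a last node, beyond which `W` keeps its sign. -/
lemma exists_last_node (hN : 1 ≤ N) (α : ℝ) :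
    ∃ k x, IsNode N γ α k x ∧ ∀ t, x < t → 0 < (-1) ^ k * profileW N γ α t := by
  by_contra hcon
  push Not at hcon
  have hall : ∀ k, ∃ x, IsNode N γ α k x := by
    intro k
    induction k with
    | zero => exact ⟨0, rfl⟩
    | succ k ih =>
      obtain ⟨x, hx⟩ := ih
      obtain ⟨t, ht1, ht2⟩ := hcon k x hx
      obtain ⟨x', -, -, hx'⟩ := hx.exists_succ hγ hγ' hN ht1 ht2
      exact ⟨x', hx'⟩
  obtain ⟨x, hx⟩ := hall ((profileZeros N γ α).ncard + 1)
  have := hx.le_ncard hγ hγ' hN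
  omega

lemma IsNode.pos_of_not_exists_succ (hN : 1 ≤ N) {α : ℝ} {k : ℕ} {x : ℝ} (h : IsNode N γ α k x)
    (h' : ¬∃ x', IsNode N γ α (k + 1) x') {t : ℝ} (ht : x < t) :
    0 < (-1) ^ k * profileW N γ α t := by
  by_contra hcon
  obtain ⟨x', -, -, hx'⟩ := h.exists_succ hγ hγ' hN ht (not_lt.1 hcon)
  exact h' ⟨x', hx'⟩

omit hγ hγ' in
lemma IsNode.not_exists_succ {α : ℝ} {k : ℕ} {x : ℝ} (h : IsNode N γ α k x)
    (h' : ∀ t, x < t → 0 < (-1) ^ k * profileW N γ α t) : ¬∃ x', IsNode N γ α (k + 1) x' := by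
  rintro ⟨x', y, hy, hyx, h0, -⟩
  obtain rfl := h.unique hy
  have := h' x' hyx
  simp [h0] at this

omit hγ hγ' in
lemma exists_node_of_le {α : ℝ} {k l : ℕ} (hkl : k ≤ l) (h : ∃ x, IsNode N γ α l x) :
    ∃ x, IsNode N γ α k x := by
  induction l, hkl using Nat.le_induction with
  | base => exact h
  | succ l _ ih =>
    obtain ⟨x, y, hy, -⟩ := h
    exact ih ⟨y, hy⟩

end profile

/-! ### Dependence of the zeros on the exponent -/

/-- `IsAlternating N γ α k t` says that `W` takes the signs `1, -1, …, (-1)^k` at some points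
`0 < t₀ < ⋯ < t_k = t`. Unlike the existence of nodes, this is visibly open in `α`. -/
def IsAlternating (N : ℕ) (γ α : ℝ) : ℕ → ℝ → Prop
  | 0, t => 0 < profileW N γ α t
  | k + 1, t => 0 < (-1) ^ (k + 1) * profileW N γ α t ∧
      ∃ u, 0 < u ∧ u < t ∧ IsAlternating N γ α k u

section profile

variable {N : ℕ} {γ : ℝ} (hγ : -1 < γ) (hγ' : γ < 1)
include hγ hγ'

lemma isOpen_isAlternating (k : ℕ) (t : ℝ) : IsOpen {α | IsAlternating N γ α k t} := by
  induction k generalizing t with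
  | zero => exact isOpen_lt continuous_const (continuous_profileW_left hγ hγ' t)
  | succ k ih =>
    have : {α | IsAlternating N γ α (k + 1) t} =
        {α | 0 < (-1) ^ (k + 1) * profileW N γ α t} ∩
          ⋃ u ∈ Set.Ioo 0 t, {α | IsAlternating N γ α k u} := by
      ext α
      simp only [IsAlternating, Set.mem_inter_iff, Set.mem_iUnion, Set.mem_Ioo, exists_prop,
        Set.mem_ofPred_eq, and_assoc]
    rw [this]
    exact (isOpen_lt continuous_const
      (continuous_const.mul (continuous_profileW_left hγ hγ' t))).inter
      (isOpen_biUnion fun u _ => ih u)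

lemma IsAlternating.exists_node (hN : 1 ≤ N) {α : ℝ} {k : ℕ} {t : ℝ} (ht : 0 < t)
    (h : IsAlternating N γ α k t) : ∃ y, y < t ∧ IsNode N γ α k y := by
  induction k generalizing t with
  | zero => exact ⟨0, ht, rfl⟩
  | succ k ih =>
    obtain ⟨h1, u, hu0, hut, hu⟩ := h
    obtain ⟨y, hy, hny⟩ := ih hu0 hu
    have h2 : (-1) ^ k * profileW N γ α t < 0 := by
      rw [pow_succ] at h1; linarith
    obtain ⟨x, -, hxt, hx⟩ := hny.exists_succ hγ hγ' hN (hy.trans hut) h2.le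
    refine ⟨x, lt_of_le_of_ne hxt ?_, hx⟩
    rintro rfl
    simp [hx.mem_zeros.2] at h2

lemma IsNode.exists_isAlternating (hN : 1 ≤ N) {α : ℝ} {k : ℕ} {y b : ℝ}
    (h : IsNode N γ α k y) (hb : y < b) : ∃ t ∈ Set.Ioo y b, IsAlternating N γ α k t := by
  induction k generalizing y b with
  | zero =>
    obtain ⟨t, ht1, ht2⟩ := ((h.eventually_pos hγ hγ' hN).and (Ioo_mem_nhdsGT hb)).exists
    exact ⟨t, ht2, by simpa [IsAlternating] using ht1⟩
  | succ k ih =>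
    obtain ⟨t, ht1, ht2⟩ := ((h.eventually_pos hγ hγ' hN).and (Ioo_mem_nhdsGT hb)).exists
    obtain ⟨z, hz, hzy, -, -⟩ := h
    obtain ⟨u, hu, hua⟩ := ih hz hzy
    exact ⟨t, ht2, ht1, u, hz.nonneg.trans_lt hu.1, hu.2.trans ht2.1, hua⟩

lemma isOpen_exists_node (hN : 1 ≤ N) (k : ℕ) : IsOpen {α | ∃ x, IsNode N γ α k x} := by
  have : {α | ∃ x, IsNode N γ α k x} = ⋃ t ∈ Set.Ioi (0 : ℝ), {α | IsAlternating N γ α k t} := by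
    ext α
    simp only [Set.mem_ofPred_eq, Set.mem_iUnion, Set.mem_Ioi, exists_prop]
    constructor
    · rintro ⟨x, hx⟩
      obtain ⟨t, ht, hta⟩ := hx.exists_isAlternating hγ hγ' hN (lt_add_one x)
      exact ⟨t, hx.nonneg.trans_lt ht.1, hta⟩
    · rintro ⟨t, ht, hta⟩
      obtain ⟨y, -, hy⟩ := hta.exists_node hγ hγ' hN ht
      exact ⟨y, hy⟩
  rw [this]
  exact isOpen_biUnion fun t _ => isOpen_isAlternating hγ hγ' k t

/-- The weighted Wronskian of `W` for two exponents `α < α'`. -/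
lemma strictMonoOn_wronskian (hN : 1 ≤ N) {α α' : ℝ} (hα : α < α') {k : ℕ} {y y' b : ℝ}
    (hy : IsNode N γ α k y) (hy' : IsNode N γ α' k y') (hle : y' ≤ y) (hb : y < b)
    (hW : ∀ t ∈ Set.Ioo y b, 0 < (-1) ^ k * profileW N γ α t)
    (hV : ∀ t ∈ Set.Ioo y' b, 0 < (-1) ^ k * profileW N γ α' t) :
    StrictMonoOn (fun η => zoneWeight N (zoneCoeff γ ((-1) ^ k)) η *
      (profileW N γ α' η * profileDW N γ α η - profileDW N γ α' η * profileW N γ α η))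
      (Set.Icc y b) ∧
    0 ≤ zoneWeight N (zoneCoeff γ ((-1) ^ k)) y *
      (profileW N γ α' y * profileDW N γ α y - profileDW N γ α' y * profileW N γ α y) := by
  have hs := neg_one_pow_eq k
  set s : ℝ := (-1) ^ k with hsd
  have hss : s * s = 1 := neg_one_pow_mul_self k
  set c := zoneCoeff γ s with hcd
  have hc : 0 < c := zoneCoeff_pos hγ hγ' hs
  have hy0 := hy.nonneg
  have c1 := continuous_profileW_right (N := N) hγ hγ' α
  have c2 := continuous_profileW_right (N := N) hγ hγ' α'
  have c3 := continuous_profileDW_right (N := N) hγ hγ' α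
  have c4 := continuous_profileDW_right (N := N) hγ hγ' α'
  have c5 := continuous_zoneWeight N c
  have hpos : ∀ η ∈ Set.Ioo y b, 0 < η := fun η hη => hy0.trans_lt hη.1
  have hV' : ∀ t ∈ Set.Ioo y b, 0 < s * profileW N γ α' t := fun t ht =>
    hV t ⟨hle.trans_lt ht.1, ht.2⟩
  have z1 := profileW_zoneSol hγ hγ' hN α hs isOpen_Ioo hpos hW
  have z2 := profileW_zoneSol hγ hγ' hN α' hs isOpen_Ioo hpos hV'
  constructor
  · apply strictMonoOn_of_hasDerivWithinAt_pos (convex_Icc y b) (by fun_prop)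
      (f' := fun η => c * ((α' + 2) - (α + 2)) *
        (zoneWeight N c η * (profileW N γ α' η * profileW N γ α η)))
    · intro η hη
      rw [interior_Icc] at hη
      exact (hasDerivAt_wronskian hN z2 z1 (hpos η hη) hη).hasDerivWithinAt
    · intro η hη
      rw [interior_Icc] at hη
      have hp := zoneWeight_pos N c (hpos η hη)
      have h1 : 0 < profileW N γ α' η * profileW N γ α η := by
        have := mul_pos (hV' η hη) (hW η hη)
        have e : s * profileW N γ α' η * (s * profileW N γ α η)
          = (s * s) * (profileW N γ α' η * profileW N γ α η) := by ring
        rwa [e, hss, one_mul] at this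
      have h2 : 0 < α' + 2 - (α + 2) := by linarith
      positivity
  · rcases k with _ | k
    · have e1 : y = 0 := hy
      simp [e1, profileDW_zero]
    · have hz := hy.mem_zeros
      have hd := (hasDerivAt_profileW (N := N) hγ hγ' hN α hz.1).const_mul s
      have h1 : 0 ≤ s * profileDW N γ α y := deriv_nonneg_of_pos_right hd (by simp [hz.2]) hb hW
      have h2 : 0 ≤ s * profileW N γ α' y := by
        rcases hle.eq_or_lt with h | h
        · rw [← h, hy'.mem_zeros.2, mul_zero]
        · exact (hV y ⟨h, hb⟩).le
      have h3 : 0 ≤ profileW N γ α' y * profileDW N γ α y := by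
        have := mul_nonneg h2 h1
        have e : s * profileW N γ α' y * (s * profileDW N γ α y)
          = (s * s) * (profileW N γ α' y * profileDW N γ α y) := by ring
        rwa [e, hss, one_mul] at this
      rw [hz.2, mul_zero, sub_zero]
      exact mul_nonneg (zoneWeight_pos N c hz.1).le h3

/-- Sturm comparison: the nodes move to the left when the exponent grows. -/
lemma IsNode.exists_le_of_lt (hN : 1 ≤ N) {α α' : ℝ} (hα : α < α') {k : ℕ} {x : ℝ}
    (h : IsNode N γ α k x) : ∃ x' ≤ x, IsNode N γ α' k x' := by
  induction k generalizing x with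
  | zero => exact ⟨x, le_rfl, h⟩
  | succ k ih =>
    have hx := h.mem_zeros
    obtain ⟨y, hy, hyx, h0, hW⟩ := h
    obtain ⟨y', hle, hy'⟩ := ih hy
    by_cases hV : ∀ t ∈ Set.Ioo y' x, 0 < (-1) ^ k * profileW N γ α' t
    · exfalso
      obtain ⟨hmono, hst⟩ := strictMonoOn_wronskian hγ hγ' hN hα hy hy' hle hyx hW hV
      have h1 := hmono ⟨le_rfl, hyx.le⟩ ⟨hyx.le, le_rfl⟩ hyx
      simp only [h0, mul_zero, sub_zero] at h1
      have hd := (hasDerivAt_profileW (N := N) hγ hγ' hN α hx.1).const_mul ((-1 : ℝ) ^ k)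
      have h2 := deriv_nonpos_of_pos_left hd (by simp [h0]) hyx hW
      have h3 : 0 ≤ (-1) ^ k * profileW N γ α' x := by
        have hc : Continuous fun t => (-1) ^ k * profileW N γ α' t :=
          continuous_const.mul (continuous_profileW_right hγ hγ' α')
        have hev : ∀ᶠ t in 𝓝[<] x, 0 ≤ (-1) ^ k * profileW N γ α' t := by
          filter_upwards [Ioo_mem_nhdsLT (hle.trans_lt hyx)] with t ht using (hV t ht).le
        exact ge_of_tendsto ((hc.tendsto x).mono_left nhdsWithin_le_nhds) hev
      have h4 : profileW N γ α' x * profileDW N γ α x ≤ 0 := by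
        have := mul_nonpos_of_nonneg_of_nonpos h3 h2
        have e : (-1) ^ k * profileW N γ α' x * ((-1) ^ k * profileDW N γ α x)
          = ((-1) ^ k * (-1) ^ k) * (profileW N γ α' x * profileDW N γ α x) := by ring
        rwa [e, neg_one_pow_mul_self, one_mul] at this
      have h5 := mul_nonpos_of_nonneg_of_nonpos
        (zoneWeight_pos N (zoneCoeff γ ((-1) ^ k)) hx.1).le h4
      linarith
    · push Not at hV
      obtain ⟨t, ht, hneg⟩ := hV
      obtain ⟨x', -, hx't, hx'⟩ := hy'.exists_succ hγ hγ' hN ht.1 hneg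
      exact ⟨x', hx't.trans ht.2.le, hx'⟩

/-- Sturm comparison on a half-line: if `W` decays like a Gaussian beyond its last node, then
every larger exponent has one more node. Otherwise the quotient of the two solutions would have
a derivative bounded above by a negative number. -/
lemma IsNode.exists_succ_of_decay (hN : 1 ≤ N) {α α' : ℝ} (hα : α < α') {k : ℕ} {y : ℝ}
    (hy : IsNode N γ α k y) (hW : ∀ t, y < t → 0 < (-1) ^ k * profileW N γ α t)
    (hdec : Tendsto (fun η => zoneWeight N (zoneCoeff γ ((-1) ^ k)) η * profileW N γ α η ^ 2)
      atTop (𝓝 0)) : ∃ x', IsNode N γ α' (k + 1) x' := by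
  obtain ⟨y', hle, hy'⟩ := hy.exists_le_of_lt hγ hγ' hN hα
  by_contra hcon
  have hV : ∀ t, y' < t → 0 < (-1) ^ k * profileW N γ α' t := fun t ht =>
    hy'.pos_of_not_exists_succ hγ hγ' hN hcon ht
  set c := zoneCoeff γ ((-1) ^ k)
  set ω : ℝ → ℝ := fun η => zoneWeight N c η *
      (profileW N γ α' η * profileDW N γ α η - profileDW N γ α' η * profileW N γ α η) with hω
  have hmono : ∀ b, y < b → StrictMonoOn ω (Set.Icc y b) ∧ 0 ≤ ω y := fun b hb =>
    strictMonoOn_wronskian hγ hγ' hN hα hy hy' hle hb (fun t ht => hW t ht.1)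
      (fun t ht => hV t ht.1)
  set δ := ω (y + 1) with hδ
  have hδ0 : 0 < δ := by
    have h := hmono (y + 1) (by linarith)
    exact h.2.trans_lt (h.1 ⟨le_rfl, by linarith⟩ ⟨by linarith, le_rfl⟩ (by linarith))
  have hδle : ∀ η, y + 1 ≤ η → δ ≤ ω η := fun η hη =>
    (hmono η (by linarith)).1.monotoneOn ⟨by linarith, hη⟩ ⟨by linarith, le_rfl⟩ hη
  obtain ⟨R, hR⟩ := eventually_atTop.1 ((hdec.eventually (gt_mem_nhds one_pos)).and
    (eventually_ge_atTop (y + 1)))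
  have hy0 := hy.nonneg
  have hRy : y + 1 ≤ R := (hR R le_rfl).2
  let r : ℝ → ℝ := fun η => profileW N γ α' η / profileW N γ α η
  have hne : ∀ η, y < η → profileW N γ α η ≠ 0 := fun η hη h0 => by
    have := hW η hη
    simp [h0] at this
  have hr0 : ∀ η, y < η → 0 < r η := fun η hη => by
    have h1 := hW η hη
    have h2 := hV η (hle.trans_lt hη)
    rcases neg_one_pow_eq k with h | h
    · rw [h, one_mul] at h1 h2
      exact div_pos h2 h1
    · rw [h] at h1 h2
      exact div_pos_of_neg_of_neg (by linarith) (by linarith)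
  -- `r' = -ω / (p W²) ≤ -δ` as soon as `p W² ≤ 1`, so that `r` becomes negative
  have hanti : AntitoneOn (fun η => r η + δ * η) (Set.Ici R) := by
    have hd : ∀ η, R ≤ η → HasDerivAt (fun η => r η + δ * η)
        (-(ω η) / (zoneWeight N c η * profileW N γ α η ^ 2) + δ) η := by
      intro η hη
      have hη0 : 0 < η := by linarith
      have hp := zoneWeight_pos N c hη0
      have hn := hne η (by linarith)
      have d1 := (hasDerivAt_profileW (N := N) hγ hγ' hN α' hη0).div
        (hasDerivAt_profileW (N := N) hγ hγ' hN α hη0) hn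
      refine (d1.add ((hasDerivAt_id η).const_mul δ)).congr_deriv ?_
      simp only [hω]
      field_simp
      ring
    apply antitoneOn_of_hasDerivWithinAt_nonpos (convex_Ici R)
      (fun η hη => (hd η hη).continuousAt.continuousWithinAt)
      (f' := fun η => -(ω η) / (zoneWeight N c η * profileW N γ α η ^ 2) + δ)
    · intro η hη
      exact (hd η (interior_subset hη)).hasDerivWithinAt
    · intro η hη
      have hη' : R ≤ η := interior_subset hη
      have hη0 : 0 < η := by linarith
      have hp := zoneWeight_pos N c hη0
      have hq : 0 < zoneWeight N c η * profileW N γ α η ^ 2 := by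
        have := hne η (by linarith)
        positivity
      have h1 := (hR η hη').1
      have h2 := hδle η (by linarith)
      have : ω η ≤ ω η / (zoneWeight N c η * profileW N γ α η ^ 2) := by
        rw [le_div_iff₀ hq]
        nlinarith
      rw [neg_div]
      linarith
  have h1 : R ≤ R + r R / δ := by
    have := hr0 R (by linarith)
    have : 0 < r R / δ := by positivity
    linarith
  have h2 := hanti (Set.mem_Ici.2 le_rfl) (Set.mem_Ici.2 h1) h1
  have h3 := hr0 (R + r R / δ) (by linarith)
  have e : δ * (R + r R / δ) = δ * R + r R := by field_simp
  simp only [e] at h2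
  linarith

/-- Zeros in a bounded interval do not split under a small change of the exponent, because they
are simple. -/
lemma eventually_ncard_zeros_le (hN : 1 ≤ N) (α R : ℝ) :
    ∀ᶠ α' in 𝓝 α, (profileZeros N γ α' ∩ Set.Iic R).ncard
      ≤ (profileZeros N γ α ∩ Set.Iic R).ncard := by
  set Z := profileZeros N γ α ∩ Set.Iic R
  have hZ : Z.Finite := finite_profileZeros_inter hγ hγ' hN α R
  -- around each zero there is a ball on which `W'` does not vanish for nearby exponents
  have hloc : ∀ z : ℝ, ∃ ε > 0, z ∈ Z → ∀ᶠ α' in 𝓝 α, ∀ x ∈ Metric.ball z ε,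
      profileDW N γ α' x ≠ 0 ∧ 0 < x := by
    intro z
    by_cases hz : z ∈ Z
    · have h1 : ∀ᶠ p : ℝ × ℝ in 𝓝 (α, z), profileDW N γ p.1 p.2 ≠ 0 ∧ 0 < p.2 := by
        have a1 := (continuous_profileDW (N := N) hγ hγ').tendsto (α, z) |>.eventually_ne
          (profileDW_ne_zero hγ hγ' hN hz.1)
        have a2 := (continuous_snd.tendsto (α, z)).eventually (lt_mem_nhds hz.1.1)
        exact a1.and a2
      rw [nhds_prod_eq] at h1
      obtain ⟨pa, hpa, pb, hpb, hab⟩ := eventually_prod_iff.1 h1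
      obtain ⟨ε, hε, hball⟩ := Metric.eventually_nhds_iff_ball.1 hpb
      exact ⟨ε, hε, fun _ => hpa.mono fun α' hα' x hx => hab hα' (hball x hx)⟩
    · exact ⟨1, one_pos, fun h => absurd h hz⟩
  choose ε hε hloc using hloc
  have e1 : ∀ᶠ α' in 𝓝 α, ∀ z ∈ Z, ∀ x ∈ Metric.ball z (ε z),
      profileDW N γ α' x ≠ 0 ∧ 0 < x :=
    (hZ.eventually_all (l := 𝓝 α)).2 fun z hz => hloc z hz
  -- outside these balls there are no zeros for nearby exponents, by compactness
  have hK : IsCompact (Set.Icc 0 R \ ⋃ z ∈ Z, Metric.ball z (ε z)) :=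
    isCompact_Icc.diff (isOpen_biUnion fun z _ => Metric.isOpen_ball)
  have e2 : ∀ᶠ α' in 𝓝 α, ∀ x ∈ Set.Icc 0 R \ ⋃ z ∈ Z, Metric.ball z (ε z),
      profileW N γ α' x ≠ 0 := by
    apply hK.eventually_forall_of_forall_eventually
    intro x hx
    refine ((continuous_profileW (N := N) hγ hγ').tendsto (α, x)).eventually_ne ?_
    intro h0
    have hx0 : 0 < x := by
      rcases hx.1.1.eq_or_lt with h | h
      · simp only [← h, profileW_zero hγ hγ'] at h0; norm_num at h0
      · exact h
    exact hx.2 (Set.mem_biUnion (⟨⟨hx0, h0⟩, hx.1.2⟩ : x ∈ Z) (Metric.mem_ball_self (hε x)))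
  filter_upwards [e1, e2] with α' h1 h2
  have hex : ∀ x : ℝ, ∃ z, x ∈ profileZeros N γ α' ∩ Set.Iic R →
      z ∈ Z ∧ x ∈ Metric.ball z (ε z) := by
    intro x
    by_cases hx : x ∈ profileZeros N γ α' ∩ Set.Iic R
    · by_contra hcon
      push Not at hcon
      refine h2 x ⟨⟨hx.1.1.le, hx.2⟩, ?_⟩ hx.1.2
      simp only [Set.mem_iUnion, not_exists]
      exact fun z hz => (hcon z).2 hz
    · exact ⟨0, fun h => absurd h hx⟩
  choose φ hφ using hex
  refine Set.ncard_le_ncard_of_injOn φ (fun x hx => (hφ x hx).1) ?_ hZ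
  -- two zeros in one ball would enclose a zero of the derivative
  have key : ∀ x ∈ profileZeros N γ α' ∩ Set.Iic R, ∀ x' ∈ profileZeros N γ α' ∩ Set.Iic R,
      φ x = φ x' → ¬x < x' := by
    intro x hx x' hx' heq hlt
    obtain ⟨t, ht, ht0⟩ := exists_hasDerivAt_eq_zero hlt
      (continuous_profileW_right (N := N) hγ hγ' α').continuousOn
      (by rw [hx.1.2, hx'.1.2]) (fun t ht => hasDerivAt_profileW hγ hγ' hN α' (hx.1.1.trans ht.1))
    have b1 := (hφ x hx).2
    have b2 := (hφ x' hx').2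
    rw [← heq] at b2
    have hb : t ∈ Metric.ball (φ x) (ε (φ x)) :=
      (convex_ball (φ x) (ε (φ x))).ordConnected.out b1 b2 ⟨ht.1.le, ht.2.le⟩
    exact (h1 _ (hφ x hx).1 t hb).1 ht0
  intro x hx x' hx' heq
  exact le_antisymm (not_lt.1 (key x' hx' x hx heq.symm)) (not_lt.1 (key x hx x' hx' heq))

/-- A small change of the exponent creates at most one more node, coming from infinity. -/
lemma eventually_not_exists_node (hN : 1 ≤ N) {α : ℝ} {k : ℕ} {y : ℝ} (hy : IsNode N γ α k y)
    (hW : ∀ t, y < t → 0 < (-1) ^ k * profileW N γ α t) :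
    ∀ᶠ α' in 𝓝 α, ¬∃ x, IsNode N γ α' (k + 2) x := by
  obtain ⟨R₀, hR₀, hfar⟩ := exists_far hγ hγ' N (|α| + 1)
  set R := max R₀ (y + 1)
  have hyR : y < R := lt_of_lt_of_le (lt_add_one y) (le_max_right _ _)
  have hcard : (profileZeros N γ α ∩ Set.Iic R).ncard = k := by
    rw [← hy.ncard.2]
    congr 1
    ext x
    refine and_congr_right fun hx => ⟨fun _ => ?_, fun h => le_trans h hyR.le⟩
    by_contra hcon
    have := hW x (not_le.1 hcon)
    simp [hx.2] at this
  have hnear : ∀ᶠ α' in 𝓝 α, |α'| < |α| + 1 :=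
    (continuous_abs.tendsto α).eventually (gt_mem_nhds (by linarith))
  filter_upwards [eventually_ncard_zeros_le hγ hγ' hN α R, hnear] with α' h1 h2
  rintro ⟨x, z, hz, hzx, hx0, -⟩
  have hzR : z ≤ R := by
    by_contra hcon
    refine profileW_ne_zero_of_gt hγ hγ' hN hz.mem_zeros (fun s hs η hη => ?_) x hzx hx0
    refine far_of_two_mul (zoneCoeff_pos hγ hγ' hs) (hfar α' h2.le s hs η ?_)
    exact (le_max_left R₀ (y + 1)).trans ((not_le.1 hcon).le.trans hη)
  have h3 : k + 1 ≤ (profileZeros N γ α' ∩ Set.Iic R).ncard := by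
    rw [← hz.ncard.2]
    exact Set.ncard_le_ncard (Set.inter_subset_inter_right _ (Set.Iic_subset_Iic.2 hzR))
      (finite_profileZeros_inter hγ hγ' hN α' R)
  omega

/-- No node comes from infinity as long as `W` does not decay faster than `η^(-α-2)`. -/
lemma eventually_not_exists_succ_node (hN : 1 ≤ N) {α : ℝ} {k : ℕ} {y : ℝ}
    (hy : IsNode N γ α k y) (hW : ∀ t, y < t → 0 < (-1) ^ k * profileW N γ α t)
    (hnd : ¬Tendsto (fun η => η ^ (α + 2) * profileW N γ α η) atTop (𝓝 0)) :
    ∀ᶠ α' in 𝓝 α, ¬∃ x, IsNode N γ α' (k + 1) x := by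
  obtain ⟨R₀, hR₀, hfar⟩ := exists_far hγ hγ' N |α|
  have hs := neg_one_pow_eq k
  set s : ℝ := (-1) ^ k with hsd
  have hss : s * s = 1 := neg_one_pow_mul_self k
  have hcs := zoneCoeff_pos hγ hγ' hs
  have hy0 := hy.nonneg
  -- otherwise `η^(α+3) W` would be bounded, and `η^(α+2) W` would tend to zero
  obtain ⟨R, hRR, hR1⟩ : ∃ R, max R₀ (y + 1) ≤ R ∧
      0 < s * (R * profileDW N γ α R + (α + 3) * profileW N γ α R) := by
    by_contra hcon
    push Not at hcon
    apply hnd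
    set R := max R₀ (y + 1)
    have hR : 0 < R := lt_of_lt_of_le hR₀ (le_max_left _ _)
    have hyR : y < R := lt_of_lt_of_le (lt_add_one y) (le_max_right _ _)
    have hd : ∀ η, R ≤ η → HasDerivAt (fun η => η ^ (α + 3) * (s * profileW N γ α η))
        (η ^ (α + 3) / η * (s * (η * profileDW N γ α η + (α + 3) * profileW N γ α η))) η := by
      intro η hη
      have hη0 := hR.trans_le hη
      have d1 := Real.hasDerivAt_rpow_const (x := η) (p := α + 3) (Or.inl hη0.ne')
      have d2 := (hasDerivAt_profileW (N := N) hγ hγ' hN α hη0).const_mul s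
      refine (d1.mul d2).congr_deriv ?_
      rw [Real.rpow_sub_one hη0.ne']
      field_simp
      ring
    have hanti : AntitoneOn (fun η => η ^ (α + 3) * (s * profileW N γ α η)) (Set.Ici R) := by
      apply antitoneOn_of_hasDerivWithinAt_nonpos (convex_Ici R)
        (fun η hη => (hd η hη).continuousAt.continuousWithinAt)
        (fun η hη => (hd η (interior_subset hη)).hasDerivWithinAt)
      intro η hη
      have hη' : R ≤ η := interior_subset hη
      have hη0 := hR.trans_le hη'
      exact mul_nonpos_of_nonneg_of_nonpos (by positivity) (hcon η hη')
    set C := R ^ (α + 3) * (s * profileW N γ α R)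
    have hsq : Tendsto (fun η : ℝ => C / η) atTop (𝓝 0) := tendsto_const_nhds.div_atTop tendsto_id
    have hlim : Tendsto (fun η => η ^ (α + 2) * (s * profileW N γ α η)) atTop (𝓝 0) := by
      refine squeeze_zero' ?_ ?_ hsq
      · filter_upwards [eventually_ge_atTop R] with η hη
        have := hW η (hyR.trans_le hη)
        have hη0 := hR.trans_le hη
        positivity
      · filter_upwards [eventually_ge_atTop R] with η hη
        have hη0 := hR.trans_le hη
        have := hanti (Set.mem_Ici.2 le_rfl) (Set.mem_Ici.2 hη) hη
        rw [le_div_iff₀ hη0]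
        have e : η ^ (α + 3) = η ^ (α + 2) * η := by
          rw [← Real.rpow_add_one hη0.ne']; ring_nf
        simp only [e] at this
        linarith
    have := hlim.const_mul s
    rw [mul_zero] at this
    refine this.congr fun η => ?_
    calc s * (η ^ (α + 2) * (s * profileW N γ α η))
        = (s * s) * (η ^ (α + 2) * profileW N γ α η) := by ring
      _ = _ := by rw [hss, one_mul]
  have hR0 : R₀ ≤ R := (le_max_left _ _).trans hRR
  have hyR : y < R := lt_of_lt_of_le (lt_of_lt_of_le (lt_add_one y) (le_max_right _ _)) hRR
  have hRp : 0 < R := hR₀.trans_le hR0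
  have hWR := hW R hyR
  have hcard : (profileZeros N γ α ∩ Set.Iic R).ncard = k := by
    rw [← hy.ncard.2]
    congr 1
    ext x
    refine and_congr_right fun hx => ⟨fun _ => ?_, fun h => le_trans h hyR.le⟩
    by_contra hcon
    have := hW x (not_le.1 hcon)
    simp [hx.2] at this
  -- the conditions that trap `W` at `R` are open in the exponent
  have n1 : ∀ᶠ α' in 𝓝 α, 0 < s * profileW N γ α' R :=
    ((continuous_const.mul (continuous_profileW_left hγ hγ' R)).tendsto α).eventually
      (lt_mem_nhds hWR)
  have n2 : ∀ᶠ α' in 𝓝 α,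
      0 < s * (R * profileDW N γ α' R + (α + 3) * profileW N γ α' R) := by
    have c1 := continuous_profileW_left (N := N) hγ hγ' R
    have c2 := continuous_profileDW_left (N := N) hγ hγ' R
    have hc : Continuous fun α' =>
        s * (R * profileDW N γ α' R + (α + 3) * profileW N γ α' R) := by fun_prop
    exact (hc.tendsto α).eventually (lt_mem_nhds hR1)
  have n3 : ∀ᶠ α' in 𝓝 α, α' < α + 1 / 2 := gt_mem_nhds (by linarith)
  filter_upwards [eventually_ncard_zeros_le hγ hγ' hN α R, n1, n2, n3] with α' h1 h2 h3 h4
  rintro ⟨x, hx⟩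
  have hxR : x ≤ R := by
    by_contra hcon
    have := profileW_trapped hγ hγ' hN (A := α + 3) hs hRp (fun η hη => by
      have a1 := hfar α le_rfl s hs η (hR0.trans hη)
      have a2 : 0 < zoneCoeff γ s * η ^ 2 := by
        have := hRp.trans_le hη
        positivity
      have a3 : (1 : ℝ) / 2 ≤ α + 3 - (α' + 2) := by linarith
      have a4 : α + 3 + 2 - (N : ℝ) = α + 5 - N := by ring
      rw [a4]
      have a5 := mul_le_mul_of_nonneg_left a3 a2.le
      linarith) h2 h3 x (not_le.1 hcon).le
    simp [hx.mem_zeros.2] at this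
  have h5 : k + 1 ≤ (profileZeros N γ α' ∩ Set.Iic R).ncard := by
    rw [← hx.ncard.2]
    exact Set.ncard_le_ncard (Set.inter_subset_inter_right _ (Set.Iic_subset_Iic.2 hxR))
      (finite_profileZeros_inter hγ hγ' hN α' R)
  omega

/-- For a large exponent `W` oscillates: `arctan (W' / (κ W))` decreases at a rate of at least
`κ / 2`, where `κ` grows with `α`. -/
lemma exists_zero_of_large (hN : 1 ≤ N) {α κ a b : ℝ} (hκ : 0 < κ) (ha : 1 ≤ a) (hab : a ≤ b)
    (hb : b ≤ 2)
    (hα : ∀ s : ℝ, s = 1 ∨ s = -1 → κ ^ 2 + ((N : ℝ) + 1) ^ 2 ≤ 2 * (zoneCoeff γ s * (α + 2)))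
    (hlen : 2 * Real.pi ≤ κ * (b - a)) : ∃ t ∈ Set.Icc a b, profileW N γ α t = 0 := by
  by_contra hcon
  push Not at hcon
  have hcW := continuous_profileW_right (N := N) hγ hγ' α
  have hcD := continuous_profileDW_right (N := N) hγ hγ' α
  obtain ⟨s, hs, hpos⟩ : ∃ s : ℝ, (s = 1 ∨ s = -1) ∧
      ∀ t ∈ Set.Icc a b, 0 < s * profileW N γ α t := by
    rcases lt_or_gt_of_ne (hcon a ⟨le_rfl, hab⟩) with h | h
    · refine ⟨-1, Or.inr rfl, fun t ht => ?_⟩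
      by_contra hneg
      obtain ⟨x, hx1, hx2, hx0, -⟩ := exists_first_zero (y := fun t => -1 * profileW N γ α t) ht.1
        (by fun_prop) (by linarith) (not_lt.1 hneg)
      exact hcon x ⟨hx1.le, hx2.trans ht.2⟩ (by linarith)
    · refine ⟨1, Or.inl rfl, fun t ht => ?_⟩
      by_contra hneg
      obtain ⟨x, hx1, hx2, hx0, -⟩ := exists_first_zero (y := fun t => 1 * profileW N γ α t) ht.1
        (by fun_prop) (by linarith) (not_lt.1 hneg)
      exact hcon x ⟨hx1.le, hx2.trans ht.2⟩ (by linarith)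
  have hz := profileW_zoneSol hγ hγ' hN α hs (S := Set.Ioo a b) isOpen_Ioo
    (fun η hη => by linarith [hη.1]) (fun η hη => hpos η ⟨hη.1.le, hη.2.le⟩)
  have hN' : (0 : ℝ) ≤ (N : ℝ) - 1 := by
    have : (1 : ℝ) ≤ N := by exact_mod_cast hN
    linarith
  have hc := zoneCoeff_pos hγ hγ' hs
  have hc1 : zoneCoeff γ s ≤ 1 := by
    unfold zoneCoeff
    rcases hs with rfl | rfl <;> linarith
  have hanti : AntitoneOn
      (fun η => Real.arctan (profileDW N γ α η / profileW N γ α η / κ) + κ / 2 * η)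
      (Set.Icc a b) := by
    apply antitoneOn_of_hasDerivWithinAt_nonpos (convex_Icc a b)
      (f' := fun η => 1 / (1 + (profileDW N γ α η / profileW N γ α η / κ) ^ 2) *
        (((-(((N : ℝ) - 1) / η + zoneCoeff γ s * η) * profileDW N γ α η
          - zoneCoeff γ s * (α + 2) * profileW N γ α η) * profileW N γ α η
          - profileDW N γ α η * profileDW N γ α η) / profileW N γ α η ^ 2 / κ) + κ / 2)
    · refine ContinuousOn.add (Real.continuous_arctan.comp_continuousOn ?_) (by fun_prop)
      exact (hcD.continuousOn.div hcW.continuousOn hcon).div_const κ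
    · intro η hη
      rw [interior_Icc] at hη
      have hne := hcon η ⟨hη.1.le, hη.2.le⟩
      have d := (((hz.snd η hη).div (hz.fst η hη) hne).div_const κ).arctan
      exact ((d.add ((hasDerivAt_id η).const_mul (κ / 2))).congr_deriv
        (by rw [mul_one]; rfl)).hasDerivWithinAt
    · intro η hη
      rw [interior_Icc] at hη
      have hne := hcon η ⟨hη.1.le, hη.2.le⟩
      have hη1 : 1 ≤ η := by linarith [hη.1]
      have hη2 : η ≤ 2 := by linarith [hη.2]
      set w := profileW N γ α η
      set d := profileDW N γ α η
      set q := d / w with hq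
      set B := ((N : ℝ) - 1) / η + zoneCoeff γ s * η with hB
      have hB0 : 0 ≤ B := by positivity
      have hB1 : B ≤ (N : ℝ) + 1 := by
        have : ((N : ℝ) - 1) / η ≤ (N : ℝ) - 1 := div_le_self hN' hη1
        nlinarith
      have e : ((-B * d - zoneCoeff γ s * (α + 2) * w) * w - d * d) / w ^ 2
          = -B * q - zoneCoeff γ s * (α + 2) - q ^ 2 := by
        rw [hq]; field_simp
      rw [e]
      have h1 : -B * q - zoneCoeff γ s * (α + 2) - q ^ 2 ≤ -(κ ^ 2 + q ^ 2) / 2 := by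
        have := hα s hs
        nlinarith [sq_nonneg (B + q)]
      have h2 : 1 / (1 + (q / κ) ^ 2) * ((-B * q - zoneCoeff γ s * (α + 2) - q ^ 2) / κ)
          ≤ 1 / (1 + (q / κ) ^ 2) * (-(κ ^ 2 + q ^ 2) / 2 / κ) := by
        gcongr
      have h3 : 1 / (1 + (q / κ) ^ 2) * (-(κ ^ 2 + q ^ 2) / 2 / κ) = -(κ / 2) := by
        have : κ ^ 2 + q ^ 2 ≠ 0 := by positivity
        field_simp
      linarith
  have h := hanti ⟨le_rfl, hab⟩ ⟨hab, le_rfl⟩ hab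
  have h1 := Real.arctan_lt_pi_div_two (profileDW N γ α a / profileW N γ α a / κ)
  have h2 := Real.neg_pi_div_two_lt_arctan (profileDW N γ α b / profileW N γ α b / κ)
  simp only at h
  nlinarith

lemma exists_node_of_large (hN : 1 ≤ N) (n : ℕ) : ∃ α, ∃ x, IsNode N γ α n x := by
  have hc1 := zoneCoeff_pos hγ hγ' (Or.inl rfl)
  have hc2 := zoneCoeff_pos hγ hγ' (Or.inr rfl)
  set c := min (zoneCoeff γ 1) (zoneCoeff γ (-1))
  have hc : 0 < c := lt_min hc1 hc2
  -- the `n` intervals `[1 + j ε, 1 + j ε + ε / 2]` in `[1, 2]` contain a zero each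
  set ε : ℝ := 1 / (n + 1) with hε
  have hε0 : 0 < ε := by positivity
  set κ : ℝ := 4 * Real.pi / ε with hκd
  have hκ : 0 < κ := by have := Real.pi_pos; positivity
  set α : ℝ := (κ ^ 2 + ((N : ℝ) + 1) ^ 2) / (2 * c) with hα
  have hα0 : 0 < α := by positivity
  have hlarge : ∀ s : ℝ, s = 1 ∨ s = -1 →
      κ ^ 2 + ((N : ℝ) + 1) ^ 2 ≤ 2 * (zoneCoeff γ s * (α + 2)) := by
    intro s hs
    have hcs : c ≤ zoneCoeff γ s := by
      rcases hs with rfl | rfl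
      · exact min_le_left _ _
      · exact min_le_right _ _
    have e : κ ^ 2 + ((N : ℝ) + 1) ^ 2 = 2 * (c * α) := by rw [hα]; field_simp
    rw [e]
    have : c * α ≤ zoneCoeff γ s * (α + 2) := by
      have h1 : α ≤ α + 2 := by linarith
      have h2 : 0 ≤ zoneCoeff γ s := hc.le.trans hcs
      gcongr
    linarith
  refine ⟨α, ?_⟩
  have key : ∀ j : ℕ, j ≤ n → ∃ x, x < 1 + j * ε ∧ IsNode N γ α j x := by
    intro j
    induction j with
    | zero => exact fun _ => ⟨0, by simp, rfl⟩
    | succ j ih =>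
      intro hj
      obtain ⟨x, hx, hnx⟩ := ih (by omega)
      have hj' : ((j : ℝ) + 1) * ε ≤ 1 := by
        rw [hε, mul_one_div, div_le_one (by positivity)]
        have : ((j + 1 : ℕ) : ℝ) ≤ n := by exact_mod_cast hj
        push_cast at this
        linarith
      have hjε : 0 ≤ (j : ℝ) * ε := by positivity
      obtain ⟨t, ht, ht0⟩ := exists_zero_of_large hγ hγ' hN (α := α) (a := 1 + j * ε)
        (b := 1 + j * ε + ε / 2) hκ (by linarith) (by linarith) (by linarith) hlarge
        (by rw [hκd]; field_simp; linarith [Real.pi_pos])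
      obtain ⟨x', -, hx't, hx'⟩ := hnx.exists_succ hγ hγ' hN (hx.trans_le ht.1) (by simp [ht0])
      refine ⟨x', ?_, hx'⟩
      have := ht.2
      push_cast
      linarith
  obtain ⟨x, -, hx⟩ := key n le_rfl
  exact ⟨x, hx⟩

end profile

/-! ### Tricomi's function -/

/-- `U`, with derivative `dU`, is Tricomi's function `U(a, b; ·)`; the last field records that the
derivative is of lower order at infinity. -/
structure IsTricomiPair (a b : ℝ) (U dU : ℝ → ℝ) : Prop where
  fst : ∀ z, 0 < z → HasDerivAt U (dU z) z
  snd : ∀ z, 0 < z → HasDerivAt dU ((a * U z - (b - z) * dU z) / z) z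
  tendsto : Tendsto (fun z => z ^ a * U z) atTop (𝓝 1)
  deriv_tendsto : Tendsto (fun z => z ^ a * dU z) atTop (𝓝 0)

/-- The integrand of `∫₀^∞ exp (-z t) t^(k-1) (1+t)^(-d) dt`. -/
def laplaceKernel (d k z t : ℝ) : ℝ := t ^ (k - 1) * Real.exp (-(z * t)) * (1 + t) ^ (-d)

/-- For `d = a + 1 - b` and `a > 0` this is `Γ(a) U(a, b; z)` at `k = a`. -/
def laplaceIntegral (d k z : ℝ) : ℝ := ∫ t in Set.Ioi (0 : ℝ), laplaceKernel d k z t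

lemma rpow_neg_le_one {d t : ℝ} (hd : 0 ≤ d) (ht : 0 < t) : (1 + t) ^ (-d) ≤ 1 :=
  Real.rpow_le_one_of_one_le_of_nonpos (by linarith) (by linarith)

lemma one_sub_le_rpow_neg {d t : ℝ} (hd : 0 ≤ d) (ht : 0 < t) : 1 - d * t ≤ (1 + t) ^ (-d) := by
  rw [Real.rpow_def_of_pos (by linarith)]
  have h1 := Real.add_one_le_exp (Real.log (1 + t) * -d)
  have h2 := Real.log_le_sub_one_of_pos (by linarith : 0 < 1 + t)
  nlinarith

lemma integrableOn_rpow_mul_exp {k z : ℝ} (hk : 0 < k) (hz : 0 < z) :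
    MeasureTheory.IntegrableOn (fun t : ℝ => t ^ (k - 1) * Real.exp (-(z * t))) (Set.Ioi 0) := by
  have := integrableOn_rpow_mul_exp_neg_mul_rpow (p := 1) (s := k - 1) (b := z) (by linarith)
    one_pos hz
  simpa using this

lemma aestronglyMeasurable_laplaceKernel (d k z : ℝ) :
    MeasureTheory.AEStronglyMeasurable (laplaceKernel d k z)
      (MeasureTheory.volume.restrict (Set.Ioi 0)) := by
  refine ContinuousOn.aestronglyMeasurable ?_ measurableSet_Ioi
  intro t ht
  have ht' : (0 : ℝ) < t := ht
  unfold laplaceKernel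
  have h1 : ContinuousAt (fun t : ℝ => t ^ (k - 1)) t :=
    Real.continuousAt_rpow_const _ _ (Or.inl ht'.ne')
  have h2 : ContinuousAt (fun t : ℝ => (1 + t) ^ (-d)) t :=
    ContinuousAt.rpow_const (by fun_prop) (Or.inl (by linarith))
  exact ((h1.mul (by fun_prop)).mul h2).continuousWithinAt

lemma laplaceKernel_nonneg {d k z t : ℝ} (ht : 0 < t) : 0 ≤ laplaceKernel d k z t := by
  unfold laplaceKernel; positivity

lemma laplaceKernel_le {d k z t : ℝ} (hd : 0 ≤ d) (ht : 0 < t) :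
    laplaceKernel d k z t ≤ t ^ (k - 1) * Real.exp (-(z * t)) := by
  unfold laplaceKernel
  exact mul_le_of_le_one_right (by positivity) (rpow_neg_le_one hd ht)

lemma integrableOn_laplaceKernel {d k z : ℝ} (hd : 0 ≤ d) (hk : 0 < k) (hz : 0 < z) :
    MeasureTheory.IntegrableOn (laplaceKernel d k z) (Set.Ioi 0) := by
  refine (integrableOn_rpow_mul_exp hk hz).mono' (aestronglyMeasurable_laplaceKernel d k z) ?_
  refine (MeasureTheory.ae_restrict_iff' measurableSet_Ioi).2 (Eventually.of_forall fun t ht => ?_)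
  rw [Real.norm_of_nonneg (laplaceKernel_nonneg ht)]
  exact laplaceKernel_le hd ht

lemma hasDerivAt_laplaceIntegral {d k z : ℝ} (hd : 0 ≤ d) (hk : 0 < k) (hz : 0 < z) :
    HasDerivAt (laplaceIntegral d k) (-laplaceIntegral d (k + 1) z) z := by
  have h := hasDerivAt_integral_of_dominated_loc_of_deriv_le
    (μ := MeasureTheory.volume.restrict (Set.Ioi (0 : ℝ))) (F := fun z t => laplaceKernel d k z t)
    (F' := fun z t => -laplaceKernel d (k + 1) z t) (x₀ := z) (s := Set.Ioi (z / 2))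
    (bound := fun t => t ^ (k + 1 - 1) * Real.exp (-(z / 2 * t)))
    (Ioi_mem_nhds (by linarith))
    (Eventually.of_forall fun z => aestronglyMeasurable_laplaceKernel d k z)
    (integrableOn_laplaceKernel hd hk hz)
    (aestronglyMeasurable_laplaceKernel d (k + 1) z).neg ?_
    (integrableOn_rpow_mul_exp (by linarith) (by linarith)) ?_
  · have := h.2
    rw [MeasureTheory.integral_neg] at this
    exact this
  · refine (MeasureTheory.ae_restrict_iff' measurableSet_Ioi).2
      (Eventually.of_forall fun t ht x hx => ?_)
    have ht' : (0 : ℝ) < t := ht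
    have hx' : z / 2 < x := hx
    rw [norm_neg, Real.norm_of_nonneg (laplaceKernel_nonneg ht)]
    refine (laplaceKernel_le hd ht).trans ?_
    gcongr
  · refine (MeasureTheory.ae_restrict_iff' measurableSet_Ioi).2
      (Eventually.of_forall fun t ht x hx => ?_)
    have ht' : (0 : ℝ) < t := ht
    have h1 : HasDerivAt (fun x : ℝ => Real.exp (-(x * t))) (Real.exp (-(x * t)) * -t) x := by
      apply HasDerivAt.exp
      simpa using ((hasDerivAt_id x).mul_const t).fun_neg
    unfold laplaceKernel
    refine ((h1.const_mul (t ^ (k - 1))).mul_const ((1 + t) ^ (-d))).congr_deriv ?_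
    rw [add_sub_right_comm, Real.rpow_add_one ht'.ne']
    ring

/-- Kummer's equation for the Laplace integral, from an integration by parts. -/
lemma laplaceIntegral_eq {d a z : ℝ} (hd : 0 ≤ d) (ha : 0 < a) (hz : 0 < z) :
    a * laplaceIntegral d a z + (a + 1 - d - z) * laplaceIntegral d (a + 1) z
      - z * laplaceIntegral d (a + 2) z = 0 := by
  -- `F = t^a (1+t)^(1-d) exp (-z t)` vanishes at both ends, so its derivative has integral zero
  let F : ℝ → ℝ := fun t => t ^ a * Real.exp (-(z * t)) * ((1 + t) * (1 + t) ^ (-d))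
  let F' : ℝ → ℝ := fun t => a * laplaceKernel d a z t
    + (a + 1 - d - z) * laplaceKernel d (a + 1) z t - z * laplaceKernel d (a + 2) z t
  have i1 := integrableOn_laplaceKernel hd ha hz
  have i2 := integrableOn_laplaceKernel hd (by linarith : 0 < a + 1) hz
  have i3 := integrableOn_laplaceKernel hd (by linarith : 0 < a + 2) hz
  have hint : MeasureTheory.IntegrableOn F' (Set.Ioi 0) :=
    ((i1.const_mul a).add (i2.const_mul _)).sub (i3.const_mul z)
  have hF0 : F 0 = 0 := by simp [F, ha.ne']
  have hcont : ContinuousWithinAt F (Set.Ici 0) 0 := by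
    apply ContinuousAt.continuousWithinAt
    have h1 : ContinuousAt (fun t : ℝ => t ^ a) 0 :=
      Real.continuousAt_rpow_const _ _ (Or.inr ha.le)
    have h2 : ContinuousAt (fun t : ℝ => (1 + t) ^ (-d)) 0 :=
      ContinuousAt.rpow_const (by fun_prop) (Or.inl (by norm_num))
    have h3 : ContinuousAt (fun t : ℝ => Real.exp (-(z * t))) 0 := by fun_prop
    have h4 : ContinuousAt (fun t : ℝ => 1 + t) 0 := by fun_prop
    exact (h1.mul h3).mul (h4.mul h2)
  have hder : ∀ t ∈ Set.Ioi (0 : ℝ), HasDerivAt F (F' t) t := by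
    intro t ht
    have ht' : (0 : ℝ) < t := ht
    have h1 := Real.hasDerivAt_rpow_const (x := t) (p := a) (Or.inl ht'.ne')
    have h2 : HasDerivAt (fun t : ℝ => Real.exp (-(z * t))) (Real.exp (-(z * t)) * -z) t := by
      apply HasDerivAt.exp
      simpa using ((hasDerivAt_id t).const_mul z).fun_neg
    have h3 : HasDerivAt (fun t : ℝ => 1 + t) 1 t := (hasDerivAt_id t).const_add 1
    have h4 := h3.rpow_const (p := -d) (Or.inl (by linarith : 1 + t ≠ 0))
    refine ((h1.mul h2).mul (h3.mul h4)).congr_deriv ?_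
    have e0 : (1 + t) ^ (-d - 1) = (1 + t) ^ (-d) / (1 + t) :=
      Real.rpow_sub_one (by linarith) _
    have e1 : t ^ (a - 1) = t ^ a / t := Real.rpow_sub_one ht'.ne' _
    have e2 : t ^ (a + 2 - 1) = t ^ a * t := by
      rw [← Real.rpow_add_one ht'.ne']; ring_nf
    have e3 : t ^ (a + 1 - 1) = t ^ a := by ring_nf
    have h5 : 1 + t ≠ 0 := by linarith
    simp only [F', laplaceKernel, Pi.mul_apply, e0, e1, e2, e3]
    field_simp
    ring
  have hlim : Tendsto F atTop (𝓝 0) := by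
    have t1 := tendsto_rpow_mul_exp_neg_mul_atTop_nhds_zero a z hz
    have t2 := tendsto_rpow_mul_exp_neg_mul_atTop_nhds_zero (a + 1) z hz
    have t3 := t1.add t2
    rw [add_zero] at t3
    refine squeeze_zero' ?_ ?_ t3
    · filter_upwards [eventually_gt_atTop 0] with t ht
      simp only [F]
      positivity
    · filter_upwards [eventually_gt_atTop 0] with t ht
      simp only [F]
      have e : t ^ a * Real.exp (-z * t) + t ^ (a + 1) * Real.exp (-z * t)
          = t ^ a * Real.exp (-(z * t)) * (1 + t) := by
        rw [Real.rpow_add_one ht.ne']; ring_nf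
      rw [e]
      have := rpow_neg_le_one hd ht
      gcongr
      exact mul_le_of_le_one_right (by linarith) this
  have h := MeasureTheory.integral_Ioi_of_hasDerivAt_of_tendsto hcont hder hint hlim
  rw [hF0, sub_zero] at h
  rw [← h]
  simp only [F', laplaceIntegral]
  have i12 : MeasureTheory.IntegrableOn (fun t => a * laplaceKernel d a z t
      + (a + 1 - d - z) * laplaceKernel d (a + 1) z t) (Set.Ioi 0) :=
    (i1.const_mul a).add (i2.const_mul _)
  rw [MeasureTheory.integral_sub i12 (i3.const_mul z),
    MeasureTheory.integral_add (i1.const_mul a) (i2.const_mul _),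
    MeasureTheory.integral_const_mul, MeasureTheory.integral_const_mul,
    MeasureTheory.integral_const_mul]

lemma tendsto_rpow_mul_laplaceIntegral {d k : ℝ} (hd : 0 ≤ d) (hk : 0 < k) :
    Tendsto (fun z => z ^ k * laplaceIntegral d k z) atTop (𝓝 (Real.Gamma k)) := by
  have hG : ∀ k z : ℝ, 0 < k → 0 < z →
      ∫ t in Set.Ioi (0 : ℝ), t ^ (k - 1) * Real.exp (-(z * t)) = z ^ (-k) * Real.Gamma k := by
    intro k z hk hz
    rw [Real.integral_rpow_mul_exp_neg_mul_Ioi hk hz, one_div, Real.inv_rpow hz.le,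
      Real.rpow_neg hz.le]
  have hlow : Tendsto (fun z : ℝ => Real.Gamma k - d * Real.Gamma (k + 1) / z) atTop
      (𝓝 (Real.Gamma k)) := by
    have : Tendsto (fun z : ℝ => d * Real.Gamma (k + 1) / z) atTop (𝓝 0) :=
      tendsto_const_nhds.div_atTop tendsto_id
    simpa using tendsto_const_nhds.sub this
  refine tendsto_of_tendsto_of_tendsto_of_le_of_le' hlow tendsto_const_nhds ?_ ?_
  · filter_upwards [eventually_gt_atTop 0] with z hz
    have i1 := integrableOn_rpow_mul_exp hk hz
    have i2 := integrableOn_rpow_mul_exp (by linarith : 0 < k + 1) hz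
    have h := MeasureTheory.setIntegral_mono_on (i1.sub (i2.const_mul d))
      (integrableOn_laplaceKernel hd hk hz) measurableSet_Ioi (fun t ht => by
        have ht' : (0 : ℝ) < t := ht
        have := one_sub_le_rpow_neg hd ht'
        unfold laplaceKernel
        have e : t ^ (k + 1 - 1) = t ^ (k - 1) * t := by
          rw [← Real.rpow_add_one ht'.ne']; ring_nf
        have : t ^ (k - 1) * Real.exp (-(z * t)) * (1 - d * t)
            ≤ t ^ (k - 1) * Real.exp (-(z * t)) * (1 + t) ^ (-d) := by gcongr
        simp only [Pi.sub_apply, e]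
        linarith)
    have e : ∫ t in Set.Ioi (0 : ℝ), ((fun t => t ^ (k - 1) * Real.exp (-(z * t)))
        - fun t => d * (t ^ (k + 1 - 1) * Real.exp (-(z * t)))) t
        = z ^ (-k) * Real.Gamma k - d * (z ^ (-(k + 1)) * Real.Gamma (k + 1)) := by
      rw [← hG k z hk hz, ← hG (k + 1) z (by linarith) hz, ← MeasureTheory.integral_const_mul,
        ← MeasureTheory.integral_sub i1 (i2.const_mul d)]
      rfl
    rw [e] at h
    have h2 := mul_le_mul_of_nonneg_left h (Real.rpow_nonneg hz.le k)
    refine le_trans (le_of_eq ?_) h2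
    rw [Real.rpow_neg hz.le, Real.rpow_neg hz.le, Real.rpow_add_one hz.ne']
    field_simp
  · filter_upwards [eventually_gt_atTop 0] with z hz
    have h := MeasureTheory.setIntegral_mono_on (integrableOn_laplaceKernel hd hk hz)
      (integrableOn_rpow_mul_exp hk hz) measurableSet_Ioi (fun t ht => laplaceKernel_le hd ht)
    rw [hG k z hk hz] at h
    have h2 := mul_le_mul_of_nonneg_left h (Real.rpow_nonneg hz.le k)
    refine h2.trans (le_of_eq ?_)
    rw [Real.rpow_neg hz.le]
    field_simp

lemma isTricomiPair_laplaceIntegral {a b : ℝ} (ha : 0 < a) (hb : b ≤ a + 1) :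
    IsTricomiPair a b (fun z => laplaceIntegral (a + 1 - b) a z / Real.Gamma a)
      (fun z => -laplaceIntegral (a + 1 - b) (a + 1) z / Real.Gamma a) := by
  have hd : 0 ≤ a + 1 - b := by linarith
  have hΓ : Real.Gamma a ≠ 0 := (Real.Gamma_pos_of_pos ha).ne'
  refine ⟨fun z hz => (hasDerivAt_laplaceIntegral hd ha hz).div_const _, fun z hz => ?_, ?_, ?_⟩
  · refine ((hasDerivAt_laplaceIntegral hd (by linarith : 0 < a + 1) hz).neg.div_const
      (Real.Gamma a)).congr_deriv ?_
    have h := laplaceIntegral_eq hd ha hz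
    have e : a + 1 - (a + 1 - b) - z = b - z := by ring
    rw [e] at h
    have e2 : a + 1 + 1 = a + 2 := by ring
    rw [e2]
    field_simp
    linarith
  · have := (tendsto_rpow_mul_laplaceIntegral hd ha).div_const (Real.Gamma a)
    rw [div_self hΓ] at this
    refine this.congr fun z => by ring
  · have h1 := tendsto_rpow_mul_laplaceIntegral hd (by linarith : 0 < a + 1)
    have h2 : Tendsto (fun z : ℝ => -(z ^ (a + 1) * laplaceIntegral (a + 1 - b) (a + 1) z)
        / Real.Gamma a * (1 / z)) atTop (𝓝 (-(Real.Gamma (a + 1)) / Real.Gamma a * 0)) :=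
      (h1.neg.div_const _).mul (tendsto_const_nhds.div_atTop tendsto_id)
    rw [mul_zero] at h2
    refine h2.congr' ?_
    filter_upwards [eventually_gt_atTop 0] with z hz
    rw [Real.rpow_add_one hz.ne']
    field_simp

/-- The contiguous relation that lowers `a`. -/
lemma IsTricomiPair.pred {a b : ℝ} {U dU : ℝ → ℝ} (h : IsTricomiPair (a + 1) b U dU) :
    IsTricomiPair a b (fun z => (z - b + (a + 1)) * U z - z * dU z)
      (fun z => -a * (U z - dU z)) := by
  refine ⟨fun z hz => ?_, fun z hz => ?_, ?_, ?_⟩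
  · have h1 : HasDerivAt (fun z : ℝ => z - b + (a + 1)) 1 z :=
      ((hasDerivAt_id z).sub_const b).add_const (a + 1)
    refine ((h1.mul (h.fst z hz)).sub ((hasDerivAt_id z).mul (h.snd z hz))).congr_deriv ?_
    simp only [id]
    field_simp
    ring
  · refine (((h.fst z hz).sub (h.snd z hz)).const_mul (-a)).congr_deriv ?_
    field_simp
    ring
  · have h1 : Tendsto (fun z : ℝ => 1 + (a + 1 - b) / z) atTop (𝓝 (1 + 0)) :=
      tendsto_const_nhds.add (tendsto_const_nhds.div_atTop tendsto_id)
    have h2 := (h1.mul h.tendsto).sub h.deriv_tendsto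
    have e : (1 + (0 : ℝ)) * 1 - 0 = 1 := by norm_num
    rw [e] at h2
    refine h2.congr' ?_
    filter_upwards [eventually_gt_atTop 0] with z hz
    rw [Real.rpow_add_one hz.ne']
    field_simp
    ring
  · have h1 : Tendsto (fun z : ℝ => 1 / z) atTop (𝓝 0) :=
      tendsto_const_nhds.div_atTop tendsto_id
    have h2 := (h1.mul (h.tendsto.sub h.deriv_tendsto)).const_mul (-a)
    have e : -a * (0 * ((1 : ℝ) - 0)) = 0 := by ring
    rw [e] at h2
    refine h2.congr' ?_
    filter_upwards [eventually_gt_atTop 0] with z hz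
    rw [Real.rpow_add_one hz.ne']
    field_simp

lemma exists_isTricomiPair (a b : ℝ) : ∃ U dU, IsTricomiPair a b U dU := by
  -- the Laplace integral covers large `a`, and the contiguous relation leads down from there
  obtain ⟨n, hn⟩ := exists_nat_gt (max 0 b - a)
  have h : max 0 b < a + n := by linarith
  induction n generalizing a with
  | zero =>
    have h1 := le_max_left 0 b
    have h2 := le_max_right 0 b
    simp only [Nat.cast_zero, add_zero] at h
    exact ⟨_, _, isTricomiPair_laplaceIntegral (by linarith) (by linarith)⟩
  | succ n ih =>
    push_cast at h hn
    obtain ⟨U, dU, hU⟩ := ih (a + 1) (by linarith) (by linarith)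
    exact ⟨_, _, hU.pred⟩

lemma IsTricomiPair.isTricomi {a b : ℝ} {U dU : ℝ → ℝ} (h : IsTricomiPair a b U dU) :
    IsTricomi a b U := by
  have e1 : ∀ z, 0 < z → deriv U z = dU z := fun z hz => (h.fst z hz).deriv
  have e2 : ∀ z, 0 < z → deriv U =ᶠ[𝓝 z] dU := fun z hz => by
    filter_upwards [lt_mem_nhds hz] with x hx using e1 x hx
  refine ⟨fun z hz => (h.fst z hz).differentiableAt, fun z hz =>
    ((h.snd z hz).congr_of_eventuallyEq (e2 z hz)).differentiableAt, fun z hz => ?_, h.tendsto⟩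
  rw [((h.snd z hz).congr_of_eventuallyEq (e2 z hz)).deriv, e1 z hz]
  field_simp
  ring

/-! ### The two kinds of behaviour at infinity -/

lemma eq_of_hasDerivAt_zero {f : ℝ → ℝ} {S : Set ℝ} (hS : Convex ℝ S) (hSo : IsOpen S)
    (hd : ∀ x ∈ S, HasDerivAt f 0 x) {x y : ℝ} (hx : x ∈ S) (hy : y ∈ S) : f x = f y :=
  hS.is_const_of_fderivWithin_eq_zero
    (fun x hx => (hd x hx).differentiableAt.differentiableWithinAt)
    (fun x hx => by
      rw [fderivWithin_of_isOpen hSo hx]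
      ext
      simp [(hd x hx).deriv]) hx hy

/-- L'Hôpital's rule at infinity for a denominator that tends to infinity. -/
lemma tendsto_div_of_tendsto_deriv_div {f f' g g' : ℝ → ℝ} {R L : ℝ}
    (hf : ∀ x, R < x → HasDerivAt f (f' x) x) (hg : ∀ x, R < x → HasDerivAt g (g' x) x)
    (hg' : ∀ᶠ x in atTop, 0 < g' x) (hgt : Tendsto g atTop atTop)
    (hlim : Tendsto (fun x => f' x / g' x) atTop (𝓝 L)) :
    Tendsto (fun x => f x / g x) atTop (𝓝 L) := by
  rw [Metric.tendsto_atTop]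
  intro ε hε
  have h1 : ∀ᶠ x in atTop, |f' x / g' x - L| < ε / 2 := by
    have := (Metric.tendsto_nhds.1 hlim) (ε / 2) (by linarith)
    simpa [Real.dist_eq] using this
  obtain ⟨x₀, hx₀⟩ := eventually_atTop.1 ((h1.and hg').and (eventually_gt_atTop R))
  set k : ℝ → ℝ := fun x => f x - L * g x with hk
  have hkd : ∀ x, x₀ ≤ x → HasDerivAt k (f' x - L * g' x) x := fun x hx =>
    (hf x (hx₀ x hx).2).sub ((hg x (hx₀ x hx).2).const_mul L)
  have hkb : ∀ x, x₀ ≤ x → |f' x - L * g' x| ≤ ε / 2 * g' x := by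
    intro x hx
    have hp := (hx₀ x hx).1.2
    have := (hx₀ x hx).1.1.le
    have e : f' x - L * g' x = (f' x / g' x - L) * g' x := by field_simp
    rw [e, abs_mul, abs_of_pos hp]
    gcongr
  have hanti : AntitoneOn (fun x => k x - ε / 2 * g x) (Set.Ici x₀) := by
    have hd : ∀ x, x₀ ≤ x → HasDerivAt (fun x => k x - ε / 2 * g x)
        (f' x - L * g' x - ε / 2 * g' x) x := fun x hx =>
      (hkd x hx).sub ((hg x (hx₀ x hx).2).const_mul _)
    refine antitoneOn_of_hasDerivWithinAt_nonpos (convex_Ici x₀)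
      (fun x hx => (hd x hx).continuousAt.continuousWithinAt)
      (fun x hx => (hd x (interior_subset hx)).hasDerivWithinAt) fun x hx => ?_
    have := (abs_le.1 (hkb x (interior_subset hx))).2
    linarith
  have hmono : MonotoneOn (fun x => k x + ε / 2 * g x) (Set.Ici x₀) := by
    have hd : ∀ x, x₀ ≤ x → HasDerivAt (fun x => k x + ε / 2 * g x)
        (f' x - L * g' x + ε / 2 * g' x) x := fun x hx =>
      (hkd x hx).add ((hg x (hx₀ x hx).2).const_mul _)
    refine monotoneOn_of_hasDerivWithinAt_nonneg (convex_Ici x₀)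
      (fun x hx => (hd x hx).continuousAt.continuousWithinAt)
      (fun x hx => (hd x (interior_subset hx)).hasDerivWithinAt) fun x hx => ?_
    have := (abs_le.1 (hkb x (interior_subset hx))).1
    linarith
  set C := |k x₀| + ε / 2 * |g x₀|
  obtain ⟨x₁, hx₁⟩ := eventually_atTop.1 (hgt.eventually_gt_atTop (2 * C / ε + 1))
  refine ⟨max x₀ x₁, fun x hx => ?_⟩
  have hx0 : x₀ ≤ x := (le_max_left _ _).trans hx
  have hgx := hx₁ x ((le_max_right _ _).trans hx)
  have hC : 0 ≤ C := by positivity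
  have hg0 : 0 < g x := by
    have : 0 ≤ 2 * C / ε := by positivity
    linarith
  have a1 := hanti (Set.mem_Ici.2 le_rfl) (Set.mem_Ici.2 hx0) hx0
  have a2 := hmono (Set.mem_Ici.2 le_rfl) (Set.mem_Ici.2 hx0) hx0
  simp only at a1 a2
  have b1 := le_abs_self (k x₀)
  have b2 := neg_abs_le (k x₀)
  have b3 : ε / 2 * g x₀ ≤ ε / 2 * |g x₀| := by gcongr; exact le_abs_self _
  have b4 : -(ε / 2 * |g x₀|) ≤ ε / 2 * g x₀ := by
    have := neg_abs_le (g x₀)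
    nlinarith
  have hkx : |k x| ≤ C + ε / 2 * g x := by
    rw [abs_le]; constructor <;> simp only [C] <;> linarith
  have hCg : C < ε / 2 * g x := by
    have : 2 * C / ε < g x := by linarith
    rw [div_lt_iff₀ hε] at this
    linarith
  have e : f x / g x - L = k x / g x := by
    rw [hk]; field_simp
  rw [Real.dist_eq, e, abs_div, abs_of_pos hg0, div_lt_iff₀ hg0]
  linarith

/-- The solution `exp (-c η² / 2) U(c η² / 2)` of the linear equation. -/
def gaussSol (c : ℝ) (U : ℝ → ℝ) (η : ℝ) : ℝ := Real.exp (-(c * η ^ 2 / 2)) * U (c * η ^ 2 / 2)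

/-- The derivative of `gaussSol`. -/
def gaussSolDeriv (c : ℝ) (U dU : ℝ → ℝ) (η : ℝ) : ℝ :=
  c * η * (Real.exp (-(c * η ^ 2 / 2)) * (dU (c * η ^ 2 / 2) - U (c * η ^ 2 / 2)))

lemma zoneSol_gaussSol {N : ℕ} {c β : ℝ} (hc : 0 < c) {U dU : ℝ → ℝ}
    (h1 : ∀ z, 0 < z → HasDerivAt U (dU z) z)
    (h2 : ∀ z, 0 < z → HasDerivAt dU
      ((((N : ℝ) - β) / 2 * U z - ((N : ℝ) / 2 - z) * dU z) / z) z) :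
    ZoneSol N c β (Set.Ioi 0) (gaussSol c U) (gaussSolDeriv c U dU) := by
  have hz : ∀ η : ℝ, HasDerivAt (fun η : ℝ => c * η ^ 2 / 2) (c * η) η := fun η => by
    refine (((hasDerivAt_pow 2 η).const_mul c).div_const 2).congr_deriv ?_
    simp only [Nat.cast_ofNat, Nat.add_one_sub_one, pow_one]
    ring
  have he : ∀ η : ℝ, HasDerivAt (fun η : ℝ => Real.exp (-(c * η ^ 2 / 2)))
      (Real.exp (-(c * η ^ 2 / 2)) * -(c * η)) η := fun η => (hz η).fun_neg.exp
  refine ⟨fun η hη => ?_, fun η hη => ?_⟩ <;> have hη' : (0 : ℝ) < η := hη <;>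
    have hz0 : 0 < c * η ^ 2 / 2 := by positivity
  · have d1 : HasDerivAt (fun η : ℝ => U (c * η ^ 2 / 2)) _ η :=
      HasDerivAt.comp (h₂ := U) η (h1 _ hz0) (hz η)
    refine ((he η).mul d1).congr_deriv ?_
    simp only [gaussSolDeriv]
    ring
  · have d1 : HasDerivAt (fun η : ℝ => U (c * η ^ 2 / 2)) _ η :=
      HasDerivAt.comp (h₂ := U) η (h1 _ hz0) (hz η)
    have d2 : HasDerivAt (fun η : ℝ => dU (c * η ^ 2 / 2)) _ η :=
      HasDerivAt.comp (h₂ := dU) η (h2 _ hz0) (hz η)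
    have d3 : HasDerivAt (fun η : ℝ => c * η) c η := by
      simpa using (hasDerivAt_id η).const_mul c
    refine (d3.mul ((he η).mul (d2.sub d1))).congr_deriv ?_
    simp only [gaussSolDeriv, gaussSol, Pi.mul_apply, Pi.sub_apply]
    field_simp
    ring

lemma tendsto_half_mul_sq {c : ℝ} (hc : 0 < c) :
    Tendsto (fun η : ℝ => c * η ^ 2 / 2) atTop atTop := by
  have h : Tendsto (fun η : ℝ => c / 2 * η ^ 2) atTop atTop :=
    (tendsto_pow_atTop two_ne_zero).const_mul_atTop (by positivity)
  exact h.congr fun η => by ring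

lemma rpow_half_mul_sq {c a η : ℝ} (hc : 0 < c) (hη : 0 < η) :
    (c * η ^ 2 / 2) ^ a = (c / 2) ^ a * η ^ (2 * a) := by
  have e : c * η ^ 2 / 2 = c / 2 * η ^ (2 : ℝ) := by
    rw [Real.rpow_two]; ring
  rw [e, Real.mul_rpow (by positivity) (by positivity), ← Real.rpow_mul hη.le]

/-- `U(z) ~ z^(-a)` in the variable `η`. -/
lemma tendsto_gaussSol {c a p : ℝ} (hc : 0 < c) (hp : p = 2 * a) {U : ℝ → ℝ} {l : ℝ}
    (hU : Tendsto (fun z => z ^ a * U z) atTop (𝓝 l)) :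
    Tendsto (fun η => η ^ p * Real.exp (c * η ^ 2 / 2) * gaussSol c U η) atTop
      (𝓝 ((c / 2) ^ (-a) * l)) := by
  have h := (hU.comp (tendsto_half_mul_sq hc)).const_mul ((c / 2) ^ (-a))
  refine h.congr' ?_
  filter_upwards [eventually_gt_atTop 0] with η hη
  simp only [Function.comp, gaussSol]
  rw [rpow_half_mul_sq hc hη, Real.exp_neg, Real.rpow_neg (by positivity), hp]
  have : (c / 2) ^ a ≠ 0 := by positivity
  field_simp

lemma tendsto_rpow_mul_exp_neg_sq {c : ℝ} (hc : 0 < c) (q : ℝ) :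
    Tendsto (fun η : ℝ => η ^ q * Real.exp (-(c * η ^ 2 / 2))) atTop (𝓝 0) := by
  have h := (tendsto_rpow_mul_exp_neg_mul_atTop_nhds_zero (q / 2) 1 one_pos).comp
    (tendsto_half_mul_sq hc)
  have h2 := h.const_mul ((c / 2) ^ (-(q / 2)))
  rw [mul_zero] at h2
  refine h2.congr' ?_
  filter_upwards [eventually_gt_atTop 0] with η hη
  simp only [Function.comp]
  rw [rpow_half_mul_sq hc hη, Real.rpow_neg (by positivity), mul_div_cancel₀ q two_ne_zero]
  have : (c / 2) ^ (q / 2) ≠ 0 := by positivity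
  field_simp

/-- Gaussian bounds beat powers. -/
lemma tendsto_rpow_mul_of_gaussian {c p l : ℝ} (hc : 0 < c) {F : ℝ → ℝ}
    (hF : Tendsto (fun η => η ^ p * Real.exp (c * η ^ 2 / 2) * F η) atTop (𝓝 l)) (q : ℝ) :
    Tendsto (fun η => η ^ q * F η) atTop (𝓝 0) := by
  have h := (tendsto_rpow_mul_exp_neg_sq hc (q - p)).mul hF
  rw [zero_mul] at h
  refine h.congr' ?_
  filter_upwards [eventually_gt_atTop 0] with η hη
  rw [Real.rpow_sub hη, Real.exp_neg]
  have : η ^ p ≠ 0 := by positivity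
  field_simp

lemma tendsto_zoneWeight_mul_sq {N : ℕ} {c p l : ℝ} (hc : 0 < c) {F : ℝ → ℝ}
    (hF : Tendsto (fun η => η ^ p * Real.exp (c * η ^ 2 / 2) * F η) atTop (𝓝 l)) :
    Tendsto (fun η => zoneWeight N c η * F η ^ 2) atTop (𝓝 0) := by
  have h := (tendsto_rpow_mul_exp_neg_sq hc ((N - 1 : ℕ) - 2 * p)).mul (hF.mul hF)
  rw [zero_mul] at h
  refine h.congr' ?_
  filter_upwards [eventually_gt_atTop 0] with η hη
  have e : η ^ (2 * p) = η ^ p * η ^ p := by rw [two_mul, Real.rpow_add hη]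
  rw [Real.rpow_sub hη, e, Real.exp_neg, Real.rpow_natCast, zoneWeight]
  have : η ^ p ≠ 0 := by positivity
  field_simp

/-- Every solution near infinity is of the order `η^(-β)`, unless it is a multiple of the
Gaussian solution. The coefficient is proportional to the Wronskian of the two. -/
lemma ZoneSol.exists_tendsto {N : ℕ} (hN : 1 ≤ N) {c β R : ℝ} (hc : 0 < c) (hR : 0 ≤ R)
    {y dy : ℝ → ℝ} (hy : ZoneSol N c β (Set.Ioi R) y dy) {U dU : ℝ → ℝ}
    (hU : IsTricomiPair (((N : ℝ) - β) / 2) ((N : ℝ) / 2) U dU) :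
    ∃ L, Tendsto (fun η => η ^ β * y η) atTop (𝓝 L) ∧
      (L = 0 → ∃ D R', R ≤ R' ∧
        ∀ η, R' < η → y η = D * gaussSol c U η ∧ dy η = D * gaussSolDeriv c U dU η) := by
  set Y := gaussSol c U
  set dY := gaussSolDeriv c U dU
  have hY : ZoneSol N c β (Set.Ioi 0) Y dY := zoneSol_gaussSol hc hU.fst hU.snd
  set ℓ : ℝ := (c / 2) ^ (-(((N : ℝ) - β) / 2)) with hℓ
  have hℓ0 : 0 < ℓ := by positivity
  have hYlim : Tendsto (fun η => η ^ ((N : ℝ) - β) * Real.exp (c * η ^ 2 / 2) * Y η) atTop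
      (𝓝 ℓ) := by
    have := tendsto_gaussSol hc (p := (N : ℝ) - β) (by ring) hU.tendsto
    rwa [mul_one] at this
  have hdYlim : Tendsto (fun η => η ^ ((N : ℝ) - β) * Real.exp (c * η ^ 2 / 2)
      * gaussSol c dU η) atTop (𝓝 0) := by
    have := tendsto_gaussSol hc (p := (N : ℝ) - β) (by ring) hU.deriv_tendsto
    rwa [mul_zero] at this
  have hdY : ∀ η, dY η = c * η * (gaussSol c dU η - Y η) := fun η => by
    simp only [dY, Y, gaussSolDeriv, gaussSol]; ring
  have hYpos : ∀ᶠ η in atTop, 0 < Y η := by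
    filter_upwards [hYlim.eventually (lt_mem_nhds hℓ0), eventually_gt_atTop 0] with η h1 h2
    have : 0 < η ^ ((N : ℝ) - β) * Real.exp (c * η ^ 2 / 2) := by positivity
    exact (mul_pos_iff_of_pos_left this).1 h1
  obtain ⟨R₁, hR₁⟩ := eventually_atTop.1 (hYpos.and (eventually_gt_atTop R))
  have hRR : R < R₁ := (hR₁ R₁ le_rfl).2
  -- the constant Wronskian
  obtain ⟨K, hK⟩ : ∃ K, ∀ η, R₁ < η → zoneWeight N c η * (Y η * dy η - dY η * y η) = K := by
    have hd : ∀ η ∈ Set.Ioi R₁, HasDerivAt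
        (fun x => zoneWeight N c x * (Y x * dy x - dY x * y x)) 0 η := by
      intro η hη
      have hη' : R₁ < η := hη
      have h0 : 0 < η := by linarith
      have := hasDerivAt_wronskian hN (hY.mono (Set.Ioi_subset_Ioi hR)) hy h0
        (Set.mem_Ioi.2 (hRR.trans hη'))
      exact this.congr_deriv (by ring)
    exact ⟨_, fun η hη => eq_of_hasDerivAt_zero (convex_Ioi R₁) isOpen_Ioi hd hη
      (Set.mem_Ioi.2 (lt_add_one R₁))⟩
  -- `q = y / Y` is compared with `G = 1 / (η^β Y)` by l'Hôpital's rule, as `η^β y = q / G`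
  let q : ℝ → ℝ := fun η => y η / Y η
  have hq : ∀ η, R₁ < η → HasDerivAt q (K / (zoneWeight N c η * Y η ^ 2)) η := by
    intro η hη
    have h0 : 0 < η := by linarith
    have hYp := (hR₁ η hη.le).1
    have hp := zoneWeight_pos N c h0
    refine ((hy.fst η (Set.mem_Ioi.2 (hRR.trans hη))).div (hY.fst η h0) hYp.ne').congr_deriv ?_
    rw [← hK η hη]
    field_simp
  let G : ℝ → ℝ := fun η => (η ^ β * Y η)⁻¹
  let G' : ℝ → ℝ := fun η => -(β * η ^ β / η * Y η + η ^ β * dY η) / (η ^ β * Y η) ^ 2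
  have hG : ∀ η, R₁ < η → HasDerivAt G (G' η) η := by
    intro η hη
    have h0 : 0 < η := by linarith
    have hYp := (hR₁ η hη.le).1
    have d1 := Real.hasDerivAt_rpow_const (x := η) (p := β) (Or.inl h0.ne')
    rw [Real.rpow_sub_one h0.ne', ← mul_div_assoc] at d1
    have hne : η ^ β * Y η ≠ 0 := by positivity
    exact (d1.mul (hY.fst η h0)).fun_inv hne
  have hGtop : Tendsto G atTop atTop := by
    apply Tendsto.inv_tendsto_nhdsGT_zero
    rw [tendsto_nhdsWithin_iff]
    refine ⟨tendsto_rpow_mul_of_gaussian hc hYlim β, ?_⟩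
    filter_upwards [hYpos, eventually_gt_atTop 0] with η h1 h2
    exact Set.mem_Ioi.2 (by positivity)
  -- `q' / G' = K / (η^(N-β) e^(c η²/2) (c Y - c V - β Y / η²))` with `V = e^(-z) U'(z)`
  let E : ℝ → ℝ := fun η => c * (η ^ ((N : ℝ) - β) * Real.exp (c * η ^ 2 / 2) * Y η)
    - c * (η ^ ((N : ℝ) - β) * Real.exp (c * η ^ 2 / 2) * gaussSol c dU η)
    - β * (η ^ ((N : ℝ) - β) * Real.exp (c * η ^ 2 / 2) * Y η) * (η⁻¹ * η⁻¹)
  have hE : Tendsto E atTop (𝓝 (c * ℓ)) := by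
    have h1 := ((hYlim.const_mul c).sub (hdYlim.const_mul c)).sub
      ((hYlim.const_mul β).mul (tendsto_inv_atTop_zero.mul tendsto_inv_atTop_zero))
    have e : c * ℓ - c * 0 - β * ℓ * (0 * 0) = c * ℓ := by ring
    rwa [e] at h1
  have hGE : ∀ η, R₁ < η → G' η = E η * (zoneWeight N c η * Y η ^ 2)⁻¹ := by
    intro η hη
    have h0 : 0 < η := by linarith
    have hYp := (hR₁ η hη.le).1
    have hp : zoneWeight N c η = η ^ (N : ℝ) / η * Real.exp (c * η ^ 2 / 2) := by
      rw [zoneWeight, Real.rpow_natCast]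
      congr 1
      rw [eq_div_iff h0.ne', ← pow_succ]
      congr 1
      omega
    have h1 : η ^ β ≠ 0 := by positivity
    have h2 : η ^ (N : ℝ) ≠ 0 := by positivity
    simp only [G', E]
    rw [hp, hdY, Real.rpow_sub h0]
    field_simp
    ring
  have hEpos : ∀ᶠ η in atTop, 0 < E η := hE.eventually (lt_mem_nhds (by positivity))
  have hlim := tendsto_div_of_tendsto_deriv_div (L := K / (c * ℓ)) hq hG (by
      filter_upwards [hEpos, eventually_gt_atTop R₁] with η h1 h2
      have h0 : 0 < η := by linarith
      have hYp := (hR₁ η h2.le).1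
      have hp := zoneWeight_pos N c h0
      rw [hGE η h2]
      positivity) hGtop (by
      refine (tendsto_const_nhds.div hE (by positivity) : Tendsto (fun η => K / E η) _ _).congr' ?_
      filter_upwards [hEpos, eventually_gt_atTop R₁] with η h1 h2
      have h0 : 0 < η := by linarith
      have hYp := (hR₁ η h2.le).1
      have hp := zoneWeight_pos N c h0
      rw [hGE η h2]
      simp only [Pi.div_apply]
      field_simp)
  refine ⟨K / (c * ℓ), ?_, fun hL => ?_⟩
  · refine hlim.congr' ?_
    filter_upwards [eventually_gt_atTop R₁] with η h2
    have hYp := (hR₁ η h2.le).1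
    simp only [q, G, div_inv_eq_mul]
    field_simp
  · have hK0 : K = 0 := by
      rcases div_eq_zero_iff.1 hL with h | h
      · exact h
      · exact absurd h (by positivity)
    have hqc : ∀ η, R₁ < η → q η = q (R₁ + 1) := by
      intro η hη
      have hd : ∀ x ∈ Set.Ioi R₁, HasDerivAt q 0 x := fun x hx =>
        (hq x hx).congr_deriv (by rw [hK0, zero_div])
      exact eq_of_hasDerivAt_zero (convex_Ioi R₁) isOpen_Ioi hd hη
        (Set.mem_Ioi.2 (lt_add_one R₁))
    have hyq : ∀ η, R₁ < η → y η = q (R₁ + 1) * Y η := by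
      intro η hη
      have hYp := (hR₁ η hη.le).1
      rw [← hqc η hη]
      simp only [q]
      field_simp
    refine ⟨q (R₁ + 1), R₁, hRR.le, fun η hη => ⟨hyq η hη, ?_⟩⟩
    have h0 : 0 < η := by linarith
    have heq : y =ᶠ[𝓝 η] fun x => q (R₁ + 1) * Y x := by
      filter_upwards [lt_mem_nhds hη] with x hx using hyq x hx
    have d1 := hy.fst η (Set.mem_Ioi.2 (hRR.trans hη))
    have d2 := ((hY.fst η h0).const_mul (q (R₁ + 1))).congr_of_eventuallyEq heq
    exact d1.unique d2

/-! ### The critical exponents -/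

/-- `α` is critical of index `m` if `W` has exactly `m + 1` positive zeros and decays faster than
`η^(-α-2)`, hence like a Gaussian. -/
def IsCritical (N : ℕ) (γ α : ℝ) (m : ℕ) : Prop :=
  (∃ y, IsNode N γ α (m + 1) y ∧ ∀ t, y < t → 0 < (-1) ^ (m + 1) * profileW N γ α t) ∧
    Tendsto (fun η => η ^ (α + 2) * profileW N γ α η) atTop (𝓝 0)

/-- The exponent at which the zero of index `m + 2` appears, coming from infinity. -/
def criticalExponent (N : ℕ) (γ : ℝ) (m : ℕ) : ℝ := sInf {α | ∃ x, IsNode N γ α (m + 2) x}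

section profile

variable {N : ℕ} {γ : ℝ} (hγ : -1 < γ) (hγ' : γ < 1)
include hγ hγ'

lemma profileW_zoneSol_last (hN : 1 ≤ N) {α : ℝ} {k : ℕ} {y : ℝ} (hy : IsNode N γ α k y)
    (hW : ∀ t, y < t → 0 < (-1) ^ k * profileW N γ α t) :
    ZoneSol N (zoneCoeff γ ((-1) ^ k)) (α + 2) (Set.Ioi y) (profileW N γ α) (profileDW N γ α) :=
  profileW_zoneSol hγ hγ' hN α (neg_one_pow_eq k) isOpen_Ioi (fun _ hη => hy.nonneg.trans_lt hη) hW

lemma eventually_eq_gaussSol_of_decay (hN : 1 ≤ N) {α : ℝ} {k : ℕ} {y : ℝ}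
    (hy : IsNode N γ α k y) (hW : ∀ t, y < t → 0 < (-1) ^ k * profileW N γ α t)
    (hdec : Tendsto (fun η => η ^ (α + 2) * profileW N γ α η) atTop (𝓝 0)) {U dU : ℝ → ℝ}
    (hU : IsTricomiPair (((N : ℝ) - (α + 2)) / 2) ((N : ℝ) / 2) U dU) :
    ∃ D R', y ≤ R' ∧ ∀ η, R' < η →
      profileW N γ α η = D * gaussSol (zoneCoeff γ ((-1) ^ k)) U η ∧
      profileDW N γ α η = D * gaussSolDeriv (zoneCoeff γ ((-1) ^ k)) U dU η := by
  obtain ⟨L, hL, h⟩ := (profileW_zoneSol_last hγ hγ' hN hy hW).exists_tendsto hN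
    (zoneCoeff_pos hγ hγ' (neg_one_pow_eq k)) hy.nonneg hU
  exact h (tendsto_nhds_unique hL hdec)

lemma zoneWeight_mul_sq_tendsto_of_decay (hN : 1 ≤ N) {α : ℝ} {k : ℕ} {y : ℝ}
    (hy : IsNode N γ α k y) (hW : ∀ t, y < t → 0 < (-1) ^ k * profileW N γ α t)
    (hdec : Tendsto (fun η => η ^ (α + 2) * profileW N γ α η) atTop (𝓝 0)) :
    Tendsto (fun η => zoneWeight N (zoneCoeff γ ((-1) ^ k)) η * profileW N γ α η ^ 2)
      atTop (𝓝 0) := by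
  obtain ⟨U, dU, hU⟩ := exists_isTricomiPair (((N : ℝ) - (α + 2)) / 2) ((N : ℝ) / 2)
  obtain ⟨D, R, -, hD⟩ := eventually_eq_gaussSol_of_decay hγ hγ' hN hy hW hdec hU
  have hc := zoneCoeff_pos hγ hγ' (neg_one_pow_eq k)
  have h := (tendsto_zoneWeight_mul_sq (N := N) hc
    (tendsto_gaussSol hc rfl hU.tendsto)).const_mul (D ^ 2)
  rw [mul_zero] at h
  refine h.congr' ?_
  filter_upwards [eventually_gt_atTop R] with η hη
  rw [(hD η hη).1]
  ring

lemma IsCritical.node_iff (hN : 1 ≤ N) {α : ℝ} {m : ℕ} (h : IsCritical N γ α m) (α' : ℝ) :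
    (∃ x, IsNode N γ α' (m + 2) x) ↔ α < α' := by
  obtain ⟨⟨y, hy, hW⟩, hdec⟩ := h
  have hnot := hy.not_exists_succ hW
  constructor
  · rintro ⟨x, hx⟩
    by_contra hcon
    rcases (not_lt.1 hcon).eq_or_lt with rfl | hlt
    · exact hnot ⟨x, hx⟩
    · obtain ⟨x', -, hx'⟩ := hx.exists_le_of_lt hγ hγ' hN hlt
      exact hnot ⟨x', hx'⟩
  · intro hlt
    exact hy.exists_succ_of_decay hγ hγ' hN hlt hW
      (zoneWeight_mul_sq_tendsto_of_decay hγ hγ' hN hy hW hdec)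

lemma IsCritical.eq_criticalExponent (hN : 1 ≤ N) {α : ℝ} {m : ℕ} (h : IsCritical N γ α m) :
    α = criticalExponent N γ m := by
  have : {α' | ∃ x, IsNode N γ α' (m + 2) x} = Set.Ioi α := by
    ext α'
    exact h.node_iff hγ hγ' hN α'
  rw [criticalExponent, this, csInf_Ioi]

lemma isCritical_criticalExponent (hN : 1 ≤ N) (m : ℕ) :
    IsCritical N γ (criticalExponent N γ m) m := by
  set S := {α | ∃ x, IsNode N γ α (m + 2) x} with hS
  set β := criticalExponent N γ m
  have hne : S.Nonempty := exists_node_of_large hγ hγ' hN (m + 2)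
  have hbdd : BddBelow S := by
    refine ⟨(N : ℝ) - 2, ?_⟩
    rintro α ⟨x, hx⟩
    have := lt_of_mem_zeros hγ hγ' hN hx.mem_zeros
    linarith
  -- `S` is open, so its infimum is not attained
  have hβS : β ∉ S := by
    intro hmem
    obtain ⟨ε, hε, hball⟩ := Metric.isOpen_iff.1 (isOpen_exists_node hγ hγ' hN (m + 2)) β hmem
    have h1 : β - ε / 2 ∈ S := hball (by
      rw [Metric.mem_ball, Real.dist_eq]
      have : β - ε / 2 - β = -(ε / 2) := by ring
      rw [this, abs_neg, abs_of_pos (by linarith)]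
      linarith)
    have h2 : β ≤ β - ε / 2 := csInf_le hbdd h1
    linarith
  have hfreq : ∃ᶠ α in 𝓝 β, α ∈ S := mem_closure_iff_frequently.1 (csInf_mem_closure hne hbdd)
  obtain ⟨k, y, hy, hW⟩ := exists_last_node hγ hγ' hN β
  have hk : k < m + 2 := by
    by_contra hcon
    exact hβS (exists_node_of_le (not_lt.1 hcon) ⟨y, hy⟩)
  -- if `W` had at most `m` zeros at `β`, it would have at most `m + 1` nearby
  have hkm : m < k := by
    by_contra hcon
    obtain ⟨α, hα1, hα2⟩ :=
      (hfreq.and_eventually (eventually_not_exists_node hγ hγ' hN hy hW)).exists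
    exact hα2 (exists_node_of_le (by omega) hα1)
  obtain rfl : k = m + 1 := by omega
  refine ⟨⟨y, hy, hW⟩, ?_⟩
  -- without decay, the number of zeros would stay below `m + 2` nearby
  by_contra hnd
  obtain ⟨α, hα1, hα2⟩ :=
    (hfreq.and_eventually (eventually_not_exists_succ_node hγ hγ' hN hy hW hnd)).exists
  exact hα2 hα1

lemma eq_criticalExponent_iff (hN : 1 ≤ N) {α : ℝ} {m : ℕ} :
    α = criticalExponent N γ m ↔ IsCritical N γ α m :=
  ⟨fun h => h ▸ isCritical_criticalExponent hγ hγ' hN m,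
    fun h => h.eq_criticalExponent hγ hγ' hN⟩

lemma strictMono_criticalExponent (hN : 1 ≤ N) : StrictMono (criticalExponent N γ) := by
  refine strictMono_nat_of_lt_succ fun m => ?_
  have h := isCritical_criticalExponent (N := N) hγ hγ' hN m
  obtain ⟨⟨y, hy, -⟩, -⟩ := isCritical_criticalExponent (N := N) hγ hγ' hN (m + 1)
  exact (h.node_iff hγ hγ' hN _).1 ⟨y, hy⟩

lemma tendsto_criticalExponent (hN : 1 ≤ N) :
    Tendsto (criticalExponent N γ) atTop atTop := by
  refine tendsto_atTop_atTop_of_monotone (strictMono_criticalExponent hγ hγ' hN).monotone ?_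
  intro b
  by_contra hcon
  push Not at hcon
  have h := isCritical_criticalExponent (N := N) hγ hγ' hN (profileZeros N γ b).ncard
  obtain ⟨x, hx⟩ := (h.node_iff hγ hγ' hN b).2 (hcon _)
  have := hx.le_ncard hγ hγ' hN
  omega

lemma lt_criticalExponent (hN : 1 ≤ N) (m : ℕ) : (N : ℝ) - 2 < criticalExponent N γ m := by
  obtain ⟨⟨y, hy, -⟩, -⟩ := isCritical_criticalExponent (N := N) hγ hγ' hN m
  have := lt_of_mem_zeros hγ hγ' hN hy.mem_zeros
  linarith

omit hγ hγ' in
lemma profileW_eq_of_zero (hγ : -1 < γ) (hγ' : γ < 1) (η : ℝ) :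
    profileW 1 γ 0 η = 1 + η * profileH 1 γ 0 η := by
  rw [profileW_eq hγ hγ']
  ring

/-- In dimension one and for `α = 0`, `W` decreases at each of its zeros, so there is at most
one. -/
lemma not_isNode_two : ¬∃ x, IsNode 1 γ 0 2 x := by
  rintro ⟨x, hx⟩
  have hz := hx.mem_zeros
  obtain ⟨y, hy, hyx, h0, hp⟩ := hx
  have hd := (hasDerivAt_profileW (N := 1) hγ hγ' le_rfl 0 hz.1).const_mul ((-1 : ℝ) ^ 1)
  have h1 := deriv_nonpos_of_pos_left hd (by simp [h0]) hyx hp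
  have h2 := profileW_eq_of_zero hγ hγ' x
  rw [h0] at h2
  rw [profileDW_of_zero h0] at h1
  norm_num at h1
  have hx0 : 0 < x := hz.1
  nlinarith

/-- In dimension one, `α = 0` is not critical: `W → 0` forces `η h → -1`, while
`h' = c |W| = o(η^(-2))` forces `η h → 0`. -/
lemma not_isCritical_zero : ¬IsCritical 1 γ 0 0 := by
  rintro ⟨⟨y, hy, hW⟩, hdec⟩
  have hy0 := hy.nonneg
  have hs := neg_one_pow_eq (0 + 1)
  have hc1 : zoneCoeff γ ((-1) ^ (0 + 1)) ≤ 1 := by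
    unfold zoneCoeff
    norm_num
    linarith
  have hc := zoneCoeff_pos hγ hγ' hs
  set c := zoneCoeff γ ((-1) ^ (0 + 1))
  have hWlim : Tendsto (profileW 1 γ 0) atTop (𝓝 0) := by
    have h := hdec.mul (tendsto_inv_atTop_zero.mul tendsto_inv_atTop_zero)
    simp only [mul_zero] at h
    refine h.congr' ?_
    filter_upwards [eventually_gt_atTop 0] with η hη
    have : η ^ ((0 : ℝ) + 2) = η ^ 2 := by rw [zero_add]; exact Real.rpow_two η
    rw [this]
    field_simp
  have hHη : Tendsto (fun η => η * profileH 1 γ 0 η) atTop (𝓝 (-1)) := by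
    have := hWlim.sub_const 1
    rw [zero_sub] at this
    refine this.congr fun η => ?_
    rw [profileW_eq_of_zero hγ hγ']
    ring
  have hHlim : Tendsto (fun η => profileH 1 γ 0 η + 1 / 4 * η⁻¹) atTop (𝓝 0) := by
    have h1 := (hHη.mul tendsto_inv_atTop_zero).add (tendsto_inv_atTop_zero.const_mul (1 / 4 : ℝ))
    simp only [mul_zero, add_zero] at h1
    refine h1.congr' ?_
    filter_upwards [eventually_gt_atTop 0] with η hη
    field_simp
  have hsmall : ∀ᶠ η in atTop, -(1 / 4) < η ^ ((0 : ℝ) + 2) * profileW 1 γ 0 η :=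
    hdec.eventually (lt_mem_nhds (by norm_num))
  obtain ⟨R, hR⟩ := eventually_atTop.1 (hsmall.and (eventually_gt_atTop y))
  have hRy : y < R := (hR R le_rfl).2
  have hanti : AntitoneOn (fun η => profileH 1 γ 0 η + 1 / 4 * η⁻¹) (Set.Ici R) := by
    have hd : ∀ η, R ≤ η → HasDerivAt (fun η => profileH 1 γ 0 η + 1 / 4 * η⁻¹)
        (flux γ (profileW 1 γ 0 η) + 1 / 4 * (-(η ^ 2)⁻¹)) η := by
      intro η hη
      have h0 : 0 < η := by linarith
      have d1 := hasDerivAt_profileH (N := 1) hγ hγ' le_rfl 0 h0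
      have d2 := (hasDerivAt_inv h0.ne').const_mul (1 / 4 : ℝ)
      refine (d1.add d2).congr_deriv ?_
      norm_num
    refine antitoneOn_of_hasDerivWithinAt_nonpos (convex_Ici R)
      (fun η hη => (hd η hη).continuousAt.continuousWithinAt)
      (fun η hη => (hd η (interior_subset hη)).hasDerivWithinAt) fun η hη => ?_
    have hη' : R ≤ η := interior_subset hη
    have h0 : 0 < η := by linarith
    have hWη := hW η (by linarith)
    have hf : flux γ (profileW 1 γ 0 η) = -c * profileW 1 γ 0 η := flux_eq hs hWη.le
    rw [hf]
    have h1 := (hR η hη').1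
    have e : η ^ ((0 : ℝ) + 2) = η ^ 2 := by rw [zero_add]; exact Real.rpow_two η
    rw [e] at h1
    norm_num at hWη
    have h2 : -profileW 1 γ 0 η ≤ 1 / 4 * (η ^ 2)⁻¹ := by
      rw [← div_eq_mul_inv, le_div_iff₀ (by positivity)]
      linarith
    have h3 : -c * profileW 1 γ 0 η ≤ -profileW 1 γ 0 η := by nlinarith
    linarith
  have hnonneg : ∀ η, R ≤ η → 0 ≤ profileH 1 γ 0 η + 1 / 4 * η⁻¹ := by
    intro η hη
    refine le_of_tendsto hHlim ?_
    filter_upwards [eventually_ge_atTop η] with t ht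
    exact hanti (Set.mem_Ici.2 hη) (Set.mem_Ici.2 (hη.trans ht)) ht
  -- `h + 1 / (4 η)` decreases to zero, hence is nonnegative, and `η h ≥ -1/4`
  have hcontra : (-(1 / 4) : ℝ) ≤ -1 := by
    refine ge_of_tendsto hHη ?_
    filter_upwards [eventually_ge_atTop R] with η hη
    have h0 : 0 < η := by linarith
    have h1 := mul_nonneg h0.le (hnonneg η hη)
    have e : η * (profileH 1 γ 0 η + 1 / 4 * η⁻¹) = η * profileH 1 γ 0 η + 1 / 4 := by
      field_simp
    rw [e] at h1
    linarith
  norm_num at hcontra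

lemma criticalExponent_zero_pos (hN : 1 ≤ N) : 0 < criticalExponent N γ 0 := by
  have h := lt_criticalExponent (N := N) hγ hγ' hN 0
  rcases hN.eq_or_lt with rfl | hN2
  · by_contra hcon
    have hcrit := isCritical_criticalExponent (N := 1) hγ hγ' le_rfl 0
    rcases (not_lt.1 hcon).eq_or_lt with heq | hlt
    · rw [heq] at hcrit
      exact not_isCritical_zero hγ hγ' hcrit
    · exact not_isNode_two hγ hγ' ((hcrit.node_iff hγ hγ' le_rfl 0).2 hlt)
  · have : (2 : ℝ) ≤ N := by exact_mod_cast hN2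
    linarith

end profile

/-! ### Kummer's function -/

lemma summable_succ_mul {v : ℕ → ℝ} (hv : ∀ r : ℝ, Summable fun n => |v n| * r ^ n) (r : ℝ) :
    Summable fun n : ℕ => |((n : ℝ) + 1) * v (n + 1)| * r ^ n := by
  set s := |r| + 1
  have hs : 0 < s := by positivity
  have h := ((summable_nat_add_iff 1).2 (hv (2 * s))).mul_left s⁻¹
  refine Summable.of_norm_bounded h fun n => ?_
  have h1 : (n : ℝ) + 1 ≤ 2 ^ (n + 1) := by
    have : n + 1 < 2 ^ (n + 1) := Nat.lt_two_pow_self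
    exact_mod_cast this.le
  have h2 : |r| ^ n ≤ s ^ n := pow_le_pow_left₀ (abs_nonneg _) (by simp [s]) n
  rw [norm_mul, norm_pow, Real.norm_eq_abs, Real.norm_eq_abs, abs_abs, abs_mul,
    abs_of_nonneg (by positivity : (0 : ℝ) ≤ (n : ℝ) + 1)]
  calc ((n : ℝ) + 1) * |v (n + 1)| * |r| ^ n ≤ 2 ^ (n + 1) * |v (n + 1)| * s ^ n := by gcongr
    _ = s⁻¹ * (|v (n + 1)| * (2 * s) ^ (n + 1)) := by
      rw [mul_pow, pow_succ s]; field_simp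

lemma summable_mul_pow {v : ℕ → ℝ} (hv : ∀ r : ℝ, Summable fun n => |v n| * r ^ n) (z : ℝ) :
    Summable fun n => v n * z ^ n :=
  Summable.of_norm_bounded (hv |z|) fun n => by
    rw [norm_mul, norm_pow, Real.norm_eq_abs, Real.norm_eq_abs]

lemma mul_tsum_succ {v : ℕ → ℝ} (z : ℝ)
    (hv : Summable fun n : ℕ => (n : ℝ) * v n * z ^ n) :
    z * ∑' n : ℕ, ((n : ℝ) + 1) * v (n + 1) * z ^ n = ∑' n : ℕ, (n : ℝ) * v n * z ^ n := by
  rw [hv.tsum_eq_zero_add, ← tsum_mul_left]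
  simp only [Nat.cast_zero, zero_mul, zero_add]
  refine tsum_congr fun n => ?_
  push_cast
  ring

/-- Termwise differentiation of an everywhere convergent power series. -/
lemma hasDerivAt_tsum_mul_pow {v : ℕ → ℝ} (hv : ∀ r : ℝ, Summable fun n => |v n| * r ^ n) (z : ℝ) :
    HasDerivAt (fun z => ∑' n, v n * z ^ n) (∑' n : ℕ, ((n : ℝ) + 1) * v (n + 1) * z ^ n) z := by
  set R := |z| + 1
  have hbd : Summable fun n : ℕ => |v n| * (n * R ^ (n - 1)) := by
    rw [← summable_nat_add_iff 1]
    refine (summable_succ_mul hv R).congr fun n => ?_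
    rw [abs_mul, abs_of_nonneg (by positivity : (0 : ℝ) ≤ (n : ℝ) + 1)]
    push_cast
    ring
  have h := hasDerivAt_tsum_of_isPreconnected (g := fun n (z : ℝ) => v n * z ^ n)
    (g' := fun n (z : ℝ) => v n * (n * z ^ (n - 1))) (t := Metric.ball 0 R) (y₀ := 0) (y := z)
    hbd Metric.isOpen_ball (convex_ball 0 R).isPreconnected
    (fun n y _ => (hasDerivAt_pow n y).const_mul (v n))
    (fun n y hy => by
      have hy' : |y| ≤ R := by
        rw [mem_ball_zero_iff, Real.norm_eq_abs] at hy
        exact hy.le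
      rw [norm_mul, norm_mul, norm_pow, Real.norm_eq_abs, Real.norm_eq_abs, Real.norm_eq_abs,
        Nat.abs_cast]
      gcongr)
    (Metric.mem_ball_self (by positivity)) (summable_mul_pow hv 0)
    (by rw [mem_ball_zero_iff, Real.norm_eq_abs]; exact lt_add_one _)
  refine h.congr_deriv ?_
  have hs : Summable fun n : ℕ => v n * (n * z ^ (n - 1)) := by
    rw [← summable_nat_add_iff 1]
    refine (summable_mul_pow (summable_succ_mul hv) z).congr fun n => ?_
    push_cast
    ring
  rw [hs.tsum_eq_zero_add]
  simp only [Nat.cast_zero, zero_mul, mul_zero, zero_add]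
  refine tsum_congr fun n => ?_
  push_cast
  ring

/-- The coefficients of Kummer's series. -/
def kummerCoeff (a b : ℝ) (k : ℕ) : ℝ :=
  (ascPochhammer ℝ k).eval a / (ascPochhammer ℝ k).eval b / (k.factorial : ℝ)

/-- The derivative of Kummer's function, as a series. -/
def kummerDeriv (a b z : ℝ) : ℝ := ∑' n : ℕ, ((n : ℝ) + 1) * kummerCoeff a b (n + 1) * z ^ n

lemma kummerM_eq (a b z : ℝ) : kummerM a b z = ∑' k, kummerCoeff a b k * z ^ k := by
  unfold kummerM kummerCoeff
  exact tsum_congr fun k => by ring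

lemma kummerCoeff_succ {a b : ℝ} (hb : 0 < b) (k : ℕ) :
    kummerCoeff a b (k + 1) * ((k + 1) * (b + k)) = kummerCoeff a b k * (a + k) := by
  have h1 := ascPochhammer_pos k b hb
  have h2 : (k.factorial : ℝ) ≠ 0 := by exact_mod_cast k.factorial_ne_zero
  have h3 : b + k ≠ 0 := by positivity
  simp only [kummerCoeff, ascPochhammer_succ_eval, Nat.factorial_succ]
  push_cast
  field_simp

lemma summable_kummerCoeff {a b : ℝ} (hb : 0 < b) (r : ℝ) :
    Summable fun n => |kummerCoeff a b n| * r ^ n := by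
  set C := |a| / b + 1
  have hC : 0 < C := by positivity
  obtain ⟨n₀, hn₀⟩ := exists_nat_gt (2 * (C * |r|))
  refine summable_of_ratio_norm_eventually_le (r := 1 / 2) (by norm_num) ?_
  filter_upwards [eventually_ge_atTop n₀] with n hn
  have hn' : 2 * (C * |r|) ≤ (n : ℝ) + 1 := by
    have : (n₀ : ℝ) ≤ n := by exact_mod_cast hn
    linarith
  have hbn : 0 < b + n := by positivity
  have h1 : kummerCoeff a b (n + 1) = kummerCoeff a b n * (a + n) / ((n + 1) * (b + n)) := by
    rw [← kummerCoeff_succ hb]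
    field_simp
  have h2 : |a + n| ≤ C * (b + n) := by
    have : |a + n| ≤ |a| + n := (abs_add_le _ _).trans (by simp)
    have e : C * (b + n) = |a| + n + (b + |a| / b * n) := by
      simp only [C]; field_simp; ring
    have : 0 ≤ b + |a| / b * n := by positivity
    linarith
  have h3 : |kummerCoeff a b (n + 1)| ≤ |kummerCoeff a b n| * (C / (n + 1)) := by
    rw [h1, abs_div, abs_mul, abs_of_pos (by positivity : 0 < ((n : ℝ) + 1) * (b + n)),
      mul_div_assoc]
    have h5 : |a + n| / (((n : ℝ) + 1) * (b + n)) ≤ C / (n + 1) := by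
      rw [div_le_div_iff₀ (by positivity) (by positivity)]
      nlinarith
    gcongr
  rw [norm_mul, norm_mul, norm_pow, norm_pow, Real.norm_eq_abs, Real.norm_eq_abs,
    Real.norm_eq_abs, abs_abs, abs_abs]
  have h4 : C / (n + 1) * |r| ≤ 1 / 2 := by
    rw [div_mul_eq_mul_div, div_le_iff₀ (by positivity)]
    linarith
  calc |kummerCoeff a b (n + 1)| * |r| ^ (n + 1)
      ≤ |kummerCoeff a b n| * (C / (n + 1)) * |r| ^ (n + 1) := by gcongr
    _ = C / (n + 1) * |r| * (|kummerCoeff a b n| * |r| ^ n) := by rw [pow_succ]; ring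
    _ ≤ 1 / 2 * (|kummerCoeff a b n| * |r| ^ n) := by gcongr

lemma hasDerivAt_kummerM {a b : ℝ} (hb : 0 < b) (z : ℝ) :
    HasDerivAt (kummerM a b) (kummerDeriv a b z) z := by
  have : kummerM a b = fun z => ∑' k, kummerCoeff a b k * z ^ k := funext (kummerM_eq a b)
  rw [this]
  exact hasDerivAt_tsum_mul_pow (summable_kummerCoeff hb) z

lemma continuous_kummerM {a b : ℝ} (hb : 0 < b) : Continuous (kummerM a b) :=
  continuous_iff_continuousAt.2 fun z => (hasDerivAt_kummerM hb z).continuousAt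

lemma continuous_kummerDeriv {a b : ℝ} (hb : 0 < b) : Continuous (kummerDeriv a b) :=
  continuous_iff_continuousAt.2 fun z =>
    (hasDerivAt_tsum_mul_pow (summable_succ_mul (summable_kummerCoeff (a := a) hb)) z).continuousAt

/-- Kummer's equation. -/
lemma hasDerivAt_kummerDeriv {a b : ℝ} (hb : 0 < b) {z : ℝ} (hz : 0 < z) :
    HasDerivAt (kummerDeriv a b)
      ((a * kummerM a b z - (b - z) * kummerDeriv a b z) / z) z := by
  set v := kummerCoeff a b
  have hv : ∀ r : ℝ, Summable fun n => |v n| * r ^ n := summable_kummerCoeff hb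
  have hv1 := summable_succ_mul hv
  have hv2 := summable_succ_mul hv1
  refine (hasDerivAt_tsum_mul_pow hv1 z).congr_deriv ?_
  rw [eq_div_iff hz.ne', mul_comm, kummerM_eq]
  have s0 := summable_mul_pow hv z
  have s1 := summable_mul_pow hv1 z
  have s0' : Summable fun n : ℕ => (n : ℝ) * v n * z ^ n := by
    rw [← summable_nat_add_iff 1]
    refine (s1.mul_left z).congr fun n => ?_
    push_cast
    ring
  have s1' : Summable fun n : ℕ => (n : ℝ) * (((n : ℝ) + 1) * v (n + 1)) * z ^ n := by
    rw [← summable_nat_add_iff 1]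
    refine ((summable_mul_pow hv2 z).mul_left z).congr fun n => ?_
    push_cast
    ring
  have e1 := mul_tsum_succ z s1'
  have e2 := mul_tsum_succ z s0'
  have e0 : ∑' n : ℕ, ((n : ℝ) + 1) * v (n + 1) * z ^ n = kummerDeriv a b z := rfl
  push_cast at e1 ⊢
  rw [e1]
  have e3 : a * ∑' k, v k * z ^ k - (b - z) * kummerDeriv a b z
      = a * ∑' k, v k * z ^ k - b * (∑' n : ℕ, ((n : ℝ) + 1) * v (n + 1) * z ^ n)
        + ∑' n : ℕ, (n : ℝ) * v n * z ^ n := by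
    rw [← e2, e0]; ring
  rw [e3, ← tsum_mul_left, ← tsum_mul_left, ← (s0.mul_left a).tsum_sub (s1.mul_left b),
    ← ((s0.mul_left a).sub (s1.mul_left b)).tsum_add s0']
  refine tsum_congr fun n => ?_
  have := kummerCoeff_succ (a := a) hb n
  have h : v (n + 1) * ((n + 1) * (b + n)) = v n * (a + n) := this
  linear_combination z ^ n * h

lemma gamma_mul_ascPochhammer {a : ℝ} (ha : ∀ l : ℕ, a ≠ -(l : ℝ)) (k : ℕ) :
    Real.Gamma a * (ascPochhammer ℝ k).eval a = Real.Gamma (a + k) := by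
  induction k with
  | zero => simp
  | succ k ih =>
    have h : a + k ≠ 0 := fun h => ha k (by linarith)
    rw [ascPochhammer_succ_eval, ← mul_assoc, ih]
    push_cast
    rw [← add_assoc, Real.Gamma_add_one h]
    ring

/-- `Γ(a) M(a, b; z)` grows faster than `z^(-a)`, since all but finitely many coefficients of its
series are positive. -/
lemma tendsto_rpow_mul_gamma_mul_kummerM {a b : ℝ} (hb : 0 < b) (ha0 : a < 0)
    (ha : ∀ l : ℕ, a ≠ -(l : ℝ)) :
    Tendsto (fun z => z ^ a * (Real.Gamma a * kummerM a b z)) atTop atTop := by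
  -- `k₀` is the first index with `a + k₀ > 0`; from there on the coefficients are positive
  set k₀ := ⌊-a⌋₊ + 1
  have hk₀ : 0 < a + k₀ := by
    have := Nat.lt_floor_add_one (-a)
    simp only [k₀]
    push_cast
    linarith
  let t : ℕ → ℝ := fun k => Real.Gamma (a + k) / (ascPochhammer ℝ k).eval b / (k.factorial : ℝ)
  have ht : ∀ k, Real.Gamma a * kummerCoeff a b k = t k := fun k => by
    simp only [t, kummerCoeff]
    rw [← gamma_mul_ascPochhammer ha k]
    ring
  have htpos : ∀ k : ℕ, 0 < a + (k : ℝ) → 0 < t k := fun k hk => by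
    have h1 := ascPochhammer_pos k b hb
    have h2 : (0 : ℝ) < k.factorial := by exact_mod_cast k.factorial_pos
    have h3 := Real.Gamma_pos_of_pos hk
    simp only [t]
    positivity
  have hsum : ∀ z, Summable fun k => t k * z ^ k := fun z => by
    refine ((summable_mul_pow (summable_kummerCoeff (a := a) hb) z).mul_left (Real.Gamma a)).congr
      fun k => ?_
    rw [← mul_assoc, ht]
  set C := ∑ k ∈ Finset.range k₀, |t k|
  have hlow : Tendsto (fun z : ℝ => -C + t k₀ * z ^ (a + k₀)) atTop atTop :=
    tendsto_atTop_add_const_left _ _ ((tendsto_rpow_atTop hk₀).const_mul_atTop (htpos k₀ hk₀))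
  refine tendsto_atTop_mono' _ ?_ hlow
  filter_upwards [eventually_ge_atTop 1] with z hz
  have hz0 : 0 < z := by linarith
  have h1 : Real.Gamma a * kummerM a b z = ∑' k, t k * z ^ k := by
    rw [kummerM_eq, ← tsum_mul_left]
    exact tsum_congr fun k => by rw [← mul_assoc, ht]
  have h2 : ∑ k ∈ Finset.range (k₀ + 1), t k * z ^ k ≤ ∑' k, t k * z ^ k := by
    refine (hsum z).sum_le_tsum _ fun k hk => ?_
    have hk' : k₀ ≤ k := by
      rw [Finset.mem_range] at hk
      omega
    have : (k₀ : ℝ) ≤ k := by exact_mod_cast hk'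
    have := htpos k (by linarith)
    positivity
  have h3 : ∀ k ∈ Finset.range k₀, -|t k| ≤ z ^ a * (t k * z ^ k) := by
    intro k hk
    have hk' : k ≤ ⌊-a⌋₊ := by
      rw [Finset.mem_range] at hk
      omega
    have hak : a + k ≤ 0 := by
      have := (Nat.le_floor_iff (by linarith : 0 ≤ -a)).1 hk'
      linarith
    have h4 : z ^ a * z ^ k ≤ 1 := by
      rw [← Real.rpow_natCast, ← Real.rpow_add hz0]
      exact Real.rpow_le_one_of_one_le_of_nonpos hz hak
    have h5 : 0 ≤ z ^ a * z ^ k := by positivity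
    have h6 := neg_abs_le (t k)
    have e : z ^ a * (t k * z ^ k) = t k * (z ^ a * z ^ k) := by ring
    rw [e]
    nlinarith [abs_nonneg (t k)]
  rw [h1]
  refine le_trans ?_ (mul_le_mul_of_nonneg_left h2 (by positivity : 0 ≤ z ^ a))
  rw [Finset.mul_sum, Finset.sum_range_succ]
  refine add_le_add ?_ (le_of_eq ?_)
  · rw [← Finset.sum_neg_distrib]
    exact Finset.sum_le_sum h3
  · rw [Real.rpow_add hz0, Real.rpow_natCast]
    ring

/-- At the largest zero of `U`, the sign of `M` is that of `Γ(a + 1)`: the Wronskian of `M` and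
`U` is constant up to the factor `z^b e^(-z)`, and its sign is read off at infinity. -/
lemma kummerM_mul_gamma_pos {a b : ℝ} (ha : a < 0) (hb : 0 < b)
    (ha1 : ∀ l : ℕ, a + 1 ≠ -(l : ℝ)) {U dU : ℝ → ℝ} (hU : IsTricomiPair a b U dU) {z₀ : ℝ}
    (hz₀ : 0 < z₀) (h0 : U z₀ = 0) (hpos : ∀ z, z₀ < z → 0 < U z) :
    0 < kummerM a b z₀ * Real.Gamma (a + 1) := by
  have ha' : ∀ l : ℕ, a ≠ -(l : ℝ) := by
    intro l hl
    rcases l with _ | l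
    · simp at hl; linarith
    · exact ha1 l (by rw [hl]; push_cast; ring)
  let m : ℝ → ℝ := fun z => Real.Gamma a * kummerM a b z
  let dm : ℝ → ℝ := fun z => Real.Gamma a * kummerDeriv a b z
  have hm : ∀ z, 0 < z → HasDerivAt m (dm z) z := fun z _ =>
    (hasDerivAt_kummerM hb z).const_mul _
  have hdm : ∀ z, 0 < z → HasDerivAt dm ((a * m z - (b - z) * dm z) / z) z := fun z hz =>
    ((hasDerivAt_kummerDeriv hb hz).const_mul _).congr_deriv (by simp only [m, dm]; ring)
  let ω : ℝ → ℝ := fun z => z ^ b * Real.exp (-z) * (m z * dU z - dm z * U z)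
  have hω : ∀ z ∈ Set.Ioi (0 : ℝ), HasDerivAt ω 0 z := by
    intro z hz
    have hz' : (0 : ℝ) < z := hz
    have d1 := Real.hasDerivAt_rpow_const (x := z) (p := b) (Or.inl hz'.ne')
    have d2 : HasDerivAt (fun z : ℝ => Real.exp (-z)) (Real.exp (-z) * -1) z :=
      (hasDerivAt_id z).fun_neg.exp
    refine ((d1.mul d2).mul (((hm z hz).mul (hU.snd z hz)).sub
      ((hdm z hz).mul (hU.fst z hz)))).congr_deriv ?_
    simp only [Pi.mul_apply, Pi.sub_apply]
    rw [Real.rpow_sub_one hz'.ne']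
    field_simp
    ring
  have hconst : ∀ z, 0 < z → ω z = ω z₀ := fun z hz =>
    eq_of_hasDerivAt_zero (convex_Ioi 0) isOpen_Ioi hω hz hz₀
  -- otherwise `m / U` decreases beyond `z₀`, although it tends to infinity
  have hneg : ω z₀ < 0 := by
    by_contra hcon
    have hanti : AntitoneOn (fun z => m z / U z) (Set.Ioi z₀) := by
      have hd : ∀ z, z₀ < z → HasDerivAt (fun z => m z / U z)
          (-(ω z₀) * (z ^ b * Real.exp (-z) * U z ^ 2)⁻¹) z := by
        intro z hz
        have hz0 : 0 < z := hz₀.trans hz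
        have hUp := hpos z hz
        refine ((hm z hz0).div (hU.fst z hz0) hUp.ne').congr_deriv ?_
        rw [← hconst z hz0]
        simp only [ω]
        field_simp
        ring
      refine antitoneOn_of_hasDerivWithinAt_nonpos (convex_Ioi z₀)
        (fun z hz => (hd z hz).continuousAt.continuousWithinAt)
        (fun z hz => (hd z (interior_subset hz)).hasDerivWithinAt) fun z hz => ?_
      have hz' : z₀ < z := interior_subset hz
      have hz0 : 0 < z := hz₀.trans hz'
      have hUp := hpos z hz'
      exact mul_nonpos_of_nonpos_of_nonneg (by linarith) (by positivity)
    have htop : Tendsto (fun z => m z / U z) atTop atTop := by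
      have h1 := (tendsto_rpow_mul_gamma_mul_kummerM hb ha ha').atTop_mul_pos one_pos
        (by simpa using hU.tendsto.inv₀ one_ne_zero)
      refine h1.congr' ?_
      filter_upwards [eventually_gt_atTop z₀] with z hz
      have hz0 : 0 < z := hz₀.trans hz
      have hUp := hpos z hz
      simp only [m]
      field_simp
    obtain ⟨z, hz1, hz2⟩ := ((htop.eventually_gt_atTop (m (z₀ + 1) / U (z₀ + 1))).and
      (eventually_ge_atTop (z₀ + 1))).exists
    have := hanti (Set.mem_Ioi.2 (lt_add_one z₀)) (Set.mem_Ioi.2 (by linarith)) hz2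
    simp only at this
    linarith
  have hdU : 0 ≤ dU z₀ := deriv_nonneg_of_pos_right (hU.fst z₀ hz₀) h0 (lt_add_one z₀)
    fun t ht => hpos t ht.1
  simp only [ω, h0, mul_zero, sub_zero] at hneg
  have hp : 0 < z₀ ^ b * Real.exp (-z₀) := by positivity
  have hm0 : m z₀ < 0 := by
    by_contra hcon
    have := mul_nonneg hp.le (mul_nonneg (not_lt.1 hcon) hdU)
    linarith
  rw [Real.Gamma_add_one ha.ne]
  have e : kummerM a b z₀ * (a * Real.Gamma a) = a * m z₀ := by simp only [m]; ring
  rw [e]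
  exact mul_pos_of_neg_of_neg ha hm0

/-! ### The profiles -/

/-- The profile with parameter `α`. -/
def profile (N : ℕ) (γ α η : ℝ) : ℝ := 1 + α * profileG N γ α η

lemma radialMean_congr {k : ℕ} {u v : ℝ → ℝ} {η : ℝ}
    (h : ∀ τ ∈ Set.Icc (0 : ℝ) 1, u (τ * η) = v (τ * η)) : radialMean k u η = radialMean k v η := by
  unfold radialMean
  apply intervalIntegral.integral_congr
  intro τ hτ
  rw [Set.uIcc_of_le zero_le_one] at hτ
  simp only [h τ hτ]

/-- Two functions on `(0, ∞)` with the same derivative and the same limit at `0` coincide. -/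
lemma eq_of_hasDerivAt_eq {f g f' : ℝ → ℝ} {l : ℝ} (hf : ∀ x, 0 < x → HasDerivAt f (f' x) x)
    (hg : ∀ x, 0 < x → HasDerivAt g (f' x) x) (hf0 : Tendsto f (𝓝[>] 0) (𝓝 l))
    (hg0 : Tendsto g (𝓝[>] 0) (𝓝 l)) {x : ℝ} (hx : 0 < x) : f x = g x := by
  have hd : ∀ y ∈ Set.Ioi (0 : ℝ), HasDerivAt (fun y => f y - g y) 0 y := fun y hy =>
    ((hf y hy).sub (hg y hy)).congr_deriv (sub_self _)
  have hlim := hf0.sub hg0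
  rw [sub_self] at hlim
  have hev : ∀ᶠ y in 𝓝[>] (0 : ℝ), f y - g y = f x - g x := by
    filter_upwards [self_mem_nhdsWithin] with y hy
    exact eq_of_hasDerivAt_zero (convex_Ioi 0) isOpen_Ioi hd hy hx
  have := tendsto_nhds_unique (hlim.congr' hev) tendsto_const_nhds
  linarith

section profile

variable {N : ℕ} {γ : ℝ} (hγ : -1 < γ) (hγ' : γ < 1)
include hγ hγ'

lemma hasDerivAt_profile (α η : ℝ) :
    HasDerivAt (profile N γ α) (α * profileH N γ α η) η :=
  ((hasDerivAt_profileG hγ hγ' α η).const_mul α).const_add 1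

lemma deriv_profile (α : ℝ) : deriv (profile N γ α) = fun η => α * profileH N γ α η :=
  funext fun η => (hasDerivAt_profile hγ hγ' α η).deriv

lemma profileW_eq_profile (α η : ℝ) :
    profileW N γ α η = profile N γ α η + η * profileH N γ α η := by
  rw [profileW_eq hγ hγ', profile]
  ring

lemma isProfile_profile (hN : 1 ≤ N) {α : ℝ} (hα : 0 < α) :
    IsProfile N γ α (profile N γ α) := by
  have hd := deriv_profile (N := N) hγ hγ' α
  refine ⟨by simp [profile, profileG], ?_, ?_, fun η _ =>
    (hasDerivAt_profile hγ hγ' α η).differentiableAt, fun η hη => ?_, fun η hη => ?_⟩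
  · have := (hasDerivAt_profile (N := N) hγ hγ' α 0).hasDerivWithinAt (s := Set.Ici 0)
    simpa [profileH] using this
  · rw [hd]
    have hc : Continuous fun η => α * profileH N γ α η :=
      continuous_const.mul (continuous_profileH_right hγ hγ' α)
    have := (hc.tendsto 0).mono_left (nhdsWithin_le_nhds (s := Set.Ioi 0))
    simpa [profileH] using this
  · rw [hd]
    exact ((hasDerivAt_profileH hγ hγ' hN α hη).const_mul α).differentiableAt
  · rw [hd, ((hasDerivAt_profileH hγ hγ' hN α hη).const_mul α).deriv]
    have e : α * profile N γ α η + η * (α * profileH N γ α η) = α * profileW N γ α η := by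
      rw [profileW_eq_profile hγ hγ']; ring
    have h := flux_mul (γ := γ) hα (profileW N γ α η)
    rw [flux] at h
    rw [e, h]
    ring

/-- A profile satisfies the integral equation, hence is the one constructed above. -/
lemma IsProfile.eqOn (hN : 1 ≤ N) {α : ℝ} (hα : 0 < α) {g : ℝ → ℝ} (hg : IsProfile N γ α g) :
    Set.EqOn g (profile N γ α) (Set.Ici 0) := by
  -- `u` is the function `W` of `g`, extended by a constant to the left of the origin
  let w : ℝ → ℝ := fun x => g x + x * deriv g x / α
  let u : ℝ → ℝ := fun η => w (max η 0)
  have hg0 : Tendsto g (𝓝[>] 0) (𝓝 1) := by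
    have := hg.initial_slope.continuousWithinAt.tendsto
    rw [hg.initial_value] at this
    exact this.mono_left (nhdsWithin_mono _ Set.Ioi_subset_Ici_self)
  have hw0 : Tendsto w (𝓝[>] 0) (𝓝 1) := by
    have hid : Tendsto (fun x : ℝ => x) (𝓝[>] 0) (𝓝 0) := nhdsWithin_le_nhds
    have := hg0.add ((hid.mul hg.slope_tendsto).div_const α)
    simpa using this
  have hwc : ContinuousOn w (Set.Ici 0) := by
    intro x hx
    rcases (Set.mem_Ici.1 hx).eq_or_lt with rfl | hx0
    · have hw00 : w 0 = 1 := by simp [w, hg.initial_value]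
      rw [← Set.Ioi_insert, continuousWithinAt_insert_self, ContinuousWithinAt, hw00]
      exact hw0
    · have h1 := (hg.differentiable x hx0).continuousAt
      have h2 := (hg.differentiable_deriv x hx0).continuousAt
      exact (h1.add ((continuousAt_id.mul h2).div_const α)).continuousWithinAt
  have hu : Continuous u :=
    hwc.comp_continuous (by fun_prop) fun x => le_max_right x 0
  have hflux : Continuous fun s => flux γ (u s) := (continuous_flux hγ hγ').comp hu
  have huw : ∀ x, 0 < x → u x = w x := fun x hx => by simp only [u, max_eq_left hx.le]
  have hcast : ((N - 1 : ℕ) : ℝ) = (N : ℝ) - 1 := by push_cast [hN]; ring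
  have hA := hflux.radialMean (N - 1)
  -- both sides have the derivative `x^(N-1) σ(u) u` and vanish at the origin
  have hslope : ∀ x, 0 < x →
      x ^ (N - 1) * deriv g x / α = x ^ (N - 1 + 1) * radialMean (N - 1) (fun s => flux γ (u s)) x := by
    intro x hx
    refine eq_of_hasDerivAt_eq (f := fun x => x ^ (N - 1) * deriv g x / α)
      (g := fun x => x ^ (N - 1 + 1) * radialMean (N - 1) (fun s => flux γ (u s)) x)
      (f' := fun x => x ^ (N - 1) * flux γ (u x)) (l := 0) (fun x hx => ?_)
      (fun x _ => hasDerivAt_pow_mul_radialMean (N - 1) hflux x) ?_ ?_ hx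
    · have d := ((hasDerivAt_pow (N - 1) x).mul
        (hg.differentiable_deriv x hx).hasDerivAt).div_const α
      refine d.congr_deriv ?_
      have h1 := hg.equation x hx
      have e1 : α * g x + x * deriv g x = α * u x := by
        rw [huw x hx]
        simp only [w]
        field_simp
      have h2 := flux_mul (γ := γ) hα (u x)
      rw [flux] at h2
      rw [e1, h2] at h1
      have hp : (((N - 1 : ℕ) : ℝ)) * x ^ (N - 1 - 1) = ((N : ℝ) - 1) / x * x ^ (N - 1) := by
        obtain ⟨n, rfl⟩ : ∃ n, N = n + 1 := ⟨N - 1, by omega⟩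
        rcases n with _ | n
        · simp
        · simp only [Nat.add_sub_cancel, pow_succ]
          push_cast
          field_simp
          ring
      rw [hp]
      have h3 : flux γ (u x) = (deriv (deriv g) x + ((N : ℝ) - 1) / x * deriv g x) / α := by
        rw [h1]; field_simp
      rw [h3]
      ring
    · have hid : Tendsto (fun x : ℝ => x ^ (N - 1)) (𝓝[>] 0) (𝓝 (0 ^ (N - 1))) :=
        ((continuous_pow (N - 1)).tendsto (0 : ℝ)).mono_left nhdsWithin_le_nhds
      have := (hid.mul hg.slope_tendsto).div_const α
      simpa using this
    · have hc : Continuous fun x : ℝ =>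
        x ^ (N - 1 + 1) * radialMean (N - 1) (fun s => flux γ (u s)) x := by fun_prop
      have := (hc.tendsto 0).mono_left (nhdsWithin_le_nhds (s := Set.Ioi 0))
      simpa using this
  have hderiv : ∀ x, 0 < x →
      deriv g x = α * (x * radialMean (N - 1) (fun s => flux γ (u s)) x) := by
    intro x hx
    have h1 := hslope x hx
    rw [div_eq_iff hα.ne', pow_succ] at h1
    have hp : x ^ (N - 1) ≠ 0 := by positivity
    apply mul_left_cancel₀ hp
    rw [h1]
    ring
  have hval : ∀ x, 0 < x → g x =
      1 + α * (x ^ 2 * radialMean 1 (radialMean (N - 1) fun s => flux γ (u s)) x) := by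
    intro x hx
    refine eq_of_hasDerivAt_eq (f := g) (f' := deriv g) (l := 1)
      (g := fun x => 1 + α * (x ^ 2 * radialMean 1 (radialMean (N - 1) fun s => flux γ (u s)) x))
      (fun x hx => (hg.differentiable x hx).hasDerivAt) (fun x hx => ?_) hg0 ?_ hx
    · have d := ((hasDerivAt_pow_mul_radialMean 1 hA x).const_mul α).const_add 1
      refine d.congr_deriv ?_
      rw [hderiv x hx, pow_one]
    · have hA2 := hA.radialMean 1
      have hc : Continuous fun x : ℝ =>
        1 + α * (x ^ 2 * radialMean 1 (radialMean (N - 1) fun s => flux γ (u s)) x) := by fun_prop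
      have := (hc.tendsto 0).mono_left (nhdsWithin_le_nhds (s := Set.Ioi 0))
      simpa using this
  have hfix : ∀ x, 0 ≤ x → u x = profileOp N γ α u x := by
    intro x hx
    rcases hx.eq_or_lt with rfl | hx0
    · simp [u, w, profileOp, hg.initial_value]
    · rw [huw x hx0]
      simp only [w]
      rw [hderiv x hx0, hval x hx0, profileOp]
      field_simp
      ring
  have huW : ∀ x, 0 ≤ x → u x = profileW N γ α x := by
    intro x hx
    have hsp := profileW_spec (N := N) hγ hγ' α
    have hG : Continuous fun η => η ^ 2 * radialMean 1 (radialMean (N - 1) fun s => flux γ (u s)) η := by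
      have := hA.radialMean 1
      fun_prop
    obtain ⟨B, hB⟩ := (isCompact_Icc (a := (0 : ℝ)) (b := x)).exists_bound_of_continuousOn
      hG.continuousOn
    have h := abs_sub_le_of_profileOp_eq N hγ hγ' (α := α) (α' := α) hu hsp.1
      (isCompact_Icc (a := (0 : ℝ)) (b := x))
      (fun η hη τ hτ => ⟨mul_nonneg hτ.1 hη.1, (mul_le_of_le_one_left hη.1 hτ.2).trans hη.2⟩)
      (fun η hη => hfix η hη.1) (fun η _ => hsp.2 η) le_rfl hB x ⟨hx, le_rfl⟩
    simp only [sub_self, abs_zero, zero_mul, mul_zero] at h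
    have := abs_nonpos_iff.1 h
    linarith
  intro x hx
  rcases (Set.mem_Ici.1 hx).eq_or_lt with rfl | hx0
  · simp [hg.initial_value, profile, profileG]
  · rw [hval x hx0, profile, profileG]
    congr 3
    refine radialMean_congr fun τ hτ => radialMean_congr fun σ hσ => ?_
    rw [huW _ (mul_nonneg hσ.1 (mul_nonneg hτ.1 hx0.le))]

lemma profile_zoneSol (hN : 1 ≤ N) {α : ℝ} {k : ℕ} {y : ℝ} (hy : IsNode N γ α k y)
    (hW : ∀ t, y < t → 0 < (-1) ^ k * profileW N γ α t) :
    ZoneSol N (zoneCoeff γ ((-1) ^ k)) α (Set.Ioi y) (profile N γ α)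
      (fun η => α * profileH N γ α η) := by
  refine ⟨fun η _ => hasDerivAt_profile hγ hγ' α η, fun η hη => ?_⟩
  have h0 : 0 < η := hy.nonneg.trans_lt hη
  refine ((hasDerivAt_profileH hγ hγ' hN α h0).const_mul α).congr_deriv ?_
  rw [flux_eq (neg_one_pow_eq k) (hW η hη).le, profileW_eq_profile hγ hγ']
  ring

/-- The profile and `W` decay fast for the same exponents. For `α = N - 2` this fails, because
`η^(-α)` is then a solution for which `W` vanishes. -/
lemma profile_decay_iff (hN : 1 ≤ N) {α : ℝ} (hα : 0 < α) (hαN : (N : ℝ) < α + 2) {k : ℕ} {y : ℝ}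
    (hy : IsNode N γ α k y) (hW : ∀ t, y < t → 0 < (-1) ^ k * profileW N γ α t) :
    Tendsto (fun η => η ^ α * profile N γ α η) atTop (𝓝 0) ↔
      Tendsto (fun η => η ^ (α + 2) * profileW N γ α η) atTop (𝓝 0) := by
  have hs := neg_one_pow_eq k
  have hc := zoneCoeff_pos hγ hγ' hs
  set c := zoneCoeff γ ((-1) ^ k) with hcd
  constructor
  · intro hdec
    obtain ⟨U, dU, hU⟩ := exists_isTricomiPair (((N : ℝ) - α) / 2) ((N : ℝ) / 2)
    obtain ⟨L, hL, h⟩ := (profile_zoneSol hγ hγ' hN hy hW).exists_tendsto hN hc hy.nonneg hU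
    obtain ⟨D, R, hRy, hD⟩ := h (tendsto_nhds_unique hL hdec)
    have t1 := tendsto_rpow_mul_of_gaussian hc (tendsto_gaussSol hc rfl hU.tendsto)
    have t2 := tendsto_rpow_mul_of_gaussian hc (tendsto_gaussSol hc rfl hU.deriv_tendsto)
    have t3 := ((t1 (α + 2)).const_mul D).add
      (((t2 (α + 2 + 2)).sub (t1 (α + 2 + 2))).const_mul (D * c / α))
    simp only [mul_zero, sub_zero, add_zero] at t3
    refine t3.congr' ?_
    filter_upwards [eventually_gt_atTop R] with η hη
    have h0 : 0 < η := hy.nonneg.trans_lt (hRy.trans_lt hη)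
    obtain ⟨h1, h2⟩ := hD η hη
    have h3 : profileH N γ α η = D * gaussSolDeriv c U dU η / α := by
      rw [← h2]; field_simp
    rw [profileW_eq_profile hγ hγ', h1, h3, Real.rpow_add h0 (α + 2) 2, Real.rpow_two]
    simp only [gaussSolDeriv, gaussSol]
    field_simp
  · intro hdec
    obtain ⟨U, dU, hU⟩ := exists_isTricomiPair (((N : ℝ) - (α + 2)) / 2) ((N : ℝ) / 2)
    obtain ⟨D, R, hRy, hD⟩ := eventually_eq_gaussSol_of_decay hγ hγ' hN hy hW hdec hU
    have t1 := tendsto_rpow_mul_of_gaussian hc (tendsto_gaussSol hc rfl hU.tendsto)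
    have t2 := tendsto_rpow_mul_of_gaussian hc (tendsto_gaussSol hc rfl hU.deriv_tendsto)
    have hμ : α + 2 - (N : ℝ) ≠ 0 := by linarith
    have t3 := ((t1 α).const_mul D).sub ((t2 (α + 2)).const_mul (D * c / (α + 2 - (N : ℝ))))
    simp only [mul_zero, sub_zero] at t3
    refine t3.congr' ?_
    filter_upwards [eventually_gt_atTop R] with η hη
    have h0 : 0 < η := hy.nonneg.trans_lt (hRy.trans_lt hη)
    obtain ⟨h1, h2⟩ := hD η hη
    -- the terms without `U'` cancel in `(α + 2 - N) h = W' + c η W`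
    have h3 : (α + 2 - N) * profileH N γ α η = D * (c * η * gaussSol c dU η) := by
      have e : (α + 2 - N) * profileH N γ α η = profileDW N γ α η + c * (η * profileW N γ α η) := by
        rw [profileDW, flux_eq hs (hW η (hRy.trans_lt hη)).le]
        ring
      rw [e, h1, h2]
      simp only [gaussSolDeriv, gaussSol]
      ring
    have h4 : profileH N γ α η = D * (c * η * gaussSol c dU η) / (α + 2 - N) := by
      rw [← h3]; field_simp
    have h5 : profile N γ α η = profileW N γ α η - η * profileH N γ α η := by
      rw [profileW_eq_profile hγ hγ']; ring
    rw [h5, h1, h4, ← hcd, Real.rpow_add h0, Real.rpow_two]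
    field_simp

/-- Without zeros of `W` the function `η^α f` increases. -/
lemma not_decay_of_pos {α : ℝ} (hα : 0 < α) (hW : ∀ t, 0 < t → 0 < profileW N γ α t) :
    ¬Tendsto (fun η => η ^ α * profile N γ α η) atTop (𝓝 0) := by
  intro hdec
  have hcont : Continuous fun η => η ^ α * profile N γ α η :=
    (Real.continuous_rpow_const hα.le).mul
      (continuous_iff_continuousAt.2 fun η => (hasDerivAt_profile hγ hγ' α η).continuousAt)
  have hmono : StrictMonoOn (fun η => η ^ α * profile N γ α η) (Set.Ici 0) := by
    refine strictMonoOn_of_hasDerivWithinAt_pos (convex_Ici 0) hcont.continuousOn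
      (f' := fun η => α * (η ^ α / η) * profileW N γ α η) (fun η hη => ?_) (fun η hη => ?_)
    · rw [interior_Ici] at hη
      have h0 : 0 < η := hη
      have d := (Real.hasDerivAt_rpow_const (x := η) (p := α) (Or.inl h0.ne')).mul
        (hasDerivAt_profile (N := N) hγ hγ' α η)
      refine (d.congr_deriv ?_).hasDerivWithinAt
      rw [Real.rpow_sub_one h0.ne', profileW_eq_profile hγ hγ']
      field_simp
    · rw [interior_Ici] at hη
      have h0 : 0 < η := hη
      have := hW η h0
      positivity
  have h1 := hmono (Set.mem_Ici.2 le_rfl) (Set.mem_Ici.2 zero_le_one) zero_lt_one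
  simp only [Real.zero_rpow hα.ne', zero_mul, Real.one_rpow, one_mul] at h1
  have h2 : profile N γ α 1 ≤ 0 := by
    refine ge_of_tendsto hdec ?_
    filter_upwards [eventually_ge_atTop 1] with η hη
    have := hmono.monotoneOn (Set.mem_Ici.2 zero_le_one)
      (Set.mem_Ici.2 (zero_le_one.trans hη)) hη
    simpa using this
  linarith

/-- Gaussian decay at the critical exponents. -/
lemma IsCritical.profile_isEquivalent (hN : 1 ≤ N) {α : ℝ} (hα : 0 < α) {m : ℕ}
    (h : IsCritical N γ α m) : ∃ D : ℝ, D ≠ 0 ∧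
      profile N γ α ~[atTop] fun η : ℝ =>
        D * (η ^ (α - (N : ℝ)) * Real.exp (-((1 + (-1) ^ m * γ) / 4) * η ^ 2)) := by
  obtain ⟨⟨y, hy, hW⟩, hdec⟩ := h
  have hαN := lt_of_mem_zeros hγ hγ' hN hy.mem_zeros
  have hfdec := (profile_decay_iff hγ hγ' hN hα hαN hy hW).2 hdec
  have hc := zoneCoeff_pos hγ hγ' (neg_one_pow_eq (m + 1))
  have hκ : zoneCoeff γ ((-1) ^ (m + 1)) / 2 = (1 + (-1) ^ m * γ) / 4 := by
    rw [zoneCoeff, pow_succ]; ring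
  set c := zoneCoeff γ ((-1) ^ (m + 1))
  obtain ⟨U, dU, hU⟩ := exists_isTricomiPair (((N : ℝ) - α) / 2) ((N : ℝ) / 2)
  obtain ⟨L, hL, hL0⟩ := (profile_zoneSol hγ hγ' hN hy hW).exists_tendsto hN hc hy.nonneg hU
  obtain ⟨D, R, hRy, hD⟩ := hL0 (tendsto_nhds_unique hL hfdec)
  have hD0 : D ≠ 0 := by
    rintro rfl
    have h1 := hD (R + 1) (lt_add_one R)
    simp only [zero_mul, mul_eq_zero, hα.ne', false_or] at h1
    have h2 := hW (R + 1) (by linarith)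
    rw [profileW_eq_profile hγ hγ', h1.1, h1.2] at h2
    simp at h2
  have hlim := tendsto_gaussSol hc (p := (N : ℝ) - α) (by ring) hU.tendsto
  set ℓ := (c / 2) ^ (-(((N : ℝ) - α) / 2)) * 1
  have hℓ : 0 < ℓ := by positivity
  refine ⟨D * ℓ, mul_ne_zero hD0 hℓ.ne', ?_⟩
  rw [isEquivalent_iff_tendsto_one]
  · have h1 := hlim.div_const ℓ
    rw [div_self hℓ.ne'] at h1
    refine h1.congr' ?_
    filter_upwards [eventually_gt_atTop R] with η hη
    have h0 : 0 < η := hy.nonneg.trans_lt (hRy.trans_lt hη)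
    have e1 : η ^ ((N : ℝ) - α) = (η ^ (α - (N : ℝ)))⁻¹ := by
      rw [← Real.rpow_neg h0.le]; ring_nf
    have e2 : Real.exp (c * η ^ 2 / 2)
        = (Real.exp (-((1 + (-1) ^ m * γ) / 4) * η ^ 2))⁻¹ := by
      rw [← Real.exp_neg, ← hκ]
      congr 1
      ring
    simp only [Pi.div_apply]
    rw [(hD η hη).1, e1, e2]
    have : η ^ (α - (N : ℝ)) ≠ 0 := by positivity
    field_simp
  · filter_upwards [eventually_gt_atTop 0] with η hη
    positivity

/-- Algebraic decay at all other exponents. -/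
lemma profile_isEquivalent_rpow (hN : 1 ≤ N) {α : ℝ} (hα : 0 < α)
    (h : ∀ m, ¬IsCritical N γ α m) :
    ∃ C : ℝ, C ≠ 0 ∧ profile N γ α ~[atTop] fun η : ℝ => C * η ^ (-α) := by
  obtain ⟨k, y, hy, hW⟩ := exists_last_node hγ hγ' hN α
  have hc := zoneCoeff_pos hγ hγ' (neg_one_pow_eq k)
  obtain ⟨U, dU, hU⟩ := exists_isTricomiPair (((N : ℝ) - α) / 2) ((N : ℝ) / 2)
  obtain ⟨L, hL, -⟩ := (profile_zoneSol hγ hγ' hN hy hW).exists_tendsto hN hc hy.nonneg hU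
  have hL0 : L ≠ 0 := by
    rintro rfl
    rcases k with _ | m
    · obtain rfl : y = 0 := hy
      exact not_decay_of_pos hγ hγ' hα (fun t ht => by simpa using hW t ht) hL
    · have hαN := lt_of_mem_zeros hγ hγ' hN hy.mem_zeros
      exact h m ⟨⟨y, hy, hW⟩, (profile_decay_iff hγ hγ' hN hα hαN hy hW).1 hL⟩
  refine ⟨L, hL0, ?_⟩
  rw [isEquivalent_iff_tendsto_one]
  · have h1 := hL.div_const L
    rw [div_self hL0] at h1
    refine h1.congr' ?_
    filter_upwards [eventually_gt_atTop 0] with η hη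
    simp only [Pi.div_apply]
    rw [Real.rpow_neg hη.le]
    have : η ^ α ≠ 0 := by positivity
    field_simp
  · filter_upwards [eventually_gt_atTop 0] with η hη
    positivity

/-! ### Characterization by special functions -/

lemma criticalRoots_eq {α : ℝ} (hα : 0 < α) :
    criticalRoots α (profile N γ α) = profileZeros N γ α := by
  ext η
  have e : η * deriv (profile N γ α) η + α * profile N γ α η = α * profileW N γ α η := by
    rw [deriv_profile hγ hγ', profileW_eq_profile hγ hγ']; ring
  simp only [criticalRoots, profileZeros, Set.mem_ofPred_eq, e, mul_eq_zero, hα.ne', false_or]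

omit hγ hγ' in
lemma IsNode.lt {α : ℝ} {j k : ℕ} (hjk : j < k) {x x' : ℝ} (hx : IsNode N γ α j x)
    (hx' : IsNode N γ α k x') : x < x' := by
  induction k, hjk using Nat.le_induction generalizing x' with
  | base =>
    obtain ⟨y, hy, hyx, -⟩ := hx'
    exact hx.unique hy ▸ hyx
  | succ k _ ih =>
    obtain ⟨y, hy, hyx, -⟩ := hx'
    exact (ih hy).trans hyx

omit hγ hγ' in
lemma IsNode.exists_of_mem {α : ℝ} {k : ℕ} {y z : ℝ} (hy : IsNode N γ α k y)
    (hz : z ∈ profileZeros N γ α) (hzy : z ≤ y) : ∃ j < k, IsNode N γ α (j + 1) z := by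
  induction k generalizing y with
  | zero =>
    have : y = 0 := hy
    have := hz.1
    linarith
  | succ k ih =>
    have hy' := hy
    obtain ⟨x, hx, hxy, h0, hp⟩ := hy
    rcases hzy.eq_or_lt with rfl | hlt
    · exact ⟨k, by omega, hy'⟩
    · rcases le_or_gt z x with h | h
      · obtain ⟨j, hj, hnj⟩ := ih hx h
        exact ⟨j, by omega, hnj⟩
      · have := hp z ⟨h, hlt⟩
        simp [hz.2] at this

/-- On the first zone `W` is given by Kummer's function. -/
lemma IsNode.kummerM_eq_zero (hN : 1 ≤ N) {α x : ℝ} (hx : IsNode N γ α 1 x) :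
    kummerM (((N : ℝ) - α) / 2 - 1) ((N : ℝ) / 2) ((1 - γ) / 4 * x ^ 2) = 0 := by
  have hz := hx.mem_zeros
  obtain ⟨y, hy, hyx, h0, hp⟩ := hx
  obtain rfl : y = 0 := hy
  have hb : 0 < (N : ℝ) / 2 := by
    have : (1 : ℝ) ≤ N := by exact_mod_cast hN
    linarith
  set a := ((N : ℝ) - α) / 2 - 1 with ha
  set b := (N : ℝ) / 2
  set c := zoneCoeff γ 1 with hcd
  have hc : 0 < c := zoneCoeff_pos hγ hγ' (Or.inl rfl)
  have ha2 : ((N : ℝ) - (α + 2)) / 2 = a := by rw [ha]; ring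
  have hY : ZoneSol N c (α + 2) (Set.Ioi 0) (gaussSol c (kummerM a b))
      (gaussSolDeriv c (kummerM a b) (kummerDeriv a b)) :=
    zoneSol_gaussSol hc (fun z _ => hasDerivAt_kummerM hb z) (fun z hz => by
      rw [ha2]; exact hasDerivAt_kummerDeriv hb hz)
  have hWs : ZoneSol N c (α + 2) (Set.Ioo 0 x) (profileW N γ α) (profileDW N γ α) :=
    profileW_zoneSol hγ hγ' hN α (Or.inl rfl) isOpen_Ioo (fun η hη => hη.1)
      (fun η hη => by simpa using hp η hη)
  set ω : ℝ → ℝ := fun η => zoneWeight N c η *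
    (profileW N γ α η * gaussSolDeriv c (kummerM a b) (kummerDeriv a b) η
      - profileDW N γ α η * gaussSol c (kummerM a b) η) with hω
  have hωc : Continuous ω := by
    have c1 := continuous_profileW_right (N := N) hγ hγ' α
    have c2 := continuous_profileDW_right (N := N) hγ hγ' α
    have c3 := continuous_zoneWeight N c
    have c4 := continuous_kummerM (a := a) hb
    have c5 := continuous_kummerDeriv (a := a) hb
    have c6 : Continuous (gaussSol c (kummerM a b)) := by unfold gaussSol; fun_prop
    have c7 : Continuous (gaussSolDeriv c (kummerM a b) (kummerDeriv a b)) := by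
      unfold gaussSolDeriv; fun_prop
    fun_prop
  have hω0 : ω 0 = 0 := by simp [hω, gaussSolDeriv, profileDW_zero]
  have hωx : ω x = 0 := by
    obtain ⟨t, -, ht⟩ := exists_hasDerivAt_eq_slope ω (fun _ => 0) hyx hωc.continuousOn
      (fun η hη => (hasDerivAt_wronskian hN hWs (hY.mono fun _ h => h.1) hη.1 hη).congr_deriv
        (by ring))
    rw [hω0, sub_zero, sub_zero, eq_comm, div_eq_zero_iff] at ht
    exact ht.resolve_right hyx.ne'
  have hp0 := zoneWeight_pos N c hyx
  simp only [hω, h0, zero_mul, zero_sub, mul_neg, neg_eq_zero, mul_eq_zero, hp0.ne', false_or,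
    profileDW_ne_zero hγ hγ' hN hz, gaussSol, (Real.exp_pos _).ne'] at hωx
  have e : c * x ^ 2 / 2 = (1 - γ) / 4 * x ^ 2 := by rw [hcd, zoneCoeff]; ring
  rwa [e] at hωx

/-- The Wronskian of `W` with a solution of the equation of the last zone is constant there. -/
lemma wronskian_last_zone (hN : 1 ≤ N) {α : ℝ} {k : ℕ} {y : ℝ} (hy : IsNode N γ α (k + 1) y)
    (hW : ∀ t, y < t → 0 < (-1) ^ (k + 1) * profileW N γ α t) {Y dY : ℝ → ℝ}
    (hY : ZoneSol N (zoneCoeff γ ((-1) ^ (k + 1))) (α + 2) (Set.Ioi 0) Y dY) {η : ℝ} (hη : y ≤ η) :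
    zoneWeight N (zoneCoeff γ ((-1) ^ (k + 1))) η *
      (profileW N γ α η * dY η - profileDW N γ α η * Y η) =
    -(zoneWeight N (zoneCoeff γ ((-1) ^ (k + 1))) y * (profileDW N γ α y * Y y)) := by
  have hz := hy.mem_zeros
  have hy0 : 0 < y := hz.1
  have hWs := profileW_zoneSol_last hγ hγ' hN hy hW
  set c := zoneCoeff γ ((-1) ^ (k + 1))
  set ω : ℝ → ℝ := fun η => zoneWeight N c η *
    (profileW N γ α η * dY η - profileDW N γ α η * Y η) with hω
  have hωy : ω y = -(zoneWeight N c y * (profileDW N γ α y * Y y)) := by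
    simp only [hω, hz.2]; ring
  rw [← hωy]
  rcases hη.eq_or_lt with rfl | hlt
  · rfl
  · have hcont : ContinuousOn ω (Set.Icc y η) := by
      intro t ht
      have ht0 : 0 < t := hy0.trans_le ht.1
      have c1 := (continuous_profileW_right (N := N) hγ hγ' α).continuousAt (x := t)
      have c2 := (continuous_profileDW_right (N := N) hγ hγ' α).continuousAt (x := t)
      have c3 := (continuous_zoneWeight N c).continuousAt (x := t)
      have c4 := (hY.fst t ht0).continuousAt
      have c5 := (hY.snd t ht0).continuousAt
      exact (c3.mul ((c1.mul c5).sub (c2.mul c4))).continuousWithinAt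
    obtain ⟨t, -, ht⟩ := exists_hasDerivAt_eq_slope ω (fun _ => 0) hlt hcont
      (fun t ht => (hasDerivAt_wronskian hN hWs
        (hY.mono (Set.Ioi_subset_Ioi hy0.le)) (hy0.trans ht.1) ht.1).congr_deriv (by ring))
    rw [eq_comm, div_eq_zero_iff] at ht
    rcases ht with h | h
    · exact sub_eq_zero.1 h
    · exact absurd h (by linarith)

/-- A solution of the equation of the last zone that vanishes at the last zero of `W` is a
multiple of `W` beyond it. -/
lemma eq_const_mul_of_eq_zero (hN : 1 ≤ N) {α : ℝ} {k : ℕ} {y : ℝ} (hy : IsNode N γ α (k + 1) y)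
    (hW : ∀ t, y < t → 0 < (-1) ^ (k + 1) * profileW N γ α t) {Y dY : ℝ → ℝ}
    (hY : ZoneSol N (zoneCoeff γ ((-1) ^ (k + 1))) (α + 2) (Set.Ioi 0) Y dY) (h0 : Y y = 0) :
    ∃ D, ∀ η, y < η → Y η = D * profileW N γ α η := by
  have hy0 : 0 < y := hy.mem_zeros.1
  have hne : ∀ η, y < η → profileW N γ α η ≠ 0 := fun η hη h => by
    have := hW η hη
    simp [h] at this
  have hd : ∀ η ∈ Set.Ioi y, HasDerivAt (fun η => Y η / profileW N γ α η) 0 η := by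
    intro η hη
    have hη' : y < η := hη
    have hη0 : 0 < η := hy0.trans hη
    have h1 := wronskian_last_zone hγ hγ' hN hy hW hY hη'.le
    rw [h0, mul_zero, mul_zero, neg_zero, mul_eq_zero] at h1
    have h2 := h1.resolve_left (zoneWeight_pos N _ hη0).ne'
    refine ((hY.fst η hη0).div (hasDerivAt_profileW hγ hγ' hN α hη0) (hne η hη')).congr_deriv ?_
    have e : dY η * profileW N γ α η - Y η * profileDW N γ α η = 0 := by linarith
    rw [e, zero_div]
  refine ⟨Y (y + 1) / profileW N γ α (y + 1), fun η hη => ?_⟩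
  have h1 := eq_of_hasDerivAt_zero (convex_Ioi y) isOpen_Ioi hd (Set.mem_Ioi.2 hη)
    (Set.mem_Ioi.2 (lt_add_one y))
  rw [← h1]
  have := hne η hη
  field_simp

/-- If Tricomi's function vanishes at the last zero of `W`, then `W` decays. -/
lemma decay_of_isTricomi (hN : 1 ≤ N) {α : ℝ} {m : ℕ} {y : ℝ} (hy : IsNode N γ α (m + 1) y)
    (hW : ∀ t, y < t → 0 < (-1) ^ (m + 1) * profileW N γ α t) {U : ℝ → ℝ}
    (hU : IsTricomi (((N : ℝ) - α) / 2 - 1) ((N : ℝ) / 2) U)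
    (h0 : U ((1 + (-1) ^ m * γ) / 4 * y ^ 2) = 0) :
    Tendsto (fun η => η ^ (α + 2) * profileW N γ α η) atTop (𝓝 0) := by
  have hc := zoneCoeff_pos hγ hγ' (neg_one_pow_eq (m + 1))
  have hκ : ∀ η : ℝ, zoneCoeff γ ((-1) ^ (m + 1)) * η ^ 2 / 2 = (1 + (-1) ^ m * γ) / 4 * η ^ 2 :=
    fun η => by rw [zoneCoeff, pow_succ]; ring
  set c := zoneCoeff γ ((-1) ^ (m + 1))
  have ha2 : ((N : ℝ) - (α + 2)) / 2 = ((N : ℝ) - α) / 2 - 1 := by ring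
  have hY : ZoneSol N c (α + 2) (Set.Ioi 0) (gaussSol c U) (gaussSolDeriv c U (deriv U)) :=
    zoneSol_gaussSol hc (fun z hz => (hU.differentiable z hz).hasDerivAt) (fun z hz => by
      refine (hU.differentiable_deriv z hz).hasDerivAt.congr_deriv ?_
      rw [ha2, eq_div_iff hz.ne']
      have := hU.equation z hz
      linarith)
  obtain ⟨D, hD⟩ := eq_const_mul_of_eq_zero hγ hγ' hN hy hW hY
    (by rw [gaussSol, hκ, h0, mul_zero])
  have hD0 : D ≠ 0 := by
    rintro rfl
    have h1 := tendsto_gaussSol hc rfl hU.normalization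
    have h2 : Tendsto (fun η : ℝ => η ^ (2 * (((N : ℝ) - α) / 2 - 1)) * Real.exp (c * η ^ 2 / 2)
        * gaussSol c U η) atTop (𝓝 0) := by
      refine tendsto_const_nhds.congr' ?_
      filter_upwards [eventually_gt_atTop y] with η hη
      rw [hD η hη]
      ring
    have h3 := tendsto_nhds_unique h1 h2
    have h4 : 0 < (c / 2) ^ (-(((N : ℝ) - α) / 2 - 1)) * 1 := by positivity
    linarith
  have h := (tendsto_rpow_mul_of_gaussian hc (tendsto_gaussSol hc rfl hU.normalization)
    (α + 2)).const_mul D⁻¹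
  rw [mul_zero] at h
  refine h.congr' ?_
  filter_upwards [eventually_gt_atTop y] with η hη
  rw [hD η hη]
  field_simp

/-- Conversely, if `W` decays, Tricomi's function vanishes at the last zero of `W`, and this is
its own last zero. -/
lemma IsCritical.tricomi_eq_zero (hN : 1 ≤ N) {α : ℝ} {m : ℕ} {y : ℝ}
    (hy : IsNode N γ α (m + 1) y)
    (hW : ∀ t, y < t → 0 < (-1) ^ (m + 1) * profileW N γ α t)
    (hdec : Tendsto (fun η => η ^ (α + 2) * profileW N γ α η) atTop (𝓝 0)) {U dU : ℝ → ℝ}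
    (hU : IsTricomiPair (((N : ℝ) - α) / 2 - 1) ((N : ℝ) / 2) U dU) :
    U ((1 + (-1) ^ m * γ) / 4 * y ^ 2) = 0 ∧
      ∀ z, (1 + (-1) ^ m * γ) / 4 * y ^ 2 < z → 0 < U z := by
  have hc := zoneCoeff_pos hγ hγ' (neg_one_pow_eq (m + 1))
  have hκ : ∀ η : ℝ, zoneCoeff γ ((-1) ^ (m + 1)) * η ^ 2 / 2 = (1 + (-1) ^ m * γ) / 4 * η ^ 2 :=
    fun η => by rw [zoneCoeff, pow_succ]; ring
  have hz := hy.mem_zeros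
  have hy0 : 0 < y := hz.1
  set c := zoneCoeff γ ((-1) ^ (m + 1)) with hcd
  have ha2 : ((N : ℝ) - α) / 2 - 1 = ((N : ℝ) - (α + 2)) / 2 := by ring
  rw [ha2] at hU
  have hY : ZoneSol N c (α + 2) (Set.Ioi 0) (gaussSol c U) (gaussSolDeriv c U dU) :=
    zoneSol_gaussSol hc hU.fst hU.snd
  obtain ⟨D, R, hRy, hD⟩ := eventually_eq_gaussSol_of_decay hγ hγ' hN hy hW hdec hU
  have h1 := wronskian_last_zone hγ hγ' hN hy hW hY (hRy.trans (lt_add_one R).le)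
  obtain ⟨h2, h3⟩ := hD (R + 1) (lt_add_one R)
  rw [h2, h3] at h1
  have h4 : zoneWeight N c y * (profileDW N γ α y * gaussSol c U y) = 0 := by
    rw [← neg_eq_zero, ← h1]; ring
  have hY0 : gaussSol c U y = 0 := by
    rw [mul_eq_zero, mul_eq_zero] at h4
    exact (h4.resolve_left (zoneWeight_pos N c hy0).ne').resolve_left
      (profileDW_ne_zero hγ hγ' hN hz)
  have hU0 : U (c * y ^ 2 / 2) = 0 := by
    rw [gaussSol, mul_eq_zero] at hY0
    exact hY0.resolve_left (Real.exp_pos _).ne'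
  refine ⟨by rwa [hκ] at hU0, fun z hzz => ?_⟩
  rw [← hκ] at hzz
  obtain ⟨E, hE⟩ := eq_const_mul_of_eq_zero hγ hγ' hN hy hW hY hY0
  -- `U` is positive near infinity, so the sign of `E W` is positive
  have hYpos : ∀ᶠ η in atTop, 0 < gaussSol c U η := by
    have hlim := tendsto_gaussSol hc rfl hU.tendsto
    filter_upwards [hlim.eventually (lt_mem_nhds (a := 0) (by positivity)),
      eventually_gt_atTop 0] with η h1 h2
    have : 0 < η ^ (2 * (((N : ℝ) - (α + 2)) / 2)) * Real.exp (c * η ^ 2 / 2) := by positivity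
    exact (mul_pos_iff_of_pos_left this).1 h1
  obtain ⟨t, ht1, ht2⟩ := (hYpos.and (eventually_gt_atTop y)).exists
  rw [hE t ht2] at ht1
  have hEs : 0 < (-1) ^ (m + 1) * E := by
    have h5 := hW t ht2
    rcases neg_one_pow_eq (m + 1) with h | h <;> rw [h] at h5 ⊢ <;> nlinarith
  set η := Real.sqrt (2 * z / c)
  have hz0 : 0 < z := lt_trans (by positivity) hzz
  have hηsq : η ^ 2 = 2 * z / c := Real.sq_sqrt (by positivity)
  have hηz : c * η ^ 2 / 2 = z := by rw [hηsq]; field_simp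
  have hyη : y < η := by
    rw [← hηz] at hzz
    have : y ^ 2 < η ^ 2 := by
      have h5 : c * y ^ 2 < c * η ^ 2 := by linarith
      exact lt_of_mul_lt_mul_left h5 hc.le
    exact lt_of_pow_lt_pow_left₀ 2 (Real.sqrt_nonneg _) this
  have h6 : 0 < gaussSol c U η := by
    rw [hE η hyη]
    have h7 := mul_pos hEs (hW η hyη)
    have e : (-1) ^ (m + 1) * E * ((-1) ^ (m + 1) * profileW N γ α η)
      = ((-1) ^ (m + 1) * (-1) ^ (m + 1)) * (E * profileW N γ α η) := by ring
    rwa [e, neg_one_pow_mul_self, one_mul] at h7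
  rw [gaussSol, hηz] at h6
  exact (mul_pos_iff_of_pos_left (Real.exp_pos _)).1 h6

lemma IsCritical.exponentSystem (hN : 1 ≤ N) {α : ℝ} (hα : 0 < α) {m : ℕ}
    (h : IsCritical N γ α m) : ExponentSystem N γ α m (profile N γ α) := by
  obtain ⟨⟨y, hy, hW⟩, hdec⟩ := h
  have hz := hy.mem_zeros
  have hαN := lt_of_mem_zeros hγ hγ' hN hz
  have hex : ∀ i : Fin (m + 1), ∃ x, IsNode N γ α (i + 1) x := fun i =>
    exists_node_of_le (by omega) ⟨y, hy⟩
  choose r hr using hex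
  have hlast : r (Fin.last m) = y := (hr (Fin.last m)).unique hy
  obtain ⟨U, dU, hU⟩ := exists_isTricomiPair (((N : ℝ) - α) / 2 - 1) ((N : ℝ) / 2)
  obtain ⟨hU0, hUpos⟩ := IsCritical.tricomi_eq_zero hγ hγ' hN hy hW hdec hU
  refine ⟨r, fun i j hij => (hr i).lt (by simpa using hij) (hr j), ?_,
    (hr 0).kummerM_eq_zero hγ hγ' hN, ⟨U, hU.isTricomi, by rw [hlast]; exact hU0⟩, fun hΓ => ?_⟩
  · rw [criticalRoots_eq hγ hγ' hα]
    ext z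
    constructor
    · rintro ⟨i, rfl⟩
      exact (hr i).mem_zeros
    · intro hz
      have hzy : z ≤ y := by
        by_contra hcon
        have := hW z (not_le.1 hcon)
        simp [hz.2] at this
      obtain ⟨j, hj, hjz⟩ := hy.exists_of_mem hz hzy
      exact ⟨⟨j, hj⟩, (hr ⟨j, hj⟩).unique hjz⟩
  · rw [hlast]
    have hb : 0 < (N : ℝ) / 2 := by
      have : (1 : ℝ) ≤ N := by exact_mod_cast hN
      linarith
    have hκ : 0 < (1 + (-1) ^ m * γ) / 4 := by
      rcases neg_one_pow_eq m with h | h <;> rw [h] <;> linarith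
    have hy0 : 0 < y := hz.1
    have e : ((N : ℝ) - α) / 2 = ((N : ℝ) - α) / 2 - 1 + 1 := by ring
    have := kummerM_mul_gamma_pos (by linarith) hb (fun l => by rw [← e]; exact hΓ l) hU
      (by positivity) hU0 hUpos
    rwa [← e] at this

lemma isCritical_of_exponentSystem (hN : 1 ≤ N) {α : ℝ} (hα : 0 < α) {m : ℕ}
    (h : ExponentSystem N γ α m (profile N γ α)) : IsCritical N γ α m := by
  obtain ⟨r, hmono, hrange, -, ⟨U, hU, hU0⟩, -⟩ := h
  rw [criticalRoots_eq hγ hγ' hα] at hrange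
  have hmem : ∀ i, r i ∈ profileZeros N γ α := fun i => hrange ▸ Set.mem_range_self i
  have hnode : ∀ j, ∀ hj : j < m + 1, IsNode N γ α (j + 1) (r ⟨j, hj⟩) := by
    intro j
    -- the next node after the `j`-th is one of the `r i` and at most `r j`, hence equal to it
    induction j with
    | zero =>
      intro hj
      obtain ⟨x, -, hxr, hx⟩ := IsNode.exists_succ (k := 0) (y := 0) (N := N) (α := α) hγ hγ' hN
        rfl (hmem ⟨0, hj⟩).1 (by rw [pow_zero, one_mul]; exact (hmem ⟨0, hj⟩).2.le)
      obtain ⟨i, rfl⟩ : x ∈ Set.range r := hrange ▸ hx.mem_zeros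
      have h1 : i ≤ ⟨0, hj⟩ := hmono.le_iff_le.1 hxr
      have h2 : i = ⟨0, hj⟩ := le_antisymm h1 (Fin.mk_le_of_le_val (Nat.zero_le _))
      rwa [h2] at hx
    | succ j ih =>
      intro hj
      have hprev := ih (by omega)
      obtain ⟨x, hyx, hxr, hx⟩ := hprev.exists_succ hγ hγ' hN
        (hmono (show (⟨j, by omega⟩ : Fin (m + 1)) < ⟨j + 1, hj⟩ from Nat.lt_succ_self j))
        (by simp [(hmem ⟨j + 1, hj⟩).2])
      obtain ⟨i, rfl⟩ : x ∈ Set.range r := hrange ▸ hx.mem_zeros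
      have h1 : i ≤ ⟨j + 1, hj⟩ := hmono.le_iff_le.1 hxr
      have h2 : (⟨j, by omega⟩ : Fin (m + 1)) < i := hmono.lt_iff_lt.1 hyx
      have h3 : i = ⟨j + 1, hj⟩ := by
        apply Fin.ext
        have h4 : (i : ℕ) ≤ j + 1 := h1
        have h5 : j < (i : ℕ) := h2
        simp only
        omega
      rwa [h3] at hx
  have hlast : IsNode N γ α (m + 1) (r (Fin.last m)) := hnode m (by omega)
  have hnot : ¬∃ x, IsNode N γ α (m + 1 + 1) x := by
    rintro ⟨x, hx⟩
    have hlt := hlast.lt (Nat.lt_succ_self _) hx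
    obtain ⟨i, rfl⟩ : x ∈ Set.range r := hrange ▸ hx.mem_zeros
    exact absurd (hmono.lt_iff_lt.1 hlt) (not_lt.2 (Fin.le_last i))
  have hW : ∀ t, r (Fin.last m) < t → 0 < (-1) ^ (m + 1) * profileW N γ α t := fun t ht =>
    hlast.pos_of_not_exists_succ hγ hγ' hN hnot ht
  exact ⟨⟨_, hlast, hW⟩, decay_of_isTricomi hγ hγ' hN hlast hW hU hU0⟩

end profile

end

theorem theorem1 (N : ℕ) (hN : 1 ≤ N) (γ : ℝ) (hγ : -1 < γ) (hγ' : γ < 1) :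
    ∃ f : ℝ → ℝ → ℝ,
      -- `f α` is the unique profile with parameter `α`
      (∀ α : ℝ, 0 < α → IsProfile N γ α (f α) ∧
        ∀ g : ℝ → ℝ, IsProfile N γ α g → Set.EqOn g (f α) (Set.Ici 0)) ∧
      ∃ a : ℕ → ℝ, 0 < a 0 ∧ StrictMono a ∧ Tendsto a atTop atTop ∧
        -- Gaussian decay at the exponents `a k`
        (∀ k : ℕ, ∃ D : ℝ, D ≠ 0 ∧
          f (a k) ~[atTop] fun η : ℝ =>
            D * (η ^ (a k - (N : ℝ)) * Real.exp (-((1 + (-1) ^ k * γ) / 4) * η ^ 2))) ∧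
        -- algebraic decay at all other exponents
        (∀ α : ℝ, 0 < α → α ∉ Set.range a →
          ∃ C : ℝ, C ≠ 0 ∧ f α ~[atTop] fun η : ℝ => C * η ^ (-α)) ∧
        -- characterization of the exponents through Kummer and Tricomi functions
        (∀ m : ℕ, ∀ α : ℝ, 0 < α → (α = a m ↔ ExponentSystem N γ α m (f α))) := by
  have hpos : ∀ k, 0 < criticalExponent N γ k := fun k =>
    (criticalExponent_zero_pos hγ hγ' hN).trans_le
      ((strictMono_criticalExponent hγ hγ' hN).monotone (Nat.zero_le k))
  refine ⟨profile N γ, fun α hα => ⟨isProfile_profile hγ hγ' hN hα, fun g hg =>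
    hg.eqOn hγ hγ' hN hα⟩, criticalExponent N γ, hpos 0, strictMono_criticalExponent hγ hγ' hN,
    tendsto_criticalExponent hγ hγ' hN, fun k => ?_, fun α hα hna => ?_, fun m α hα => ?_⟩
  · exact (isCritical_criticalExponent hγ hγ' hN k).profile_isEquivalent hγ hγ' hN (hpos k)
  · refine profile_isEquivalent_rpow hγ hγ' hN hα fun m hm => hna ⟨m, ?_⟩
    exact (hm.eq_criticalExponent hγ hγ' hN).symm
  · rw [eq_criticalExponent_iff hγ hγ' hN]
    exact ⟨fun h => h.exponentSystem hγ hγ' hN hα, isCritical_of_exponentSystem hγ hγ' hN hα⟩
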